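/- Let $d\ge 3$ and let $L^2=L^2(\mathbb R^d)$ be the complex Lebesgue space, $\langle f,g\rangle=\int_{\mathbb R^d} f\bar g\,dx$. For $\delta\ge 0$ a vector field $b:\mathbb R^d\to\mathbb R^d$ is *weakly form-bounded*, $b\in\mathbf F^{1/2}_\delta$, if $|b|\in L^1_{\rm loc}$ and there is $\lambda=\lambda_\delta>0$ with $$\big\||b|^{1/2}(\lambda-\Delta)^{-1/4}\big\|_{2\to2}\le\sqrt\delta .\qquad(*)$$ Put $b^{1/2}:=|b|^{-1/2}b$ (and $b^{1/2}:=0$ where $b=0$). Let $\mathcal W^{2,1}_{\rm loc}$ be the space of functions $u$ with $\varphi u\in (1-\Delta)^{-1}L^1(\mathbb R^d)$ for all $\varphi\in C_c^\infty(\mathbb R^d)$ (local Bessel potential space). A holomorphic semigroup $T$ is *quasi bounded* if $\|T(z)\|\le Me^{a\,{\rm Re}\,z}$ on some sector $\{z\ne0:|\arg z|<\theta\}$, $0<\theta\le\pi/2$. **Theorem.** Let $b\in\mathbf F^{1/2}_\delta$ with $0\le\delta<1$. There is an operator $\Lambda$ in $L^2$, a realization of $-\Delta+b\cdot\nabla$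 in the sense of (iv) and (v), such that $-\Lambda$ generates a quasi bounded holomorphic semigroup $e^{-t\Lambda}$ on $L^2$, and the following holds for every $\lambda>0$ satisfying $(*)$, with $\mathcal O:=\{\zeta\in\mathbb C:{\rm Re}\,\zeta\ge\lambda\}$. (i) $\mathcal O\subset\rho(-\Lambda)$. For $\zeta\in\mathcal O$ the operators $H:=|b|^{1/2}(\bar\zeta-\Delta)^{-1/4}$ and $S:=b^{1/2}\cdot\nabla(\zeta-\Delta)^{-3/4}$ are bounded on $L^2$, $\|H^*S\|_{2\to2}\le\delta$, $1+H^*S$ is boundedly invertible, and $$(\zeta+\Lambda)^{-1}=(\zeta-\Delta)^{-3/4}(1+H^*S)^{-1}(\zeta-\Delta)^{-1/4}.$$ (ii) For $\zeta\in\mathcal O$, $1+SH^*$ is boundedly invertible and $$(\zeta+\Lambda)^{-1}=(\zeta-\Delta)^{-1}-(\zeta-\Delta)^{-3/4}H^*(1+SH^*)^{-1}S(\zeta-\Delta)^{-1/4}.$$ (iii) $\|(\zeta+\Lambda)^{-1}\|_{2\to2}\le(1-\delta)^{-1}|\zeta|^{-1}$ for $\zeta\in\mathcal O$. (iv) If $f\in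 D(\Lambda)$, then $f\in W^{1,2}$, $b^{1/2}\cdot\nabla f\in L^2$, and for every $g\in W^{1,2}$ one has $|b|^{1/2}g\in L^2$ and $$\langle\Lambda f,g\rangle=\langle\nabla f,\nabla g\rangle+\langle b^{1/2}\cdot\nabla f,|b|^{1/2}g\rangle .$$ (v) If $f\in D(\Lambda)$, then $b\cdot\nabla f\in L^1_{\rm loc}$, $f\in\mathcal W^{2,1}_{\rm loc}$, and for every $\phi\in C_c^\infty(\mathbb R^d)$ $$\langle\Lambda f,\phi\rangle=\langle f,-\Delta\phi\rangle+\langle b\cdot\nabla f,\phi\rangle .$$ -/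

import Mathlib

open MeasureTheory Filter Topology
open scoped ENNReal ContDiff ComplexConjugate InnerProduct

namespace WeaklyFormBounded

noncomputable section

/-- Euclidean space `ℝ^d`. -/
abbrev Rd (d : ℕ) := EuclideanSpace ℝ (Fin d)

/-- The complex Lebesgue space `L²(ℝ^d)`. -/
abbrev L2 (d : ℕ) := Lp ℂ 2 (volume : Measure (Rd d))

/-! ### Powers of the resolvent of the Laplacian -/

open Classical in
/-- The Fourier multiplier `f ↦ 𝓕⁻¹ (m · 𝓕 f)` on `L²` with an essentially bounded symbol `m`
(and `0` when the symbol is not essentially bounded). -/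
def fourierMultiplierL2 {d : ℕ} (m : Rd d → ℂ) : L2 d →L[ℂ] L2 d :=
  if hm : MemLp m ∞ (volume : Measure (Rd d)) then
    ((Lp.fourierTransformₗᵢ (Rd d) ℂ).symm.toContinuousLinearEquiv : L2 d →L[ℂ] L2 d) ∘L
      ((ContinuousLinearMap.mul ℂ ℂ).holderL (volume : Measure (Rd d)) ∞ 2 2 hm.toLp) ∘L
      ((Lp.fourierTransformₗᵢ (Rd d) ℂ).toContinuousLinearEquiv : L2 d →L[ℂ] L2 d)
  else 0

/-- The symbol `(ζ + |2πξ|²)^(-α)` of `(ζ - Δ)^(-α)`, with the principal branch of the power. The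
Fourier transform is `𝓕 f(ξ) = ∫ exp(-2πi x·ξ) f(x) dx`, so that `-Δ` has the symbol `|2πξ|²`. -/
def resolventSymbol {d : ℕ} (ζ : ℂ) (α : ℝ) (ξ : Rd d) : ℂ :=
  (ζ + (((2 * Real.pi * ‖ξ‖) ^ 2 : ℝ) : ℂ)) ^ ((-α : ℝ) : ℂ)

/-- The operator `(ζ - Δ)^(-α)` on `L²(ℝ^d)`, for `Re ζ > 0` and `α ≥ 0`. -/
def resolventPow {d : ℕ} (ζ : ℂ) (α : ℝ) : L2 d →L[ℂ] L2 d :=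
  fourierMultiplierL2 (resolventSymbol ζ α)

/-- For `Re ζ > 0` and `α ≥ 0` the symbol of `(ζ - Δ)^(-α)` is bounded, so `resolventPow` is
the genuine operator. -/
theorem memLp_resolventSymbol {d : ℕ} {ζ : ℂ} (hζ : 0 < ζ.re) {α : ℝ} (hα : 0 ≤ α) :
    MemLp (resolventSymbol ζ α) ∞ (volume : Measure (Rd d)) := by
  have hre : ∀ ξ : Rd d, ζ.re ≤ (ζ + (((2 * Real.pi * ‖ξ‖) ^ 2 : ℝ) : ℂ)).re := by
    intro ξ
    rw [Complex.add_re, Complex.ofReal_re]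
    have := sq_nonneg (2 * Real.pi * ‖ξ‖)
    linarith
  refine memLp_top_of_bound (C := ζ.re ^ (-α)) ?_ ?_
  · apply Continuous.aestronglyMeasurable
    unfold resolventSymbol
    refine Continuous.cpow (by fun_prop) continuous_const ?_
    intro ξ
    exact Or.inl (lt_of_lt_of_le hζ (hre ξ))
  · refine Eventually.of_forall fun ξ => ?_
    have h0 : ζ + (((2 * Real.pi * ‖ξ‖) ^ 2 : ℝ) : ℂ) ≠ 0 := by
      intro h
      have := hre ξ
      rw [h, Complex.zero_re] at this
      linarith
    unfold resolventSymbol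
    rw [Complex.norm_cpow_real]
    exact Real.rpow_le_rpow_of_nonpos hζ ((hre ξ).trans (Complex.re_le_norm _)) (by linarith)

/-! ### Weakly form-bounded vector fields -/

/-- The bound `‖ |b|^(1/2) (lam - Δ)^(-1/4) ‖_{2 → 2} ≤ √δ`. -/
def WeakFormBound {d : ℕ} (b : Rd d → Rd d) (δ lam : ℝ) : Prop :=
  ∀ f : L2 d,
    eLpNorm (fun x => ((√‖b x‖ : ℝ) : ℂ) * (resolventPow (lam : ℂ) (1 / 4) f : L2 d) x) 2 volume
      ≤ ENNReal.ofReal (√δ) * ‖f‖ₑ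

/-- The class `F_δ^{1/2}` of weakly form-bounded vector fields: `|b| ∈ L¹_loc` and
`‖ |b|^(1/2) (λ - Δ)^(-1/4) ‖_{2 → 2} ≤ √δ` for some `λ > 0`. -/
def weakFormClass (d : ℕ) (δ : ℝ) : Set (Rd d → Rd d) :=
  {b | LocallyIntegrable b volume ∧ ∃ lam : ℝ, 0 < lam ∧ WeakFormBound b δ lam}

/-- The vector field `b^{1/2} = |b|^(-1/2) b` (equal to `0` where `b = 0`). -/
def sqrtField {d : ℕ} (b : Rd d → Rd d) (x : Rd d) : Rd d := (√‖b x‖)⁻¹ • b x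

/-- The bilinear product `a · w` of a real and a complex vector. -/
def dotC {d : ℕ} (a : Rd d) (w : EuclideanSpace ℂ (Fin d)) : ℂ := ∑ j, (a j : ℂ) * w j

/-! ### Weak gradients and function spaces -/

/-- `φ ∈ C_c^∞(ℝ^d)`, complex valued. -/
def IsTestFunction {d : ℕ} (φ : Rd d → ℂ) : Prop := ContDiff ℝ ∞ φ ∧ HasCompactSupport φ

/-- `w` is the weak gradient of `u`. -/
structure HasWeakGradient {d : ℕ} (u : Rd d → ℂ) (w : Rd d → EuclideanSpace ℂ (Fin d)) :
    Prop where
  locallyIntegrable : LocallyIntegrable u volume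
  locallyIntegrable_grad : LocallyIntegrable w volume
  integral_eq : ∀ φ : Rd d → ℂ, IsTestFunction φ → ∀ j : Fin d,
    ∫ x, u x * fderiv ℝ φ x (EuclideanSpace.single j 1) = - ∫ x, w x j * φ x

/-- `u` lies in the Sobolev space `W^{1,2}` and `w` is its weak gradient. -/
structure IsSobolevW12 {d : ℕ} (u : Rd d → ℂ) (w : Rd d → EuclideanSpace ℂ (Fin d)) : Prop where
  memLp : MemLp u 2 volume
  memLp_grad : MemLp w 2 volume
  hasWeakGradient : HasWeakGradient u w

/-- `u` lies locally in the Bessel potential space `𝒲^{s,p} = (1 - Δ)^(-s/2) L^p`, `s ≥ 0`: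
for every test function `φ`, the product `φ u` lies in `𝒲^{s,p}`. (The Fourier normalization of
`MemSobolev` replaces `1 - Δ` by `1 - (2π)⁻² Δ`, which gives the same space.) -/
def MemBesselPotentialLoc {d : ℕ} (s : ℝ) (p : ℝ≥0∞) [Fact (1 ≤ p)] (u : Rd d → ℂ) : Prop :=
  ∀ φ : Rd d → ℂ, IsTestFunction φ →
    ∃ v : Lp ℂ p (volume : Measure (Rd d)), v =ᵐ[volume] (fun x => φ x * u x) ∧
      TemperedDistribution.MemSobolev s p (Lp.toTemperedDistribution v)

/-! ### Unbounded operators and holomorphic semigroups -/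

section Semigroups

variable {X : Type*} [NormedAddCommGroup X] [NormedSpace ℂ X]

/-- `z` lies in the resolvent set of the operator `A`, and `R = (z - A)⁻¹`. -/
def IsResolventAt (A : X →ₗ.[ℂ] X) (z : ℂ) (R : X →L[ℂ] X) : Prop :=
  (∀ f : A.domain, R (z • (f : X) - A f) = f) ∧
    ∀ g : X, ∃ f : A.domain, (f : X) = R g ∧ z • (f : X) - A f = g

/-- The open sector `{z ≠ 0 : |arg z| < θ}`. -/
def sector (θ : ℝ) : Set ℂ := {z | z ≠ 0 ∧ |z.arg| < θ}

/-- `A` is the generator of the semigroup `T` on `[0, ∞)`: `f ∈ D(A)` and `A f = g` exactly when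
`t⁻¹ (T(t) f - f) → g` as `t ↓ 0`. -/
def IsGenerator (T : ℝ → X →L[ℂ] X) (A : X →ₗ.[ℂ] X) : Prop :=
  ∀ f g : X, (f, g) ∈ A.graph ↔
    Tendsto (fun t : ℝ => (t : ℂ)⁻¹ • (T t f - f)) (𝓝[>] 0) (𝓝 g)

/-- `T` is a holomorphic (analytic) strongly continuous semigroup on the sector of half-angle
`θ` which is quasi bounded: `‖T(z)‖ ≤ M e^{a Re z}` there. -/
structure IsQuasiBoundedHolomorphicSemigroup (θ M a : ℝ) (T : ℂ → X →L[ℂ] X) : Prop where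
  map_zero : T 0 = 1
  map_add : ∀ z ∈ sector θ, ∀ w ∈ sector θ, T (z + w) = T z ∘L T w
  holomorphic : DifferentiableOn ℂ T (sector θ)
  tendsto_zero : ∀ f : X, Tendsto (fun z => T z f) (𝓝[sector θ] 0) (𝓝 f)
  norm_le : ∀ z ∈ sector θ, ‖T z‖ ≤ M * Real.exp (a * z.re)

/-- `A` generates a quasi bounded holomorphic semigroup. -/
def GeneratesQuasiBoundedHolomorphicSemigroup (A : X →ₗ.[ℂ] X) : Prop :=
  ∃ (θ M a : ℝ) (T : ℂ → X →L[ℂ] X), 0 < θ ∧ θ ≤ Real.pi / 2 ∧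
    IsQuasiBoundedHolomorphicSemigroup θ M a T ∧ IsGenerator (fun t : ℝ => T (t : ℂ)) A

end Semigroups

/-! ### The operators `H` and `S` -/

/-- `H = |b|^(1/2) (conj ζ - Δ)^(-1/4)` as a bounded operator on `L²`. -/
def IsOperatorH {d : ℕ} (b : Rd d → Rd d) (ζ : ℂ) (H : L2 d →L[ℂ] L2 d) : Prop :=
  ∀ f : L2 d, H f =ᵐ[volume]
    fun x => ((√‖b x‖ : ℝ) : ℂ) * (resolventPow (conj ζ) (1 / 4) f : L2 d) x

/-- `S = b^{1/2} · ∇ (ζ - Δ)^(-3/4)` as a bounded operator on `L²`. -/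
def IsOperatorS {d : ℕ} (b : Rd d → Rd d) (ζ : ℂ) (S : L2 d →L[ℂ] L2 d) : Prop :=
  ∀ f : L2 d, ∃ w : Rd d → EuclideanSpace ℂ (Fin d),
    HasWeakGradient (resolventPow ζ (3 / 4) f : L2 d) w ∧
      S f =ᵐ[volume] fun x => dotC (sqrtField b x) (w x)

end

end WeaklyFormBounded

/-!
The operator `Λ` is defined by its graph: `Λ u = f` means that `u = (1 - Δ)^(-3/4) h` for some
`h ∈ L²` and `⟨f, g⟩ = ⟨∇u, ∇g⟩ + ⟨b^{1/2} · ∇u, |b|^{1/2} g⟩` for all `g ∈ W^{1,2}`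
(`IsWeakSolution`). This relation does not involve a spectral parameter, so all resolvents below
belong to one operator.

Fix `ζ` with `Re ζ ≥ lam`. On the Fourier side `|(ζ + |2πξ|²)^(-1)| ≤ (lam + |2πξ|²)^(-1)` and
`|2πξ| |ζ + |2πξ|²|^(-1/2) ≤ 1`, so the form bound for `|b|^{1/2} (lam - Δ)^(-1/4)` passes to both
`H = |b|^{1/2} (conj ζ - Δ)^(-1/4)` and `S = b^{1/2} · ∇ (ζ - Δ)^(-3/4)`, with norms at most `√δ`
(`exists_operatorH`, `exists_operatorS`). Writing `u = (ζ - Δ)^(-3/4) h` and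
`g = (conj ζ - Δ)^(-1/4) k`, the weak equation `(ζ + Λ) u = f` becomes
`(1 + H*S) h = (ζ - Δ)^(-1/4) f` (`isWeakSolution_iff`). As `‖H*S‖ ≤ δ < 1` this is solved by a
Neumann series, which gives the factorization of `(ζ + Λ)^(-1)`, its norm bound, and its dense
range; the second formula is the algebraic identity `(1 + H*S)^(-1) = 1 - H*(1 + SH*)^(-1)S`.

Generation follows from the resolvent bound `M / |ζ|` on a half-plane
(`generatesQuasiBoundedHolomorphicSemigroup_of_resolvent_le`). The Yosida approximants are bounded
operators `B` with the same kind of bound. For bounded `B`, the function `t exp(tB)` has the Laplace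
transform `(ζ - B)^(-2)`, which is integrable along vertical lines. Fourier inversion on a line
first shows that `exp(tB)` has no exponential growth (`exists_growth_of_pos`), and then, on the line
`Re ζ = 1/t`, bounds `exp(tB)` by a constant depending only on `M`; rotating `B` by a small angle
extends the bound to a sector (`norm_exp_le_of_mem_sector`). The exponentials of the approximants
then converge strongly, and the bounds survive in the limit.

The form identity for `f ∈ D(Λ)` is part of the definition, once `W^{1,2}` is identified with the
functions having a square integrable Fourier gradient. Testing it with test functions gives the
distributional identity, where `b · ∇f` is locally integrable as the product of
`|b|^{1/2} ∈ L²_loc` and `b^{1/2} · ∇f ∈ L²`. Finally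
`Δ(φf) = φΔf + 2∇φ · ∇f + fΔφ` is then integrable for each test function `φ`, which is the local
Bessel potential regularity (`memBesselPotentialLoc_of_weak`).
-/

namespace WeaklyFormBounded

noncomputable section

/-! ### Exponentials of bounded elements with a half-plane resolvent bound -/

section BoundedExponential

variable {𝔸 : Type*} [NormedRing 𝔸] [NormedAlgebra ℂ 𝔸] [CompleteSpace 𝔸]

/-- The resolvent `(ζ - b)⁻¹` exists and is bounded by `M / ‖ζ‖` on the open right half-plane. -/
def HalfPlaneBound (M : ℝ) (b : 𝔸) : Prop :=
  ∀ ζ : ℂ, 0 < ζ.re → ∃ r : 𝔸, (ζ • 1 - b) * r = 1 ∧ r * (ζ • 1 - b) = 1 ∧ ‖r‖ ≤ M / ‖ζ‖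

theorem exp_add_smul (b : 𝔸) (z w : ℂ) :
    NormedSpace.exp ((z + w) • b) = NormedSpace.exp (z • b) * NormedSpace.exp (w • b) := by
  let : NormedAlgebra ℚ 𝔸 := NormedAlgebra.restrictScalars ℚ ℂ 𝔸
  rw [add_smul]
  exact NormedSpace.exp_add_of_commute (((Commute.refl b).smul_left z).smul_right w)

theorem continuous_exp_smul (b : 𝔸) : Continuous fun z : ℂ => NormedSpace.exp (z • b) :=
  continuous_iff_continuousAt.2 fun z => (hasDerivAt_exp_smul_const (𝕂 := ℂ) b z).continuousAt

theorem hasDerivAt_comp_ofReal {E : Type*} [NormedAddCommGroup E] [NormedSpace ℂ E] {f : ℂ → E}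
    {f' : E} {t : ℝ} (hf : HasDerivAt f f' (t : ℂ)) :
    HasDerivAt (fun s : ℝ => f (s : ℂ)) f' t := by
  simpa [Function.comp_def] using hf.scomp t (Complex.ofRealCLM.hasDerivAt (x := t))

theorem hasDerivAt_exp_ofReal_smul (b : 𝔸) (t : ℝ) :
    HasDerivAt (fun s : ℝ => NormedSpace.exp ((s : ℂ) • b))
      (NormedSpace.exp ((t : ℂ) • b) * b) t :=
  hasDerivAt_comp_ofReal (hasDerivAt_exp_smul_const (𝕂 := ℂ) b (t : ℂ))

/-- The Laplace transform of `t ↦ t exp(t b)` is the square of the resolvent. -/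
theorem integral_mul_exp_eq_resolvent_sq {b r : 𝔸} {ζ : ℂ} {K γ : ℝ}
    (hr : (ζ • 1 - b) * r = 1) (hγ : γ < ζ.re)
    (hK : ∀ t : ℝ, 0 ≤ t → ‖NormedSpace.exp ((t : ℂ) • b)‖ ≤ K * Real.exp (γ * t)) :
    IntegrableOn (fun t : ℝ => Complex.exp (-(ζ * t)) • ((t : ℂ) • NormedSpace.exp ((t : ℂ) • b)))
        (Set.Ioi 0) ∧
      ∫ t in Set.Ioi (0 : ℝ), Complex.exp (-(ζ * t)) • ((t : ℂ) • NormedSpace.exp ((t : ℂ) • b))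
        = r * r := by
  set E : ℝ → 𝔸 := fun t => NormedSpace.exp ((t : ℂ) • b) with hE
  have hEc : Continuous E := (continuous_exp_smul b).comp Complex.continuous_ofReal
  have hK0 : 0 ≤ K := by
    have := (norm_nonneg _).trans (hK 0 le_rfl)
    simpa using this
  set a := ζ.re - γ with ha
  have ha0 : 0 < a := by rw [ha]; linarith
  have hne : ∀ t : ℝ, ‖Complex.exp (-(ζ * t))‖ = Real.exp (-(ζ.re * t)) := by
    intro t
    rw [Complex.norm_exp]
    simp
  have hbd : ∀ t : ℝ, 0 ≤ t → ‖Complex.exp (-(ζ * t)) • E t‖ ≤ K * Real.exp (-(a * t)) := by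
    intro t ht
    rw [norm_smul, hne]
    calc _ ≤ Real.exp (-(ζ.re * t)) * (K * Real.exp (γ * t)) := by gcongr; exact hK t ht
      _ = K * (Real.exp (-(ζ.re * t)) * Real.exp (γ * t)) := by ring
      _ = _ := by rw [← Real.exp_add, ha]; ring_nf
  have hint : IntegrableOn (fun t : ℝ => Complex.exp (-(ζ * t)) • ((t : ℂ) • E t))
      (Set.Ioi 0) := by
    have h1 : IntegrableOn (fun t : ℝ => (2 * K / a) * Real.exp (-(a / 2) * t)) (Set.Ioi 0) :=
      (exp_neg_integrableOn_Ioi 0 (by positivity)).const_mul _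
    refine Integrable.mono' h1 ?_ ?_
    · exact (Continuous.aestronglyMeasurable (by fun_prop))
    · refine (ae_restrict_iff' measurableSet_Ioi).2 (Eventually.of_forall fun t ht => ?_)
      have ht : 0 < t := ht
      rw [smul_comm, norm_smul, Complex.norm_real, Real.norm_of_nonneg ht.le]
      have h2 : t ≤ (2 / a) * Real.exp (a / 2 * t) := by
        have := Real.add_one_le_exp (a / 2 * t)
        calc t = (2 / a) * (a / 2 * t) := by field_simp
          _ ≤ _ := by gcongr; linarith
      calc t * ‖Complex.exp (-(ζ * t)) • E t‖
          ≤ ((2 / a) * Real.exp (a / 2 * t)) * (K * Real.exp (-(a * t))) :=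
            mul_le_mul h2 (hbd t ht.le) (norm_nonneg _) (by positivity)
        _ = (2 * K / a) * (Real.exp (a / 2 * t) * Real.exp (-(a * t))) := by ring
        _ = _ := by rw [← Real.exp_add]; ring_nf
  refine ⟨hint, ?_⟩
  -- the antiderivative that vanishes at infinity
  set G : ℝ → 𝔸 := fun t =>
    -(Complex.exp (-(ζ * t)) • (E t * ((t : ℂ) • r + r * r))) with hG
  have hderiv : ∀ t : ℝ, HasDerivAt G (Complex.exp (-(ζ * t)) • ((t : ℂ) • E t)) t := by
    intro t
    have h1 : HasDerivAt (fun t : ℝ => Complex.exp (-(ζ * t)))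
        (-(ζ * Complex.exp (-(ζ * t)))) t := by
      have : HasDerivAt (fun t : ℂ => Complex.exp (-(ζ * t)))
          (-(ζ * Complex.exp (-(ζ * t)))) (t : ℂ) := by
        have := (((hasDerivAt_id (t : ℂ)).const_mul ζ).neg).cexp
        simpa [mul_comm] using this
      exact hasDerivAt_comp_ofReal this
    have h2 : HasDerivAt (fun t : ℝ => (t : ℂ) • r + r * r) r t := by
      have : HasDerivAt (fun t : ℂ => t • r + r * r) r (t : ℂ) := by
        simpa using ((hasDerivAt_id (t : ℂ)).smul_const r).add_const (r * r)
      exact hasDerivAt_comp_ofReal this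
    have h3 := ((h1.smul ((hasDerivAt_exp_ofReal_smul b t).mul h2))).neg
    refine h3.congr_deriv ?_
    have hbr : b * r = ζ • r - 1 := by
      have := hr
      rw [sub_mul, smul_mul_assoc, one_mul] at this
      rw [← this]; abel
    change -(Complex.exp (-(ζ * t)) • (E t * b * ((t : ℂ) • r + r * r) + E t * r) +
      (-(ζ * Complex.exp (-(ζ * t)))) • (E t * ((t : ℂ) • r + r * r))) = _
    have h4 : E t * b * ((t : ℂ) • r + r * r) + E t * r
        = ζ • (E t * ((t : ℂ) • r + r * r)) - (t : ℂ) • E t := by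
      have : b * ((t : ℂ) • r + r * r) = ζ • ((t : ℂ) • r + r * r) - ((t : ℂ) • 1 + r) := by
        rw [mul_add, mul_smul_comm, ← mul_assoc, hbr, sub_mul, smul_mul_assoc, one_mul,
          smul_add, smul_sub, smul_comm (t : ℂ) ζ]
        abel
      rw [mul_assoc, this, mul_sub, mul_add (E t) ((t : ℂ) • 1) r, mul_smul_comm, mul_smul_comm,
        mul_one]
      abel
    rw [h4, smul_sub, neg_smul, mul_smul, smul_comm ζ (Complex.exp (-(ζ * t)))]
    abel
  have hlim : Tendsto G atTop (𝓝 0) := by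
    have h1 : Tendsto (fun t : ℝ => K * (‖r‖ * (t ^ (1 : ℝ) * Real.exp (-a * t)) +
        ‖r * r‖ * (t ^ (0 : ℝ) * Real.exp (-a * t)))) atTop (𝓝 0) := by
      have h := fun n : ℝ => tendsto_rpow_mul_exp_neg_mul_atTop_nhds_zero n a ha0
      simpa using (((h 1).const_mul ‖r‖).add ((h 0).const_mul ‖r * r‖)).const_mul K
    refine squeeze_zero_norm' ?_ h1
    filter_upwards [eventually_ge_atTop 0] with t ht
    rw [hG]
    simp only [norm_neg]
    rw [← smul_mul_assoc]
    calc _ ≤ ‖Complex.exp (-(ζ * t)) • E t‖ * ‖(t : ℂ) • r + r * r‖ := norm_mul_le _ _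
      _ ≤ (K * Real.exp (-(a * t))) * (t * ‖r‖ + ‖r * r‖) := by
        gcongr
        · exact hbd t ht
        · refine (norm_add_le _ _).trans ?_
          rw [norm_smul, Complex.norm_real, Real.norm_of_nonneg ht]
      _ = _ := by rw [Real.rpow_one, Real.rpow_zero, neg_mul]; ring
  rw [integral_Ioi_of_hasDerivAt_of_tendsto (f := G) (m := 0)
    (hderiv 0).continuousAt.continuousWithinAt (fun t _ => hderiv t) hint hlim]
  simp [hG, hE]

/-- If `‖exp(t b)‖` grows slower than `exp(c t)`, Fourier inversion on the line `Re ζ = c`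
bounds `t exp(t b)` by the integral of the squared resolvent over that line. -/
theorem norm_mul_exp_le_of_growth {b : 𝔸} {M K γ c : ℝ} (hb : HalfPlaneBound M b)
    (hc : 0 < c) (hγ : γ < c)
    (hK : ∀ t : ℝ, 0 ≤ t → ‖NormedSpace.exp ((t : ℂ) • b)‖ ≤ K * Real.exp (γ * t))
    {t : ℝ} (ht : 0 ≤ t) :
    t * ‖NormedSpace.exp ((t : ℂ) • b)‖ ≤ Real.exp (c * t) * (M ^ 2 / (2 * c)) := by
  set E : ℝ → 𝔸 := fun t => NormedSpace.exp ((t : ℂ) • b) with hE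
  have hEc : Continuous E := (continuous_exp_smul b).comp Complex.continuous_ofReal
  set f : ℝ → 𝔸 := fun t => Complex.exp (-((c : ℂ) * t)) • (((max t 0 : ℝ) : ℂ) • E t) with hf
  have hfc : Continuous f := by
    rw [hf]; fun_prop
  have hline : ∀ s : ℝ, ((c : ℂ) + 2 * Real.pi * s * Complex.I).re = c := by intro s; simp
  choose r hr hr' hrn using fun s : ℝ =>
    hb ((c : ℂ) + 2 * Real.pi * s * Complex.I) (by rw [hline s]; exact hc)
  have hL := fun s : ℝ => integral_mul_exp_eq_resolvent_sq (hr s) (by rw [hline s]; exact hγ) hK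
  have hsupp : Function.support f ⊆ Set.Ioi 0 := by
    intro t ht
    by_contra h
    apply ht
    have : max t 0 = 0 := max_eq_right (not_lt.1 h)
    simp only [hf, this]
    simp
  have hfi : Integrable f := by
    rw [← integrableOn_iff_integrable_of_support_subset hsupp]
    refine (hL 0).1.congr_fun ?_ measurableSet_Ioi
    intro t ht
    simp only [hf, max_eq_left (le_of_lt (show (0 : ℝ) < t from ht))]
    simp [hE]
  have hF : ∀ s : ℝ, FourierTransform.fourier f s = r s * r s := by
    intro s
    rw [Real.fourier_real_eq_integral_exp_smul, ← (hL s).2,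
      ← setIntegral_eq_integral_of_forall_compl_eq_zero (s := Set.Ioi (0 : ℝ))]
    · refine setIntegral_congr_fun measurableSet_Ioi ?_
      intro t ht
      simp only [hf, max_eq_left (le_of_lt (show (0 : ℝ) < t from ht))]
      rw [smul_smul, ← Complex.exp_add]
      congr 2
      push_cast
      ring
    · intro t ht
      have : f t = 0 := by
        by_contra h
        exact ht (hsupp h)
      rw [this, smul_zero]
  have hFn : ∀ s : ℝ, ‖FourierTransform.fourier f s‖ ≤
      (M ^ 2 / c ^ 2) * (1 + ((2 * Real.pi / c) * s) ^ 2)⁻¹ := by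
    intro s
    rw [hF]
    have h1 : ‖(c : ℂ) + 2 * Real.pi * s * Complex.I‖ ^ 2
        = c ^ 2 * (1 + ((2 * Real.pi / c) * s) ^ 2) := by
      rw [← Complex.normSq_eq_norm_sq, Complex.normSq_apply]
      simp
      field_simp
    calc ‖r s * r s‖ ≤ ‖r s‖ * ‖r s‖ := norm_mul_le _ _
      _ ≤ (M / ‖(c : ℂ) + 2 * Real.pi * s * Complex.I‖) *
          (M / ‖(c : ℂ) + 2 * Real.pi * s * Complex.I‖) :=
        mul_le_mul (hrn s) (hrn s) (norm_nonneg _) ((norm_nonneg _).trans (hrn s))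
      _ = M ^ 2 / ‖(c : ℂ) + 2 * Real.pi * s * Complex.I‖ ^ 2 := by
        rw [div_mul_div_comm]; ring
      _ = _ := by rw [h1]; field_simp
  have hπc : 0 < 2 * Real.pi / c := by positivity
  have hbi : Integrable fun s : ℝ => (M ^ 2 / c ^ 2) * (1 + ((2 * Real.pi / c) * s) ^ 2)⁻¹ :=
    ((integrable_comp_mul_left_iff (fun x : ℝ => (1 + x ^ 2)⁻¹) hπc.ne').2
      integrable_inv_one_add_sq).const_mul _
  have hFc : Continuous (FourierTransform.fourier f) :=
    VectorFourier.fourierIntegral_continuous Real.continuous_fourierChar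
      (innerSL ℝ).continuous₂ hfi
  have hFi : Integrable (FourierTransform.fourier f) :=
    hbi.mono' hFc.aestronglyMeasurable (Eventually.of_forall hFn)
  have hinv := congrFun (hfc.fourierInv_fourier_eq hfi hFi) t
  have hnorm : ‖f t‖ ≤ M ^ 2 / (2 * c) := by
    rw [← hinv, Real.fourierInv_eq']
    refine (norm_integral_le_integral_norm _).trans ?_
    calc _ ≤ ∫ s : ℝ, (M ^ 2 / c ^ 2) * (1 + ((2 * Real.pi / c) * s) ^ 2)⁻¹ := by
          refine integral_mono_of_nonneg (Eventually.of_forall fun s => norm_nonneg _) hbi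
            (Eventually.of_forall fun s => ?_)
          simp only
          rw [norm_smul, Complex.norm_exp_ofReal_mul_I, one_mul]
          exact hFn s
      _ = M ^ 2 / (2 * c) := by
          rw [integral_const_mul,
            Measure.integral_comp_mul_left (fun x : ℝ => (1 + x ^ 2)⁻¹) (2 * Real.pi / c),
            integral_univ_inv_one_add_sq, abs_of_pos (inv_pos.2 hπc), smul_eq_mul]
          field_simp
  have hft : ‖f t‖ = Real.exp (-(c * t)) * (t * ‖E t‖) := by
    simp only [hf, max_eq_left ht]
    rw [norm_smul, norm_smul, Complex.norm_exp, Complex.norm_real, Real.norm_of_nonneg ht]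
    simp
  rw [hft] at hnorm
  calc t * ‖E t‖ = Real.exp (c * t) * (Real.exp (-(c * t)) * (t * ‖E t‖)) := by
        rw [← mul_assoc, ← Real.exp_add]; simp
    _ ≤ _ := by gcongr

/-- A bound for `exp(t₀ b)` at one time `t₀` gives an exponential growth bound. -/
theorem exists_growth_of_norm_exp_le {b : 𝔸} {t₀ γ : ℝ} (ht₀ : 0 < t₀) (hγ : 0 ≤ γ)
    (h : ‖NormedSpace.exp ((t₀ : ℂ) • b)‖ ≤ Real.exp (γ * t₀)) :
    ∃ K : ℝ, ∀ t : ℝ, 0 ≤ t → ‖NormedSpace.exp ((t : ℂ) • b)‖ ≤ K * Real.exp (γ * t) := by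
  set E : ℝ → 𝔸 := fun t => NormedSpace.exp ((t : ℂ) • b) with hE
  have hEc : Continuous E := (continuous_exp_smul b).comp Complex.continuous_ofReal
  obtain ⟨K, hK⟩ := (isCompact_Icc (a := (0 : ℝ)) (b := t₀)).exists_bound_of_continuousOn
    hEc.continuousOn
  have hK0 : 0 ≤ K := (norm_nonneg _).trans (hK 0 ⟨le_rfl, ht₀.le⟩)
  refine ⟨K, ?_⟩
  have key : ∀ n : ℕ, ∀ t : ℝ, 0 ≤ t → t ≤ (n + 1) * t₀ → ‖E t‖ ≤ K * Real.exp (γ * t) := by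
    intro n
    induction n with
    | zero =>
      intro t h0 h1
      refine (hK t ⟨h0, by simpa using h1⟩).trans ?_
      exact le_mul_of_one_le_right hK0 (Real.one_le_exp (by positivity))
    | succ n ih =>
      intro t h0 h1
      rcases le_total t t₀ with h2 | h2
      · refine (hK t ⟨h0, h2⟩).trans ?_
        exact le_mul_of_one_le_right hK0 (Real.one_le_exp (by positivity))
      · have h3 : E t = E t₀ * E (t - t₀) := by
          simp only [hE]
          rw [← exp_add_smul]
          congr 2
          push_cast; ring
        have h4 := ih (t - t₀) (by linarith) (by push_cast at h1; linarith)
        calc ‖E t‖ ≤ ‖E t₀‖ * ‖E (t - t₀)‖ := by rw [h3]; exact norm_mul_le _ _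
          _ ≤ Real.exp (γ * t₀) * (K * Real.exp (γ * (t - t₀))) := by gcongr
          _ = K * (Real.exp (γ * t₀) * Real.exp (γ * (t - t₀))) := by ring
          _ = _ := by rw [← Real.exp_add]; ring_nf
  intro t ht
  obtain ⟨n, hn⟩ := exists_nat_ge (t / t₀)
  refine key n t ht ?_
  rw [div_le_iff₀ ht₀] at hn
  nlinarith

/-- The half-plane resolvent bound forces the exponential growth bound to be nonpositive: on the
line `Re ζ = γ` at a positive growth bound `γ` the inversion formula would give the decay
`exp(γ t) / t`, which improves `γ`. -/
theorem exists_growth_of_pos {b : 𝔸} {M : ℝ} (hb : HalfPlaneBound M b) {γ : ℝ} (hγ : 0 < γ) :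
    ∃ K : ℝ, ∀ t : ℝ, 0 ≤ t → ‖NormedSpace.exp ((t : ℂ) • b)‖ ≤ K * Real.exp (γ * t) := by
  set S : Set ℝ := {γ | 0 < γ ∧ ∃ K : ℝ, ∀ t : ℝ, 0 ≤ t →
    ‖NormedSpace.exp ((t : ℂ) • b)‖ ≤ K * Real.exp (γ * t)} with hS
  have hup : ∀ γ ∈ S, ∀ γ', γ ≤ γ' → γ' ∈ S := by
    rintro γ ⟨h0, K, hK⟩ γ' h
    refine ⟨h0.trans_le h, K, fun t ht => (hK t ht).trans ?_⟩
    have hK0 : 0 ≤ K := by simpa using (norm_nonneg _).trans (hK 0 le_rfl)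
    gcongr
  have hne : S.Nonempty := by
    refine ⟨‖NormedSpace.exp (((1 : ℝ) : ℂ) • b)‖ + 1, by positivity, ?_⟩
    refine exists_growth_of_norm_exp_le one_pos (by positivity) ?_
    have := Real.add_one_le_exp (‖NormedSpace.exp (((1 : ℝ) : ℂ) • b)‖ + 1)
    rw [mul_one]; linarith
  have hbdd : BddBelow S := ⟨0, fun γ h => h.1.le⟩
  set γ₀ := sInf S with hγ₀
  have hγ₀0 : 0 ≤ γ₀ := le_csInf hne fun γ h => h.1.le
  have hgt : ∀ c, γ₀ < c → c ∈ S := by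
    intro c hc
    obtain ⟨γ, h1, h2⟩ := (csInf_lt_iff hbdd hne).1 hc
    exact hup γ h1 c h2.le
  suffices γ₀ = 0 from (hgt γ (this ▸ hγ)).2
  by_contra h
  have hpos : 0 < γ₀ := lt_of_le_of_ne hγ₀0 (Ne.symm h)
  have hline : ∀ t : ℝ, 0 ≤ t →
      t * ‖NormedSpace.exp ((t : ℂ) • b)‖ ≤ Real.exp (γ₀ * t) * (M ^ 2 / (2 * γ₀)) := by
    intro t ht
    have hcont : Tendsto (fun c : ℝ => Real.exp (c * t) * (M ^ 2 / (2 * c))) (𝓝[>] γ₀)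
        (𝓝 (Real.exp (γ₀ * t) * (M ^ 2 / (2 * γ₀)))) := by
      have : ContinuousAt (fun c : ℝ => Real.exp (c * t) * (M ^ 2 / (2 * c))) γ₀ := by
        refine ContinuousAt.mul (by fun_prop) (ContinuousAt.div (by fun_prop) (by fun_prop) ?_)
        positivity
      exact this.tendsto.mono_left nhdsWithin_le_nhds
    refine ge_of_tendsto hcont ?_
    filter_upwards [self_mem_nhdsWithin] with c hc
    have hc : γ₀ < c := hc
    obtain ⟨-, K, hK⟩ := hgt ((γ₀ + c) / 2) (by linarith)
    exact norm_mul_exp_le_of_growth hb (hpos.trans hc) (by linarith) hK ht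
  -- at this time the bound is half of `exp (γ₀ t)`
  set t₀ := (M ^ 2 + 1) / γ₀ with ht₀
  have ht₀0 : 0 < t₀ := by positivity
  have h1 : ‖NormedSpace.exp ((t₀ : ℂ) • b)‖ ≤ Real.exp (γ₀ * t₀) / 2 := by
    have := hline t₀ ht₀0.le
    have h2 : M ^ 2 / (2 * γ₀) ≤ t₀ / 2 := by
      rw [ht₀, div_div, mul_comm γ₀ 2]
      gcongr
      linarith
    have h3 : t₀ * ‖NormedSpace.exp ((t₀ : ℂ) • b)‖ ≤ t₀ * (Real.exp (γ₀ * t₀) / 2) := by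
      refine this.trans ?_
      calc _ ≤ Real.exp (γ₀ * t₀) * (t₀ / 2) := by gcongr
        _ = _ := by ring
    exact le_of_mul_le_mul_left h3 ht₀0
  set κ := min (Real.log 2 / t₀) (γ₀ / 2) with hκ
  have hκ0 : 0 < κ := lt_min (div_pos (Real.log_pos one_lt_two) ht₀0) (by positivity)
  have hmem : γ₀ - κ ∈ S := by
    have h2 : κ ≤ γ₀ / 2 := min_le_right _ _
    refine ⟨by linarith, exists_growth_of_norm_exp_le ht₀0 (by linarith) (h1.trans ?_)⟩
    have h3 : κ * t₀ ≤ Real.log 2 := by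
      rw [← le_div_iff₀ ht₀0]; exact min_le_left _ _
    calc Real.exp (γ₀ * t₀) / 2 = Real.exp (γ₀ * t₀ - Real.log 2) := by
          rw [Real.exp_sub, Real.exp_log two_pos]
      _ ≤ _ := Real.exp_le_exp.2 (by nlinarith)
  have := csInf_le hbdd hmem
  linarith

/-- A half-plane resolvent bound controls `exp(t b)` uniformly in `t > 0`: integrate over the line
`Re ζ = t⁻¹`. -/
theorem norm_exp_le_of_halfPlaneBound {b : 𝔸} {M : ℝ} (hb : HalfPlaneBound M b) {t : ℝ}
    (ht : 0 < t) : ‖NormedSpace.exp ((t : ℂ) • b)‖ ≤ M ^ 2 * Real.exp 1 / 2 := by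
  obtain ⟨K, hK⟩ := exists_growth_of_pos hb (γ := t⁻¹ / 2) (by positivity)
  have h := norm_mul_exp_le_of_growth hb (c := t⁻¹) (by positivity)
    (half_lt_self (by positivity)) hK ht.le
  rw [inv_mul_cancel₀ ht.ne'] at h
  have h2 : t * ‖NormedSpace.exp ((t : ℂ) • b)‖ ≤ t * (M ^ 2 * Real.exp 1 / 2) := by
    refine h.trans (le_of_eq ?_)
    field_simp
  exact le_of_mul_le_mul_left h2 ht

/-- The half-plane bound is stable under small rotations, by a Neumann series. -/
theorem HalfPlaneBound.rotate {b : 𝔸} {M φ : ℝ} (hb : HalfPlaneBound M b) (hφ : M * |φ| ≤ 1 / 2) :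
    HalfPlaneBound (2 * M) (Complex.exp (φ * Complex.I) • b) := by
  intro ζ hζ
  obtain ⟨r, h1, h2, h3⟩ := hb ζ hζ
  have hζ0 : 0 < ‖ζ‖ := by
    refine norm_pos_iff.2 ?_
    rintro rfl
    simp at hζ
  set u := Complex.exp (φ * Complex.I) with hu
  have hu1 : ‖u‖ = 1 := Complex.norm_exp_ofReal_mul_I φ
  have hu0 : u ≠ 0 := Complex.exp_ne_zero _
  set ε : ℂ := (1 - u⁻¹) * ζ with hε
  have hεn : ‖ε‖ ≤ |φ| * ‖ζ‖ := by
    rw [hε, norm_mul]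
    gcongr
    have : 1 - u⁻¹ = u⁻¹ * (u - 1) := by field_simp
    rw [this, norm_mul, norm_inv, hu1, inv_one, one_mul, hu, mul_comm]
    exact Real.norm_exp_I_mul_ofReal_sub_one_le
  have hsmall : ‖ε • r‖ ≤ 1 / 2 := by
    rw [norm_smul]
    calc ‖ε‖ * ‖r‖ ≤ (|φ| * ‖ζ‖) * (M / ‖ζ‖) := by gcongr
      _ = M * |φ| := by field_simp
      _ ≤ 1 / 2 := hφ
  obtain ⟨q, hq1, hq2, hq3⟩ : ∃ q : 𝔸, (1 - ε • r) * q = 1 ∧ q * (1 - ε • r) = 1 ∧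
      ‖r * q‖ ≤ 2 * ‖r‖ := by
    set U := Units.oneSub (ε • r) (by linarith) with hU
    have hval : (U : 𝔸) = 1 - ε • r := Units.val_oneSub _ _
    have h5 : (1 - ε • r) * ↑U⁻¹ = 1 := by rw [← hval]; exact U.mul_inv
    refine ⟨↑U⁻¹, h5, by rw [← hval]; exact U.inv_mul, ?_⟩
    have h6 : r * (↑U⁻¹ : 𝔸) = r + (ε • r) * (r * ↑U⁻¹) := by
      have : (↑U⁻¹ : 𝔸) = 1 + (ε • r) * ↑U⁻¹ := by
        rw [sub_mul, one_mul] at h5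
        rw [← h5]; abel
      conv_lhs => rw [this]
      rw [mul_add, mul_one, smul_mul_assoc, smul_mul_assoc, mul_smul_comm]
    have h7 : ‖r * (↑U⁻¹ : 𝔸)‖ ≤ ‖r‖ + 1 / 2 * ‖r * (↑U⁻¹ : 𝔸)‖ := by
      calc ‖r * (↑U⁻¹ : 𝔸)‖ = ‖r + (ε • r) * (r * ↑U⁻¹)‖ := congrArg _ h6
        _ ≤ ‖r‖ + ‖ε • r‖ * ‖r * (↑U⁻¹ : 𝔸)‖ :=
          (norm_add_le _ _).trans (add_le_add le_rfl (norm_mul_le _ _))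
        _ ≤ _ := by gcongr
    linarith
  have hfac : ζ • (1 : 𝔸) - u • b = u • ((1 - ε • r) * (ζ • 1 - b)) := by
    rw [sub_mul, one_mul, smul_mul_assoc, h2, hε, sub_mul, sub_smul, one_mul]
    rw [show ζ • (1 : 𝔸) - b - (ζ • 1 - (u⁻¹ * ζ) • 1) = (u⁻¹ * ζ) • 1 - b by abel, smul_sub,
      smul_smul, mul_inv_cancel_left₀ hu0]
  refine ⟨u⁻¹ • (r * q), ?_, ?_, ?_⟩
  · rw [hfac, smul_mul_smul_comm, mul_inv_cancel₀ hu0, one_smul, mul_assoc, ← mul_assoc _ r q, h1,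
      one_mul, hq1]
  · rw [hfac, smul_mul_smul_comm, inv_mul_cancel₀ hu0, one_smul, mul_assoc, ← mul_assoc q, hq2,
      one_mul, h2]
  · rw [norm_smul, norm_inv, hu1, inv_one, one_mul]
    calc ‖r * q‖ ≤ 2 * ‖r‖ := hq3
      _ ≤ 2 * (M / ‖ζ‖) := by gcongr
      _ = _ := by ring

/-- Uniform bound for `exp(z b)` on a sector around the positive half-line. -/
theorem norm_exp_le_of_mem_sector {b : 𝔸} {M θ : ℝ} (hM : 0 ≤ M) (hb : HalfPlaneBound M b)
    (hθ : M * θ ≤ 1 / 2) {z : ℂ} (hz : z ∈ sector θ) :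
    ‖NormedSpace.exp (z • b)‖ ≤ 2 * M ^ 2 * Real.exp 1 := by
  have h1 : HalfPlaneBound (2 * M) (Complex.exp (z.arg * Complex.I) • b) :=
    hb.rotate ((mul_le_mul_of_nonneg_left hz.2.le hM).trans hθ)
  have h2 := norm_exp_le_of_halfPlaneBound h1 (norm_pos_iff.2 hz.1)
  rw [smul_smul, Complex.norm_mul_exp_arg_mul_I] at h2
  refine h2.trans (le_of_eq ?_)
  ring

end BoundedExponential

/-! ### Strong limits of exponentials -/

section StrongLimit

variable {X : Type*} [NormedAddCommGroup X] [NormedSpace ℂ X]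

/-- Uniformly bounded operators that converge strongly on a dense set converge strongly. -/
theorem tendsto_apply_of_dense {ι : Type*} {l : Filter ι} {F : ι → X →L[ℂ] X} {L : X →L[ℂ] X}
    {C : ℝ} (hF : ∀ᶠ i in l, ‖F i‖ ≤ C) {D : Set X} (hD : Dense D)
    (h : ∀ f ∈ D, Tendsto (fun i => F i f) l (𝓝 (L f))) (f : X) :
    Tendsto (fun i => F i f) l (𝓝 (L f)) := by
  rw [Metric.tendsto_nhds]
  intro ε hε
  set K := |C| + ‖L‖ + 1 with hK
  have hK0 : 0 < K := by positivity
  obtain ⟨g, hgD, hg⟩ := hD.exists_dist_lt f (show 0 < ε / 2 / K by positivity)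
  filter_upwards [hF, Metric.tendsto_nhds.1 (h g hgD) (ε / 2) (by positivity)] with i h1 h2
  rw [dist_eq_norm] at *
  have h3 : F i f - L f = F i (f - g) + (F i g - L g) - L (f - g) := by
    simp only [map_sub]; abel
  have h4 : ‖F i (f - g)‖ ≤ |C| * ‖f - g‖ :=
    (F i).le_of_opNorm_le (h1.trans (le_abs_self C)) _
  have h5 : ‖L (f - g)‖ ≤ ‖L‖ * ‖f - g‖ := L.le_opNorm _
  have h6 : K * ‖f - g‖ < ε / 2 := by
    rw [mul_comm]; exact (lt_div_iff₀ hK0).1 hg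
  calc ‖F i f - L f‖ ≤ ‖F i (f - g)‖ + ‖F i g - L g‖ + ‖L (f - g)‖ := by
        rw [h3]; exact (norm_sub_le _ _).trans (add_le_add (norm_add_le _ _) le_rfl)
    _ < ε := by
        have : (|C| + ‖L‖) * ‖f - g‖ ≤ K * ‖f - g‖ := by gcongr; linarith
        linarith

/-- A family of operators that is locally bounded and strongly holomorphic on a dense set is
holomorphic in the operator norm. -/
theorem differentiableOn_of_dense [CompleteSpace X] {U : Set ℂ} (hU : IsOpen U)
    {T : ℂ → X →L[ℂ] X} {C : ℝ}
    (hC : ∀ z ∈ U, ‖T z‖ ≤ C) {D : Set X} (hD : Dense D)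
    (h : ∀ f ∈ D, DifferentiableOn ℂ (fun z => T z f) U) : DifferentiableOn ℂ T U := by
  intro z₀ hz₀
  have hC0 : 0 ≤ C := (norm_nonneg _).trans (hC z₀ hz₀)
  obtain ⟨ρ, hρ, hball⟩ := Metric.isOpen_iff.1 hU z₀ hz₀
  set r := ρ / 3 with hr
  have hr0 : 0 < r := by positivity
  have hsub : ∀ z ∈ Metric.ball z₀ (2 * r), Metric.closedBall z (r / 2) ⊆ U := by
    intro z hz w hw
    apply hball
    rw [Metric.mem_ball] at *
    rw [Metric.mem_closedBall] at hw
    calc dist w z₀ ≤ dist w z + dist z z₀ := dist_triangle _ _ _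
      _ < ρ := by rw [hr] at *; linarith
  have hLip1 : ∀ f ∈ D, ∀ z ∈ Metric.ball z₀ (2 * r), ∀ w ∈ Metric.ball z₀ (2 * r),
      ‖T z f - T w f‖ ≤ (C / (r / 2)) * ‖f‖ * ‖z - w‖ := by
    intro f hf z hz w hw
    refine Convex.norm_image_sub_le_of_norm_deriv_le (𝕜 := ℂ) (f := fun z => T z f)
      (s := Metric.ball z₀ (2 * r)) ?_ ?_ (convex_ball _ _) hw hz
    · intro y hy
      exact (h f hf).differentiableAt
        (hU.mem_nhds (hsub y hy (Metric.mem_closedBall_self (by positivity))))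
    · intro y hy
      have := Complex.norm_deriv_le_of_forall_mem_sphere_norm_le (c := y) (R := r / 2)
        (f := fun z => T z f) (C := C * ‖f‖) (by positivity)
        (((h f hf).mono (hsub y hy)).diffContOnCl_ball subset_rfl)
        (fun x hx => (T x).le_of_opNorm_le
          (hC x (hsub y hy (Metric.sphere_subset_closedBall hx))) f)
      refine this.trans (le_of_eq ?_)
      ring
  have hLip : ∀ z ∈ Metric.ball z₀ (2 * r), ∀ w ∈ Metric.ball z₀ (2 * r),
      ‖T z - T w‖ ≤ (C / (r / 2)) * ‖z - w‖ := by
    intro z hz w hw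
    refine ContinuousLinearMap.opNorm_le_bound _ (by positivity) fun f => ?_
    have hcl : IsClosed {f : X | ‖(T z - T w) f‖ ≤ (C / (r / 2)) * ‖z - w‖ * ‖f‖} :=
      isClosed_le (by fun_prop) (by fun_prop)
    refine hcl.closure_subset_iff.2 ?_ (hD f)
    intro f hf
    have := hLip1 f hf z hz w hw
    simp only [Set.mem_ofPred_eq, sub_apply]
    linarith
  have hcont : ContinuousOn T (Metric.closedBall z₀ r) := by
    have : LipschitzOnWith (C / (r / 2)).toNNReal T (Metric.ball z₀ (2 * r)) := by
      refine LipschitzOnWith.of_dist_le_mul fun z hz w hw => ?_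
      rw [dist_eq_norm, dist_eq_norm, Real.coe_toNNReal _ (by positivity)]
      exact hLip z hz w hw
    exact this.continuousOn.mono (Metric.closedBall_subset_ball (by linarith))
  have hUr : Metric.closedBall z₀ r ⊆ U :=
    fun w hw => hball (Metric.closedBall_subset_ball (by linarith) hw)
  have hci : CircleIntegrable T z₀ r :=
    (hcont.mono Metric.sphere_subset_closedBall).circleIntegrable hr0.le
  have hcauchy : ∀ w ∈ Metric.ball z₀ r,
      T w = (2 * Real.pi * Complex.I : ℂ)⁻¹ • ∮ z in C(z₀, r), (z - w)⁻¹ • T z := by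
    intro w hw
    have hci' : CircleIntegrable (fun z => (z - w)⁻¹ • T z) z₀ r := by
      refine ContinuousOn.circleIntegrable hr0.le ?_
      refine ContinuousOn.smul (ContinuousOn.inv₀ (continuousOn_id.sub continuousOn_const) ?_)
        (hcont.mono Metric.sphere_subset_closedBall)
      intro z hz h0
      have h0 : z = w := sub_eq_zero.1 h0
      rw [h0, Metric.mem_sphere] at hz
      rw [Metric.mem_ball, hz] at hw
      exact lt_irrefl _ hw
    refine ContinuousLinearMap.ext fun f => ?_
    refine congrFun (Continuous.ext_on hD (T w).continuous
      (ContinuousLinearMap.continuous _) fun f hf => ?_) f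
    have h1 := ((h f hf).mono hUr).circleIntegral_sub_inv_smul hw
    have h2 : (∮ z in C(z₀, r), (z - w)⁻¹ • T z) f = ∮ z in C(z₀, r), (z - w)⁻¹ • T z f := by
      simp only [circleIntegral]
      rw [ContinuousLinearMap.intervalIntegral_apply]
      · rfl
      · exact hci'.out
    rw [smul_apply, h2, h1, inv_smul_smul₀]
    simp [Real.pi_ne_zero, Complex.I_ne_zero]
  have hps := hasFPowerSeriesOn_cauchy_integral (R := r.toNNReal) (c := z₀) (f := T)
    (by rwa [Real.coe_toNNReal _ hr0.le]) (by simpa using hr0)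
  have hd := hps.differentiableOn z₀ (by simpa using hr0)
  rw [Real.coe_toNNReal _ hr0.le] at hd
  have hd' : DifferentiableAt ℂ
      (fun w => (2 * Real.pi * Complex.I : ℂ)⁻¹ • ∮ z in C(z₀, r), (z - w)⁻¹ • T z) z₀ := by
    refine hd.differentiableAt ?_
    exact Metric.isOpen_eball.mem_nhds (by simpa using hr0)
  refine (hd'.congr_of_eventuallyEq ?_).differentiableWithinAt
  filter_upwards [Metric.ball_mem_nhds z₀ hr0] with w hw using hcauchy w hw

theorem isOpen_sector {θ : ℝ} (hθ : θ ≤ Real.pi) : IsOpen (sector θ) := by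
  have : sector θ = Complex.slitPlane ∩ Complex.arg ⁻¹' {x | |x| < θ} := by
    ext z
    simp only [sector, Set.mem_ofPred_eq, Set.mem_inter_iff, Complex.mem_slitPlane_iff_arg,
      Set.mem_preimage]
    constructor
    · rintro ⟨h1, h2⟩
      refine ⟨⟨fun h => ?_, h1⟩, h2⟩
      rw [h, abs_of_pos Real.pi_pos] at h2
      linarith
    · rintro ⟨⟨-, h1⟩, h2⟩
      exact ⟨h1, h2⟩
  rw [this]
  refine ContinuousOn.isOpen_inter_preimage ?_ Complex.isOpen_slitPlane
    (isOpen_lt continuous_abs continuous_const)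
  intro z hz
  exact (Complex.continuousAt_arg hz).continuousWithinAt

theorem ofReal_mul_mem_sector {θ : ℝ} {z : ℂ} (hz : z ∈ sector θ) {s : ℝ} (hs : 0 < s) :
    (s : ℂ) * z ∈ sector θ := by
  refine ⟨mul_ne_zero (by exact_mod_cast hs.ne') hz.1, ?_⟩
  rw [Complex.arg_real_mul _ hs]
  exact hz.2

theorem ofReal_mem_sector {θ : ℝ} (hθ : 0 < θ) {s : ℝ} (hs : 0 < s) : (s : ℂ) ∈ sector θ := by
  refine ⟨by exact_mod_cast hs.ne', ?_⟩
  rw [Complex.arg_ofReal_of_nonneg hs.le, abs_zero]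
  exact hθ

variable [CompleteSpace X]

/-- Duhamel comparison of the exponentials of two commuting operators. -/
theorem norm_exp_sub_exp_apply_le {B₁ B₂ : X →L[ℂ] X} (hcomm : Commute B₁ B₂) {C : ℝ} {z : ℂ}
    (h₁ : ∀ s ∈ Set.Icc (0 : ℝ) 1, ‖NormedSpace.exp (((s : ℂ) * z) • B₁)‖ ≤ C)
    (h₂ : ∀ s ∈ Set.Icc (0 : ℝ) 1, ‖NormedSpace.exp (((s : ℂ) * z) • B₂)‖ ≤ C) (f : X) :
    ‖NormedSpace.exp (z • B₁) f - NormedSpace.exp (z • B₂) f‖ ≤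
      C * (C * (‖z‖ * ‖B₁ f - B₂ f‖)) := by
  have hC0 : 0 ≤ C := (norm_nonneg _).trans (h₁ 0 ⟨le_rfl, zero_le_one⟩)
  set Φ : ℝ → X := fun s => (NormedSpace.exp (((s : ℂ) * z) • B₁) *
    NormedSpace.exp ((((1 - s : ℝ) : ℂ) * z) • B₂)) f with hΦ
  have hd : ∀ s : ℝ, HasDerivAt Φ ((NormedSpace.exp (((s : ℂ) * z) • B₁) *
      NormedSpace.exp ((((1 - s : ℝ) : ℂ) * z) • B₂)) (z • (B₁ f - B₂ f))) s := by
    intro s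
    have e1 : HasDerivAt (fun s : ℝ => NormedSpace.exp (((s : ℂ) * z) • B₁))
        (NormedSpace.exp (((s : ℂ) * z) • B₁) * (z • B₁)) s := by
      have := hasDerivAt_exp_ofReal_smul (z • B₁) s
      simpa only [smul_smul] using this
    have e2 : HasDerivAt (fun s : ℝ => NormedSpace.exp ((((1 - s : ℝ) : ℂ) * z) • B₂))
        (-((z • B₂) * NormedSpace.exp ((((1 - s : ℝ) : ℂ) * z) • B₂))) s := by
      have := (hasDerivAt_exp_smul_const' (𝕂 := ℂ) (z • B₂) ((1 - s : ℝ) : ℂ))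
      have h3 := hasDerivAt_comp_ofReal this
      have h4 := h3.scomp s ((hasDerivAt_id s).const_sub 1)
      simpa only [smul_smul, Function.comp_def, neg_smul, one_smul, id] using h4
    have e3 := e1.mul e2
    have e4 :=
      ((ContinuousLinearMap.apply ℂ X f).restrictScalars ℝ).hasFDerivAt.comp_hasDerivAt s e3
    refine e4.congr_deriv ?_
    have hc : (z • B₂) * NormedSpace.exp ((((1 - s : ℝ) : ℂ) * z) • B₂) =
        NormedSpace.exp ((((1 - s : ℝ) : ℂ) * z) • B₂) * (z • B₂) :=
      (((Commute.refl B₂).smul_left z).smul_right _).exp_right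
    have hc' : (z • B₁) * NormedSpace.exp ((((1 - s : ℝ) : ℂ) * z) • B₂) =
        NormedSpace.exp ((((1 - s : ℝ) : ℂ) * z) • B₂) * (z • B₁) :=
      ((hcomm.smul_left z).smul_right _).exp_right
    have : NormedSpace.exp (((s : ℂ) * z) • B₁) * (z • B₁) *
          NormedSpace.exp ((((1 - s : ℝ) : ℂ) * z) • B₂) +
        NormedSpace.exp (((s : ℂ) * z) • B₁) *
          -((z • B₂) * NormedSpace.exp ((((1 - s : ℝ) : ℂ) * z) • B₂)) =
        NormedSpace.exp (((s : ℂ) * z) • B₁) * NormedSpace.exp ((((1 - s : ℝ) : ℂ) * z) • B₂) *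
          (z • B₁ - z • B₂) := by
      rw [hc, mul_assoc, hc', mul_sub, mul_neg, mul_assoc, mul_assoc, ← sub_eq_add_neg]
    change (NormedSpace.exp (((s : ℂ) * z) • B₁) * (z • B₁) *
          NormedSpace.exp ((((1 - s : ℝ) : ℂ) * z) • B₂) +
        NormedSpace.exp (((s : ℂ) * z) • B₁) *
          -((z • B₂) * NormedSpace.exp ((((1 - s : ℝ) : ℂ) * z) • B₂))) f = _
    rw [this, smul_sub]
    rfl
  have hmv := norm_image_sub_le_of_norm_deriv_le_segment_01' (f := Φ)
    (C := C * (C * (‖z‖ * ‖B₁ f - B₂ f‖))) (fun s _ => (hd s).hasDerivWithinAt) ?_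
  · have e0 : Φ 0 = NormedSpace.exp (z • B₂) f := by
      simp [hΦ]
    have e1 : Φ 1 = NormedSpace.exp (z • B₁) f := by
      simp [hΦ]
    rwa [e0, e1] at hmv
  · intro s hs
    refine (ContinuousLinearMap.le_of_opNorm_le _
      (h₁ s ⟨hs.1, hs.2.le⟩) _).trans (mul_le_mul_of_nonneg_left ?_ hC0)
    refine (ContinuousLinearMap.le_of_opNorm_le _
      (h₂ (1 - s) ⟨by linarith [hs.2], by linarith [hs.1]⟩) _).trans
      (mul_le_mul_of_nonneg_left ?_ hC0)
    rw [norm_smul]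

/-- First order expansion of the exponential of a bounded operator on an element. -/
theorem norm_exp_sub_sub_smul_le {B : X →L[ℂ] X} {t K : ℝ} (ht : 0 ≤ t) {f g : X}
    (h : ∀ s ∈ Set.Ico (0 : ℝ) t, ‖NormedSpace.exp ((s : ℂ) • B) (B f) - g‖ ≤ K) :
    ‖NormedSpace.exp ((t : ℂ) • B) f - f - (t : ℂ) • g‖ ≤ K * t := by
  have hd : ∀ s : ℝ, HasDerivAt (fun s : ℝ => NormedSpace.exp ((s : ℂ) • B) f - (s : ℂ) • g)
      (NormedSpace.exp ((s : ℂ) • B) (B f) - g) s := by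
    intro s
    have e1 := ((ContinuousLinearMap.apply ℂ X f).restrictScalars ℝ).hasFDerivAt.comp_hasDerivAt s
      (hasDerivAt_exp_ofReal_smul B s)
    have e2 : HasDerivAt (fun s : ℝ => (s : ℂ) • g) g s :=
      hasDerivAt_comp_ofReal (by simpa using (hasDerivAt_id (s : ℂ)).smul_const g)
    exact e1.sub e2
  have := norm_image_sub_le_of_norm_deriv_le_segment' (fun s _ => (hd s).hasDerivWithinAt) h t
    ⟨ht, le_rfl⟩
  simpa [NormedSpace.exp_zero, sub_right_comm] using this

/-- If commuting bounded operators `B n` have exponentials bounded uniformly on a sector and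
converge strongly on a dense set to `A`, then the exponentials converge strongly to a bounded
holomorphic semigroup, whose derivative at `0` extends `A`. -/
theorem exists_semigroup_of_tendsto {B : ℕ → X →L[ℂ] X} (hcomm : ∀ n m, Commute (B n) (B m))
    {C θ : ℝ} (hC : 1 ≤ C) (hθ0 : 0 < θ) (hθ : θ ≤ Real.pi / 2)
    (hB : ∀ n, ∀ z ∈ sector θ, ‖NormedSpace.exp (z • B n)‖ ≤ C)
    {D : Set X} (hD : Dense D) {A : X → X}
    (hA : ∀ f ∈ D, Tendsto (fun n => B n f) atTop (𝓝 (A f))) :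
    ∃ T : ℂ → X →L[ℂ] X, IsQuasiBoundedHolomorphicSemigroup θ C 0 T ∧
      (∀ z ∈ sector θ, ∀ f, Tendsto (fun n => NormedSpace.exp (z • B n) f) atTop (𝓝 (T z f))) ∧
      ∀ f ∈ D, Tendsto (fun t : ℝ => (t : ℂ)⁻¹ • (T t f - f)) (𝓝[>] 0) (𝓝 (A f)) := by
  have hone : ‖(1 : X →L[ℂ] X)‖ ≤ C := (ContinuousLinearMap.norm_id_le).trans hC
  have hB' : ∀ n, ∀ z ∈ sector θ, ∀ s ∈ Set.Icc (0 : ℝ) 1,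
      ‖NormedSpace.exp (((s : ℂ) * z) • B n)‖ ≤ C := by
    intro n z hz s hs
    rcases hs.1.eq_or_lt with h | h
    · rw [← h, Complex.ofReal_zero, zero_mul, zero_smul, NormedSpace.exp_zero]
      exact hone
    · exact hB n _ (ofReal_mul_mem_sector hz h)
  have hdiff : ∀ n m, ∀ z ∈ sector θ, ∀ f, ‖NormedSpace.exp (z • B n) f -
      NormedSpace.exp (z • B m) f‖ ≤ C * (C * (‖z‖ * ‖B n f - B m f‖)) := fun n m z hz f =>
    norm_exp_sub_exp_apply_le (hcomm n m) (hB' n z hz) (hB' m z hz) f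
  have hdiff0 : ∀ n, ∀ z ∈ sector θ, ∀ f, ‖NormedSpace.exp (z • B n) f - f‖ ≤
      C * (C * (‖z‖ * ‖B n f‖)) := by
    intro n z hz f
    have := norm_exp_sub_exp_apply_le (Commute.zero_right (B n)) (C := C) (hB' n z hz)
      (fun s _ => by simpa [NormedSpace.exp_zero] using hone) f
    simpa [NormedSpace.exp_zero] using this
  have hcauchy : ∀ z ∈ sector θ, ∀ f, CauchySeq fun n => NormedSpace.exp (z • B n) f := by
    intro z hz f
    rw [Metric.cauchySeq_iff]
    intro ε hε
    have hC0 : 0 < C := by linarith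
    obtain ⟨g, hgD, hg⟩ := hD.exists_dist_lt f (show 0 < ε / (4 * C) by positivity)
    have hz0 : 0 < ‖z‖ := norm_pos_iff.2 hz.1
    obtain ⟨N, hN⟩ := Metric.cauchySeq_iff.1 (hA g hgD).cauchySeq (ε / (2 * (C * C * ‖z‖)))
      (by positivity)
    refine ⟨N, fun n hn m hm => ?_⟩
    have h1 := hN n hn m hm
    rw [dist_eq_norm] at *
    have h2 := hdiff n m z hz g
    have h3 : C * (C * (‖z‖ * ‖B n g - B m g‖)) < ε / 2 := by
      rw [lt_div_iff₀ (by positivity)] at h1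
      nlinarith
    have h4 := (NormedSpace.exp (z • B n)).le_of_opNorm_le (hB n z hz) (f - g)
    have h5 := (NormedSpace.exp (z • B m)).le_of_opNorm_le (hB m z hz) (f - g)
    have h6 : C * ‖f - g‖ < ε / 4 := by
      rw [lt_div_iff₀ (by positivity)] at hg
      linarith
    have h7 : NormedSpace.exp (z • B n) f - NormedSpace.exp (z • B m) f =
        NormedSpace.exp (z • B n) (f - g) + (NormedSpace.exp (z • B n) g -
        NormedSpace.exp (z • B m) g) - NormedSpace.exp (z • B m) (f - g) := by
      simp only [map_sub]; abel
    rw [h7]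
    refine (norm_sub_le _ _).trans_lt ?_
    have := norm_add_le (NormedSpace.exp (z • B n) (f - g)) (NormedSpace.exp (z • B n) g -
        NormedSpace.exp (z • B m) g)
    linarith
  -- the limit operators, where they exist
  classical
  set T : ℂ → X →L[ℂ] X := fun z =>
    if h : ∃ L : X →L[ℂ] X, ∀ f, Tendsto (fun n => NormedSpace.exp (z • B n) f) atTop (𝓝 (L f))
    then h.choose else 0 with hTdef
  have hTeq : ∀ z, ∀ L : X →L[ℂ] X,
      (∀ f, Tendsto (fun n => NormedSpace.exp (z • B n) f) atTop (𝓝 (L f))) → T z = L := by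
    intro z L hL
    have hex : ∃ L : X →L[ℂ] X, ∀ f,
      Tendsto (fun n => NormedSpace.exp (z • B n) f) atTop (𝓝 (L f)) := ⟨L, hL⟩
    simp only [hTdef, dif_pos hex]
    ext f
    exact tendsto_nhds_unique (hex.choose_spec f) (hL f)
  have hT : ∀ z ∈ sector θ, ∀ f,
      Tendsto (fun n => NormedSpace.exp (z • B n) f) atTop (𝓝 (T z f)) := by
    intro z hz
    choose L hL using fun f => cauchySeq_tendsto_of_complete (hcauchy z hz f)
    have hL' := hTeq z (continuousLinearMapOfTendsto _ (tendsto_pi_nhds.2 hL)) hL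
    intro f
    rw [hL']
    exact hL f
  have hTn : ∀ z ∈ sector θ, ‖T z‖ ≤ C := by
    intro z hz
    refine ContinuousLinearMap.opNorm_le_bound _ (by linarith) fun f => ?_
    exact le_of_tendsto (hT z hz f).norm (Eventually.of_forall fun n =>
      (NormedSpace.exp (z • B n)).le_of_opNorm_le (hB n z hz) f)
  have hT0 : ∀ f ∈ D, ∀ z ∈ sector θ, ‖T z f - f‖ ≤ C * (C * (‖z‖ * ‖A f‖)) := by
    intro f hf z hz
    exact le_of_tendsto_of_tendsto ((hT z hz f).sub_const f).norm
      ((((hA f hf).norm.const_mul ‖z‖).const_mul C).const_mul C)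
      (Eventually.of_forall fun n => hdiff0 n z hz f)
  refine ⟨T, ⟨?_, ?_, ?_, ?_, ?_⟩, hT, ?_⟩
  · refine hTeq 0 1 fun f => ?_
    simp [NormedSpace.exp_zero]
  · intro z hz w hw
    refine hTeq _ _ fun f => ?_
    have h1 : Tendsto (fun n => NormedSpace.exp (z • B n) (NormedSpace.exp (w • B n) f - T w f))
        atTop (𝓝 0) := by
      have h2 : Tendsto (fun n => C * ‖NormedSpace.exp (w • B n) f - T w f‖) atTop (𝓝 0) := by
        simpa using ((hT w hw f).sub_const (T w f)).norm.const_mul C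
      exact squeeze_zero_norm (fun n =>
        (NormedSpace.exp (z • B n)).le_of_opNorm_le (hB n z hz) _) h2
    have h3 := h1.add (hT z hz (T w f))
    rw [zero_add] at h3
    refine h3.congr fun n => ?_
    have h4 := exp_add_smul (B n) z w
    rw [map_sub, sub_add_cancel, h4]
    rfl
  · refine differentiableOn_of_dense (isOpen_sector (by linarith [Real.pi_pos])) hTn hD ?_
    intro f hf
    have hopen : IsOpen (sector θ) := isOpen_sector (by linarith [Real.pi_pos])
    have hlu : TendstoLocallyUniformlyOn (fun n z => NormedSpace.exp (z • B n) f)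
        (fun z => T z f) atTop (sector θ) := by
      rw [Metric.tendstoLocallyUniformlyOn_iff]
      intro ε hε z hz
      refine ⟨sector θ ∩ Metric.ball z 1, ?_, ?_⟩
      · exact Filter.inter_mem self_mem_nhdsWithin
          (mem_nhdsWithin_of_mem_nhds (Metric.ball_mem_nhds z one_pos))
      · have h1 : Tendsto (fun n => C * (C * ((‖z‖ + 1) * ‖A f - B n f‖))) atTop (𝓝 0) := by
          simpa using ((((hA f hf).const_sub (A f)).norm.const_mul (‖z‖ + 1)).const_mul
            C).const_mul C
        filter_upwards [h1.eventually (gt_mem_nhds hε)] with n hn w hw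
        refine lt_of_le_of_lt ?_ hn
        rw [dist_eq_norm]
        refine le_of_tendsto_of_tendsto ((hT w hw.1 f).sub_const _).norm
          (((((hA f hf).sub_const (B n f)).norm.const_mul (‖z‖ + 1)).const_mul C).const_mul C)
          (Eventually.of_forall fun m => (hdiff m n w hw.1 f).trans ?_)
        have : ‖w‖ ≤ ‖z‖ + 1 := by
          have h3 : ‖w - z‖ < 1 := by simpa [dist_eq_norm] using hw.2
          have h4 := norm_add_le (w - z) z
          rw [sub_add_cancel] at h4
          linarith
        have hC0 : 0 ≤ C := by linarith
        exact mul_le_mul_of_nonneg_left (mul_le_mul_of_nonneg_left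
          (mul_le_mul_of_nonneg_right this (norm_nonneg _)) hC0) hC0
    refine hlu.differentiableOn (Eventually.of_forall fun n => ?_) hopen
    intro z _
    have e1 := (hasDerivAt_exp_smul_const (𝕂 := ℂ) (B n) z)
    exact ((ContinuousLinearMap.apply ℂ X f).hasFDerivAt.comp_hasDerivAt z
      e1).differentiableAt.differentiableWithinAt
  · intro f
    refine tendsto_apply_of_dense (L := ContinuousLinearMap.id ℂ X) (C := C) ?_ hD ?_ f
    · filter_upwards [self_mem_nhdsWithin] with z hz using hTn z hz
    · intro f hf
      rw [tendsto_iff_norm_sub_tendsto_zero]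
      have h1 : Tendsto (fun z : ℂ => C * (C * (‖z‖ * ‖A f‖))) (𝓝[sector θ] 0) (𝓝 0) := by
        have : Tendsto (fun z : ℂ => C * (C * (‖z‖ * ‖A f‖))) (𝓝 0)
            (𝓝 (C * (C * (‖(0 : ℂ)‖ * ‖A f‖)))) := by
          apply Continuous.tendsto; fun_prop
        rw [norm_zero, zero_mul, mul_zero, mul_zero] at this
        exact this.mono_left nhdsWithin_le_nhds
      refine squeeze_zero' (Eventually.of_forall fun _ => norm_nonneg _) ?_ h1
      filter_upwards [self_mem_nhdsWithin] with z hz using hT0 f hf z hz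
  · intro z hz
    simpa using hTn z hz
  · intro f hf
    rw [Metric.tendsto_nhds]
    intro ε hε
    obtain ⟨g, hgD, hg⟩ := hD.exists_dist_lt (A f) (show 0 < ε / (2 * (C + 1)) by positivity)
    set δ := ε / (2 * (C * (C * (‖A g‖ + 1)))) with hδ
    have hδ0 : 0 < δ := by positivity
    filter_upwards [Ioo_mem_nhdsGT hδ0] with t ht
    have ht0 : 0 < t := ht.1
    have hs : ∀ n, ∀ s ∈ Set.Ico (0 : ℝ) t, ‖NormedSpace.exp ((s : ℂ) • B n) (B n f) - A f‖ ≤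
        C * ‖B n f - A f‖ + (C * (C * (t * ‖B n g‖)) + (C + 1) * ‖A f - g‖) := by
      intro n s hs
      have hsb : ‖NormedSpace.exp ((s : ℂ) • B n)‖ ≤ C ∧
          ‖NormedSpace.exp ((s : ℂ) • B n) g - g‖ ≤ C * (C * (t * ‖B n g‖)) := by
        rcases hs.1.eq_or_lt with h | h
        · rw [← h, Complex.ofReal_zero, zero_smul, NormedSpace.exp_zero]
          refine ⟨hone, ?_⟩
          simp only [one_apply_eq_self, sub_self, norm_zero]
          positivity
        · have hmem := ofReal_mem_sector hθ0 h
          refine ⟨hB n _ hmem, (hdiff0 n _ hmem g).trans ?_⟩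
          rw [Complex.norm_real, Real.norm_of_nonneg h.le]
          gcongr
          exact hs.2.le
      set E := NormedSpace.exp ((s : ℂ) • B n) with hE
      have : E (B n f) - A f = E (B n f - A f) + (E g - g) + (E (A f - g) - (A f - g)) := by
        simp only [map_sub]; abel
      rw [this]
      have a1 := E.le_of_opNorm_le hsb.1 (B n f - A f)
      have a2 := E.le_of_opNorm_le hsb.1 (A f - g)
      have a3 := norm_sub_le (E (A f - g)) (A f - g)
      refine (norm_add_le _ _).trans ?_
      have a4 := norm_add_le (E (B n f - A f)) (E g - g)
      linarith [hsb.2]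
    have hlim := le_of_tendsto_of_tendsto
      (((hT _ (ofReal_mem_sector hθ0 ht0) f).sub_const f).sub_const ((t : ℂ) • A f)).norm
      ((((((hA f hf).sub_const (A f)).norm.const_mul C).add
        (((((hA g hgD).norm.const_mul t).const_mul C).const_mul C).add_const
          ((C + 1) * ‖A f - g‖))).mul_const t))
      (Eventually.of_forall fun n => norm_exp_sub_sub_smul_le ht0.le (hs n))
    rw [sub_self, norm_zero, mul_zero, zero_add] at hlim
    rw [dist_eq_norm] at *
    have htc : (t : ℂ) ≠ 0 := by exact_mod_cast ht0.ne'
    have e1 : (t : ℂ)⁻¹ • (T t f - f) - A f = (t : ℂ)⁻¹ • (T t f - f - (t : ℂ) • A f) := by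
      rw [smul_sub _ _ ((t : ℂ) • A f), inv_smul_smul₀ htc]
    rw [e1, norm_smul, norm_inv, Complex.norm_real, Real.norm_of_nonneg ht0.le]
    have b1 : (C + 1) * ‖A f - g‖ < ε / 2 := by
      rw [lt_div_iff₀ (by positivity)] at hg
      linarith
    have b2 : C * (C * (t * ‖A g‖)) ≤ ε / 2 := by
      have h3 : t * (2 * (C * (C * (‖A g‖ + 1)))) ≤ ε := by
        have := ht.2.le
        rwa [hδ, le_div_iff₀ (by positivity)] at this
      have h4 : 0 ≤ t * (C * C) := by positivity
      nlinarith
    calc t⁻¹ * ‖T t f - f - (t : ℂ) • A f‖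
        ≤ t⁻¹ * ((C * (C * (t * ‖A g‖)) + (C + 1) * ‖A f - g‖) * t) := by gcongr
      _ = C * (C * (t * ‖A g‖)) + (C + 1) * ‖A f - g‖ := by field_simp
      _ < ε := by linarith

end StrongLimit

/-! ### Generation of holomorphic semigroups -/

section Generation

variable {X : Type*} [NormedAddCommGroup X] [NormedSpace ℂ X]

theorem IsResolventAt.resolvent_identity {A : X →ₗ.[ℂ] X} {μ ν : ℂ} {R S : X →L[ℂ] X}
    (hR : IsResolventAt A μ R) (hS : IsResolventAt A ν S) :
    R - S = (ν - μ) • (R * S) := by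
  ext g
  obtain ⟨f, hf, hfg⟩ := hS.2 g
  have h1 := hR.1 f
  have h2 : μ • (f : X) - A f = g - (ν - μ) • (f : X) := by
    rw [← hfg, sub_smul]; abel
  rw [h2, map_sub, map_smul, hf] at h1
  rw [sub_eq_iff_eq_add] at h1
  change R g - S g = (ν - μ) • R (S g)
  rw [h1, add_sub_cancel_left]

/-- The Yosida approximant `N² (N - A)⁻¹ - N` inherits the half-plane resolvent bound. -/
theorem halfPlaneBound_yosida {r : ℂ → X →L[ℂ] X} {M : ℝ}
    (hid : ∀ μ ν : ℂ, 0 < μ.re → 0 < ν.re → r μ - r ν = (ν - μ) • (r μ * r ν))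
    (hr : ∀ ζ : ℂ, 0 < ζ.re → ‖r ζ‖ ≤ M / ‖ζ‖) {N : ℝ} (hN : 0 < N) :
    HalfPlaneBound (M + 1) (((N : ℂ) ^ 2) • r N - (N : ℂ) • (1 : X →L[ℂ] X)) := by
  intro ζ hζ
  have hNre : 0 < ((N : ℂ)).re := by simpa using hN
  have hN0 : (N : ℂ) ≠ 0 := by exact_mod_cast hN.ne'
  have hζN : ζ + N ≠ 0 := by
    intro h
    have := congrArg Complex.re h
    simp at this
    linarith
  have hζ0 : ζ ≠ 0 := by rintro rfl; simp at hζ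
  set μ : ℂ := N * ζ / (ζ + N) with hμ
  have hμre : 0 < μ.re := by
    have : μ = (N : ℂ) * (ζ * conj (ζ + N)) / (Complex.normSq (ζ + N) : ℂ) := by
      rw [hμ, ← Complex.mul_conj (ζ + N)]
      have : conj (ζ + N) ≠ 0 := (map_ne_zero _).2 hζN
      field_simp
    rw [this, Complex.div_ofReal_re, Complex.re_ofReal_mul]
    have h2 : 0 < Complex.normSq (ζ + N) := Complex.normSq_pos.2 hζN
    have h3 : 0 < (ζ * conj (ζ + N)).re := by
      simp only [Complex.mul_re, map_add, Complex.add_re, Complex.conj_re, Complex.conj_ofReal,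
        Complex.ofReal_re, Complex.add_im, Complex.conj_im, Complex.ofReal_im]
      nlinarith [sq_nonneg ζ.im]
    positivity
  have e1 : ((N : ℂ) ^ 2) • (r N * r μ) = -(N + ζ) • (r N - r μ) := by
    rw [hid N μ hNre hμre, smul_smul]
    congr 1
    rw [hμ]; field_simp; ring
  have e2 : ((N : ℂ) ^ 2) • (r μ * r N) = -(N + ζ) • (r N - r μ) := by
    have h := hid μ N hμre hNre
    rw [← neg_sub (r μ), h, ← smul_neg, smul_neg, ← neg_smul, smul_smul]
    congr 1
    rw [hμ]; field_simp; ring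
  have e3 : ((N : ℂ) ^ 2) • r N - (ζ + N) • r N - (ζ + N) • (r μ - r N) =
    ((N : ℂ) ^ 2) • r N - (ζ + N) • r μ := by rw [smul_sub]; abel
  set q : X →L[ℂ] X := (ζ + N)⁻¹ • (1 : X →L[ℂ] X) + ((N : ℂ) / (ζ + N)) ^ 2 • r μ with hq
  have hfac : ζ • (1 : X →L[ℂ] X) - (((N : ℂ) ^ 2) • r N - (N : ℂ) • (1 : X →L[ℂ] X)) =
      (ζ + N) • 1 - ((N : ℂ) ^ 2) • r N := by rw [add_smul]; abel
  refine ⟨q, ?_, ?_, ?_⟩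
  · rw [hfac, hq, sub_mul, mul_add, mul_add, smul_mul_smul_comm, mul_inv_cancel₀ hζN, one_smul,
      one_mul, smul_mul_smul_comm, one_mul, smul_mul_smul_comm, mul_one,
      smul_mul_smul_comm, mul_comm ((N : ℂ) ^ 2) (_ ^ 2), mul_smul _ ((N : ℂ) ^ 2) (r N * r μ), e1]
    match_scalars <;> field_simp <;> ring
  · rw [hfac, hq, mul_sub, add_mul, add_mul, smul_mul_smul_comm, inv_mul_cancel₀ hζN, one_smul,
      one_mul, smul_mul_smul_comm, mul_one, smul_mul_smul_comm, one_mul,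
      smul_mul_smul_comm, mul_smul _ ((N : ℂ) ^ 2) (r μ * r N), e2]
    match_scalars <;> field_simp <;> ring
  · have hn1 : ‖ζ‖ ≤ ‖ζ + N‖ := by
      rw [← sq_le_sq₀ (norm_nonneg _) (norm_nonneg _), ← Complex.normSq_eq_norm_sq,
        ← Complex.normSq_eq_norm_sq, Complex.normSq_apply, Complex.normSq_apply]
      simp
      nlinarith
    have hn2 : N ≤ ‖ζ + N‖ := by
      refine le_trans ?_ (Complex.re_le_norm _)
      simp; linarith
    have hζp : 0 < ‖ζ‖ := norm_pos_iff.2 hζ0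
    have hμn : ‖μ‖ = N * ‖ζ‖ / ‖ζ + N‖ := by
      rw [hμ, norm_div, norm_mul, Complex.norm_real, Real.norm_of_nonneg hN.le]
    have hM : 0 ≤ M := by
      have := (norm_nonneg _).trans (hr ζ hζ)
      by_contra h
      exact absurd this (not_le.2 (div_neg_of_neg_of_pos (not_le.1 h) hζp))
    have hζNp : 0 < ‖ζ + N‖ := norm_pos_iff.2 hζN
    calc ‖q‖ ≤ ‖(ζ + N)⁻¹ • (1 : X →L[ℂ] X)‖ + ‖((N : ℂ) / (ζ + N)) ^ 2 • r μ‖ := norm_add_le _ _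
      _ ≤ ‖ζ + N‖⁻¹ * 1 + (N / ‖ζ + N‖) ^ 2 * (M / ‖μ‖) := by
        rw [norm_smul, norm_smul, norm_inv, norm_pow, norm_div, Complex.norm_real,
          Real.norm_of_nonneg hN.le]
        gcongr
        · exact ContinuousLinearMap.norm_id_le
        · exact hr μ hμre
      _ = ‖ζ + N‖⁻¹ + M * (N / ‖ζ + N‖) / ‖ζ‖ := by
        rw [hμn]; field_simp
      _ ≤ ‖ζ‖⁻¹ + M * 1 / ‖ζ‖ := by
        gcongr
        exact (div_le_one hζNp).2 hn2
      _ = (M + 1) / ‖ζ‖ := by field_simp; ring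

theorem IsQuasiBoundedHolomorphicSemigroup.exp_smul {θ C : ℝ} {T : ℂ → X →L[ℂ] X}
    (hT : IsQuasiBoundedHolomorphicSemigroup θ C 0 T) (a : ℝ) :
    IsQuasiBoundedHolomorphicSemigroup θ C a (fun z => Complex.exp (a * z) • T z) := by
  refine ⟨?_, ?_, ?_, ?_, ?_⟩
  · simp [hT.map_zero]
  · intro z hz w hw
    rw [hT.map_add z hz w hw, mul_add, Complex.exp_add, ContinuousLinearMap.smul_comp,
      ContinuousLinearMap.comp_smul, smul_smul]
  · have : Differentiable ℂ fun z : ℂ => Complex.exp (a * z) := by fun_prop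
    exact this.differentiableOn.smul hT.holomorphic
  · intro f
    have h1 : Tendsto (fun z : ℂ => Complex.exp (a * z)) (𝓝[sector θ] 0) (𝓝 1) := by
      have : Tendsto (fun z : ℂ => Complex.exp (a * z)) (𝓝 0) (𝓝 (Complex.exp (a * 0))) := by
        apply Continuous.tendsto; fun_prop
      rw [mul_zero, Complex.exp_zero] at this
      exact this.mono_left nhdsWithin_le_nhds
    simpa using h1.smul (hT.tendsto_zero f)
  · intro z hz
    have h1 := hT.norm_le z hz
    rw [zero_mul, Real.exp_zero, mul_one] at h1
    rw [norm_smul, Complex.norm_exp, mul_comm, Complex.re_ofReal_mul]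
    gcongr

/-- A densely defined operator whose resolvent is bounded by `M / ‖ζ‖` on a half-plane generates a
quasi bounded holomorphic semigroup. -/
theorem generatesQuasiBoundedHolomorphicSemigroup_of_resolvent_le [CompleteSpace X]
    {A : X →ₗ.[ℂ] X} (hdense : Dense (A.domain : Set X)) {lam M : ℝ} (hlam : 0 < lam) (hM : 0 ≤ M)
    (h : ∀ ζ : ℂ, lam ≤ ζ.re → ∃ R : X →L[ℂ] X, IsResolventAt A ζ R ∧ ‖R‖ ≤ M / ‖ζ‖) :
    GeneratesQuasiBoundedHolomorphicSemigroup A := by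
  -- `r ζ` is the resolvent at `ζ` of the shifted operator `A - lam`
  have hre : ∀ ζ : ℂ, 0 < ζ.re → lam ≤ (ζ + lam).re := by
    intro ζ hζ; simp; exact hζ.le
  choose! r hrA hrn' using fun (ζ : ℂ) (hζ : 0 < ζ.re) => h (ζ + lam) (hre ζ hζ)
  have hrn : ∀ ζ : ℂ, 0 < ζ.re → ‖r ζ‖ ≤ M / ‖ζ‖ := by
    intro ζ hζ
    refine (hrn' ζ hζ).trans ?_
    have hζ0 : ζ ≠ 0 := by rintro rfl; simp at hζ
    have hζp : 0 < ‖ζ‖ := norm_pos_iff.2 hζ0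
    gcongr
    rw [← sq_le_sq₀ (norm_nonneg _) (norm_nonneg _), ← Complex.normSq_eq_norm_sq,
      ← Complex.normSq_eq_norm_sq, Complex.normSq_apply, Complex.normSq_apply]
    simp
    nlinarith
  have hid : ∀ μ ν : ℂ, 0 < μ.re → 0 < ν.re → r μ - r ν = (ν - μ) • (r μ * r ν) := by
    intro μ ν hμ hν
    have := (hrA μ hμ).resolvent_identity (hrA ν hν)
    rwa [add_sub_add_right_eq_sub] at this
  have hrcomm : ∀ μ ν : ℂ, 0 < μ.re → 0 < ν.re → Commute (r μ) (r ν) := by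
    intro μ ν hμ hν
    rcases eq_or_ne μ ν with rfl | hne
    · exact Commute.refl _
    · have h1 := hid μ ν hμ hν
      have h2 := hid ν μ hν hμ
      have h3 : (ν - μ) • (r μ * r ν) = (ν - μ) • (r ν * r μ) := by
        rw [← h1, ← neg_sub, h2, ← neg_smul, neg_sub]
      exact smul_right_injective _ (sub_ne_zero.2 hne.symm) h3
  set N : ℕ → ℝ := fun n => n + 1 with hNdef
  have hN0 : ∀ n, 0 < N n := fun n => by positivity
  have hNre : ∀ n, 0 < ((N n : ℝ) : ℂ).re := fun n => by simpa using hN0 n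
  set B : ℕ → X →L[ℂ] X := fun n => ((N n : ℂ) ^ 2) • r (N n) - (N n : ℂ) • (1 : X →L[ℂ] X)
    with hBdef
  have hcomm : ∀ n m, Commute (B n) (B m) := by
    intro n m
    have h1 : Commute (r (N n)) (r (N m)) := hrcomm _ _ (hNre n) (hNre m)
    simp only [hBdef]
    refine Commute.sub_left (Commute.sub_right ?_ ?_) (Commute.sub_right ?_ ?_)
    · exact (h1.smul_left _).smul_right _
    · exact (Commute.one_right _).smul_right _
    · exact (Commute.one_left _).smul_left _
    · exact (Commute.one_right _).smul_right _
  have hcommr : ∀ n, Commute (r 1) (B n) := by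
    intro n
    refine Commute.sub_right ?_ ((Commute.one_right _).smul_right _)
    exact (hrcomm 1 _ (by simp) (hNre n)).smul_right _
  set θ : ℝ := 1 / (2 * (M + 1)) with hθdef
  have hθ0 : 0 < θ := by positivity
  have hθ : θ ≤ Real.pi / 2 := by
    have : θ ≤ 1 := by
      rw [hθdef, div_le_one (by positivity)]; linarith
    linarith [Real.pi_gt_three]
  set C : ℝ := 2 * (M + 1) ^ 2 * Real.exp 1 with hCdef
  have hC : 1 ≤ C := by
    have h1 : 1 ≤ Real.exp 1 := Real.one_le_exp zero_le_one
    have h2 : 1 ≤ 2 * (M + 1) ^ 2 := by nlinarith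
    exact one_le_mul_of_one_le_of_one_le h2 h1
  have hB : ∀ n, ∀ z ∈ sector θ, ‖NormedSpace.exp (z • B n)‖ ≤ C := by
    intro n z hz
    refine norm_exp_le_of_mem_sector (by linarith) (halfPlaneBound_yosida hid hrn (hN0 n))
      (le_of_eq ?_) hz
    rw [hθdef]; field_simp
  -- strong convergence of the Yosida approximants
  have hNr : ∀ n, ‖(N n : ℂ) • r (N n)‖ ≤ M := by
    intro n
    have := hrn (N n) (hNre n)
    rw [norm_smul]
    rw [Complex.norm_real, Real.norm_of_nonneg (hN0 n).le] at *
    calc N n * ‖r (N n)‖ ≤ N n * (M / N n) := by gcongr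
      _ = M := by have := (hN0 n).ne'; field_simp
  have hrapp : ∀ n, ∀ f : A.domain, (N n : ℂ) • r (N n) f =
      f + r (N n) (A f - (lam : ℂ) • (f : X)) := by
    intro n f
    have h1 := (hrA (N n) (hNre n)).1 f
    have h2 : ((N n : ℂ) + lam) • (f : X) - A f = (N n : ℂ) • (f : X) -
      (A f - (lam : ℂ) • (f : X)) := by rw [add_smul]; abel
    rw [h2, map_sub, map_smul, sub_eq_iff_eq_add] at h1
    exact h1
  have hNr1 : ∀ g : X, Tendsto (fun n => ((N n : ℂ) • r (N n)) g) atTop (𝓝 g) := by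
    refine tendsto_apply_of_dense (L := ContinuousLinearMap.id ℂ X) (Eventually.of_forall hNr)
      hdense ?_
    intro f hf
    rw [tendsto_iff_norm_sub_tendsto_zero]
    set k : X := A ⟨f, hf⟩ - (lam : ℂ) • f with hk
    have h1 : Tendsto (fun n : ℕ => M / N n * ‖k‖) atTop (𝓝 0) := by
      have : Tendsto (fun n : ℕ => M / N n) atTop (𝓝 0) :=
        Tendsto.const_div_atTop (tendsto_atTop_add_const_right _ _ tendsto_natCast_atTop_atTop) M
      simpa using this.mul_const ‖k‖
    refine squeeze_zero (fun _ => norm_nonneg _) (fun n => ?_) h1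
    have h2 := hrapp n ⟨f, hf⟩
    simp only [smul_apply, ContinuousLinearMap.id_apply]
    rw [h2, add_sub_cancel_left]
    refine (r (N n)).le_of_opNorm_le ?_ k
    have := hrn (N n) (hNre n)
    rwa [Complex.norm_real, Real.norm_of_nonneg (hN0 n).le] at this
  classical
  set A' : X → X := fun f => if hf : f ∈ A.domain then A ⟨f, hf⟩ - (lam : ℂ) • f else 0 with hA'
  have hBA : ∀ f ∈ (A.domain : Set X), Tendsto (fun n => B n f) atTop (𝓝 (A' f)) := by
    intro f hf
    have hf' : f ∈ A.domain := hf
    simp only [hA', dif_pos hf']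
    refine (hNr1 _).congr fun n => ?_
    have h2 := hrapp n ⟨f, hf⟩
    simp only [hBdef, smul_apply, sub_apply, one_apply_eq_self]
    rw [sq, mul_smul, h2, smul_add, add_sub_cancel_left]
  obtain ⟨T, hT, hTlim, hTder⟩ := exists_semigroup_of_tendsto hcomm hC hθ0 hθ hB hdense hBA
  refine ⟨θ, C, lam, _, hθ0, hθ, hT.exp_smul lam, ?_⟩
  -- the derivative at `0` on the domain
  have hder : ∀ f : A.domain, Tendsto (fun t : ℝ => (t : ℂ)⁻¹ •
      ((Complex.exp (lam * t) • T t) (f : X) - f)) (𝓝[>] 0) (𝓝 (A f)) := by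
    intro f
    have h1 := hTder f f.2
    have hA'f : A' f = A f - (lam : ℂ) • (f : X) := by simp [hA']
    rw [hA'f] at h1
    have h2 : Tendsto (fun t : ℝ => Complex.exp (lam * t)) (𝓝[>] 0) (𝓝 1) := by
      have : Tendsto (fun t : ℝ => Complex.exp (lam * t)) (𝓝 0)
          (𝓝 (Complex.exp (lam * ((0 : ℝ) : ℂ)))) := by
        apply Continuous.tendsto; fun_prop
      rw [Complex.ofReal_zero, mul_zero, Complex.exp_zero] at this
      exact this.mono_left nhdsWithin_le_nhds
    have h3 : Tendsto (fun t : ℝ => (t : ℂ)⁻¹ * (Complex.exp (lam * t) - 1)) (𝓝[>] 0)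
        (𝓝 (lam : ℂ)) := by
      have h4 : HasDerivAt (fun t : ℝ => Complex.exp (lam * t)) (lam : ℂ) 0 := by
        have : HasDerivAt (fun t : ℂ => Complex.exp (lam * t)) (lam : ℂ) ((0 : ℝ) : ℂ) := by
          have := (((hasDerivAt_id ((0 : ℝ) : ℂ)).const_mul (lam : ℂ))).cexp
          simpa using this
        exact hasDerivAt_comp_ofReal this
      have h5 := (hasDerivAt_iff_tendsto_slope.1 h4).mono_left
        (nhdsWithin_mono 0 (fun x (hx : 0 < x) => hx.ne'))
      refine h5.congr fun t => ?_
      simp [slope]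
    have h6 := (h2.smul h1).add (h3.smul_const (f : X))
    rw [one_smul, sub_add_cancel] at h6
    refine h6.congr fun t => ?_
    simp only [smul_apply]
    rw [smul_comm (Complex.exp _), ← smul_smul, ← smul_add, smul_sub, sub_smul, one_smul]
    congr 1
    abel
  intro f g
  rw [LinearPMap.mem_graph_iff]
  constructor
  · rintro ⟨f', rfl, rfl⟩
    exact hder f'
  · intro hlim
    have hR := hrA 1 (by simp)
    -- the resolvent commutes with the semigroup
    have hcom : ∀ t : ℝ, 0 < t → r 1 (T t f) = T t (r 1 f) := by
      intro t ht
      have h1 := ((r 1).continuous.tendsto _).comp (hTlim t (ofReal_mem_sector hθ0 ht) f)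
      have h2 := hTlim t (ofReal_mem_sector hθ0 ht) (r 1 f)
      refine tendsto_nhds_unique h1 (h2.congr fun n => ?_)
      have h3 : r 1 * NormedSpace.exp ((t : ℂ) • B n) = NormedSpace.exp ((t : ℂ) • B n) * r 1 :=
        ((hcommr n).smul_right _).exp_right
      exact (DFunLike.congr_fun h3 f).symm
    obtain ⟨u, hu, hug⟩ := hR.2 f
    have h1 := hder u
    have h2 : Tendsto (fun t : ℝ => (t : ℂ)⁻¹ •
        ((Complex.exp (lam * t) • T t) (u : X) - u)) (𝓝[>] 0) (𝓝 (r 1 g)) := by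
      refine (((r 1).continuous.tendsto g).comp hlim).congr' ?_
      filter_upwards [self_mem_nhdsWithin] with t ht
      simp only [Function.comp_apply, map_smul, map_sub, smul_apply]
      rw [hcom t ht, hu]
    have h3 : A u = r 1 g := tendsto_nhds_unique h1 h2
    have h4 : f = r 1 ((1 + lam : ℂ) • f - g) := by
      rw [map_sub, map_smul, ← hu, ← h3, ← hug]
    obtain ⟨v, hv, hvg⟩ := hR.2 ((1 + lam : ℂ) • f - g)
    rw [← h4] at hv
    refine ⟨v, hv, ?_⟩
    rw [hv] at hvg
    exact sub_right_injective hvg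

end Generation

open FourierTransform
open scoped SchwartzMap LineDeriv

variable {d : ℕ}

/-! ### Fourier multipliers on `L²` -/

theorem L2_inner_eq_integral (f g : L2 d) : inner ℂ f g = ∫ x, g x * conj (f x) := by
  rw [L2.inner_def]
  rfl

/-- Multiplication by an essentially bounded function. -/
def mulL2 {m : Rd d → ℂ} (hm : MemLp m ∞ (volume : Measure (Rd d))) : L2 d →L[ℂ] L2 d :=
  (ContinuousLinearMap.mul ℂ ℂ).holderL (volume : Measure (Rd d)) ∞ 2 2 hm.toLp

theorem coeFn_mulL2 {m : Rd d → ℂ} (hm : MemLp m ∞ (volume : Measure (Rd d))) (f : L2 d) :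
    mulL2 hm f =ᵐ[volume] fun x => m x * f x := by
  have h1 := (ContinuousLinearMap.mul ℂ ℂ).coeFn_holder (r := 2) hm.toLp f
  filter_upwards [h1, hm.coeFn_toLp] with x h1 h2
  have h3 : (mulL2 hm f : L2 d) x = ((ContinuousLinearMap.mul ℂ ℂ).holder 2 hm.toLp f : L2 d) x :=
    rfl
  rw [h3, h1, h2]
  rfl

theorem L2_ext_fourier {f g : L2 d} (h : (𝓕 f : L2 d) =ᵐ[volume] (𝓕 g : L2 d)) : f = g :=
  (Lp.fourierTransformₗᵢ (Rd d) ℂ).injective (Lp.ext h)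

theorem exists_fourier_eq {m : Rd d → ℂ} (hm : MemLp m 2 (volume : Measure (Rd d))) :
    ∃ f : L2 d, (𝓕 f : L2 d) =ᵐ[volume] m := by
  refine ⟨𝓕⁻ hm.toLp, ?_⟩
  rw [fourier_fourierInv_eq]
  exact hm.coeFn_toLp

theorem fourier_fourierMultiplierL2 {m : Rd d → ℂ} (hm : MemLp m ∞ (volume : Measure (Rd d)))
    (f : L2 d) :
    (𝓕 (fourierMultiplierL2 m f) : L2 d) =ᵐ[volume] fun ξ => m ξ * (𝓕 f : L2 d) ξ := by
  have h : fourierMultiplierL2 m f = 𝓕⁻ (mulL2 hm (𝓕 f)) := by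
    rw [fourierMultiplierL2, dif_pos hm]
    rfl
  rw [h, fourier_fourierInv_eq]
  exact coeFn_mulL2 hm _

theorem fourierMultiplierL2_eq_iff {m : Rd d → ℂ} (hm : MemLp m ∞ (volume : Measure (Rd d)))
    {f g : L2 d} :
    fourierMultiplierL2 m f = g ↔ (𝓕 g : L2 d) =ᵐ[volume] fun ξ => m ξ * (𝓕 f : L2 d) ξ := by
  constructor
  · rintro rfl
    exact fourier_fourierMultiplierL2 hm f
  · intro h
    exact L2_ext_fourier ((fourier_fourierMultiplierL2 hm f).trans h.symm)

theorem norm_fourierMultiplierL2_apply_le {m : Rd d → ℂ}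
    (hm : MemLp m ∞ (volume : Measure (Rd d))) {C : ℝ} (hC : ∀ ξ, ‖m ξ‖ ≤ C) (f : L2 d) :
    ‖fourierMultiplierL2 m f‖ ≤ C * ‖f‖ := by
  rw [← Lp.norm_fourier_eq (fourierMultiplierL2 m f), ← Lp.norm_fourier_eq f]
  refine Lp.norm_le_mul_norm_of_ae_le_mul ?_
  filter_upwards [fourier_fourierMultiplierL2 hm f] with ξ h
  rw [h, norm_mul]
  exact mul_le_mul_of_nonneg_right (hC ξ) (norm_nonneg _)

theorem norm_fourierMultiplierL2_le {m : Rd d → ℂ}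
    (hm : MemLp m ∞ (volume : Measure (Rd d))) {C : ℝ} (hC : ∀ ξ, ‖m ξ‖ ≤ C) :
    ‖(fourierMultiplierL2 m : L2 d →L[ℂ] L2 d)‖ ≤ C :=
  ContinuousLinearMap.opNorm_le_bound _ ((norm_nonneg _).trans (hC 0))
    (norm_fourierMultiplierL2_apply_le hm hC)

theorem inner_fourierMultiplierL2 {m : Rd d → ℂ} (hm : MemLp m ∞ (volume : Measure (Rd d)))
    (hm' : MemLp (fun ξ => conj (m ξ)) ∞ (volume : Measure (Rd d))) (f g : L2 d) :
    inner ℂ f (fourierMultiplierL2 m g) =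
      inner ℂ (fourierMultiplierL2 (fun ξ => conj (m ξ)) f) g := by
  rw [← Lp.inner_fourier_eq f, ← Lp.inner_fourier_eq _ g, L2_inner_eq_integral,
    L2_inner_eq_integral]
  refine integral_congr_ae ?_
  filter_upwards [fourier_fourierMultiplierL2 hm g, fourier_fourierMultiplierL2 hm' f] with ξ h1 h2
  rw [h1, h2, map_mul, Complex.conj_conj]
  ring

/-! ### The symbols of the powers of the resolvent -/

/-- The symbol `|2πξ|²` of `-Δ`. -/
def laplaceSymbol (ξ : Rd d) : ℝ := (2 * Real.pi * ‖ξ‖) ^ 2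

theorem laplaceSymbol_nonneg (ξ : Rd d) : 0 ≤ laplaceSymbol ξ := sq_nonneg _

theorem le_re_add_laplaceSymbol (ζ : ℂ) (ξ : Rd d) :
    ζ.re + laplaceSymbol ξ ≤ ‖ζ + (laplaceSymbol ξ : ℂ)‖ := by
  have := Complex.re_le_norm (ζ + (laplaceSymbol ξ : ℂ))
  rwa [Complex.add_re, Complex.ofReal_re] at this

theorem add_laplaceSymbol_mem_slitPlane {ζ : ℂ} (hζ : 0 < ζ.re) (ξ : Rd d) :
    ζ + (laplaceSymbol ξ : ℂ) ∈ Complex.slitPlane := by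
  refine Or.inl ?_
  rw [Complex.add_re, Complex.ofReal_re]
  linarith [laplaceSymbol_nonneg ξ]

theorem add_laplaceSymbol_ne_zero {ζ : ℂ} (hζ : 0 < ζ.re) (ξ : Rd d) :
    ζ + (laplaceSymbol ξ : ℂ) ≠ 0 :=
  Complex.slitPlane_ne_zero (add_laplaceSymbol_mem_slitPlane hζ ξ)

theorem resolventSymbol_eq (ζ : ℂ) (α : ℝ) (ξ : Rd d) :
    resolventSymbol ζ α ξ = (ζ + (laplaceSymbol ξ : ℂ)) ^ ((-α : ℝ) : ℂ) := rfl

theorem norm_resolventSymbol (ζ : ℂ) (α : ℝ) (ξ : Rd d) :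
    ‖resolventSymbol ζ α ξ‖ = ‖ζ + (laplaceSymbol ξ : ℂ)‖ ^ (-α) := by
  rw [resolventSymbol_eq, Complex.norm_cpow_real]

theorem resolventSymbol_ne_zero {ζ : ℂ} (hζ : 0 < ζ.re) (α : ℝ) (ξ : Rd d) :
    resolventSymbol ζ α ξ ≠ 0 := by
  rw [resolventSymbol_eq]
  exact fun h => add_laplaceSymbol_ne_zero hζ ξ (Complex.cpow_eq_zero_iff _ _ |>.1 h).1

theorem resolventSymbol_mul {ζ : ℂ} (hζ : 0 < ζ.re) (α β : ℝ) (ξ : Rd d) :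
    resolventSymbol ζ α ξ * resolventSymbol ζ β ξ = resolventSymbol ζ (α + β) ξ := by
  simp only [resolventSymbol_eq]
  rw [← Complex.cpow_add _ _ (add_laplaceSymbol_ne_zero hζ ξ)]
  congr 1
  push_cast
  ring

theorem resolventSymbol_zero (ζ : ℂ) (ξ : Rd d) : resolventSymbol ζ 0 ξ = 1 := by
  rw [resolventSymbol_eq]
  simp

theorem resolventSymbol_neg_one (ζ : ℂ) (ξ : Rd d) :
    resolventSymbol ζ (-1) ξ = ζ + (laplaceSymbol ξ : ℂ) := by
  rw [resolventSymbol_eq]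
  simp

theorem conj_resolventSymbol {ζ : ℂ} (hζ : 0 < ζ.re) (α : ℝ) (ξ : Rd d) :
    conj (resolventSymbol ζ α ξ) = resolventSymbol (conj ζ) α ξ := by
  simp only [resolventSymbol_eq]
  have h : (conj ζ + (laplaceSymbol ξ : ℂ)) = conj (ζ + (laplaceSymbol ξ : ℂ)) := by
    rw [map_add, Complex.conj_ofReal]
  have harg : (conj ζ + (laplaceSymbol ξ : ℂ)).arg ≠ Real.pi :=
    (Complex.mem_slitPlane_iff_arg.1 (add_laplaceSymbol_mem_slitPlane
      (by simpa using hζ) ξ)).1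
  have := Complex.cpow_conj (conj ζ + (laplaceSymbol ξ : ℂ)) ((-α : ℝ) : ℂ) harg
  rw [Complex.conj_ofReal] at this
  rw [this, h, Complex.conj_conj]

theorem continuous_resolventSymbol {ζ : ℂ} (hζ : 0 < ζ.re) (α : ℝ) :
    Continuous (resolventSymbol ζ α : Rd d → ℂ) := by
  unfold resolventSymbol
  exact Continuous.cpow (by fun_prop) continuous_const
    fun ξ => add_laplaceSymbol_mem_slitPlane hζ ξ

theorem memLp_top_of_continuous {m : Rd d → ℂ} (hm : Continuous m) {C : ℝ}
    (hC : ∀ ξ, ‖m ξ‖ ≤ C) : MemLp m ∞ (volume : Measure (Rd d)) :=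
  memLp_top_of_bound hm.aestronglyMeasurable C (Eventually.of_forall hC)

theorem fourier_resolventPow {ζ : ℂ} (hζ : 0 < ζ.re) {α : ℝ} (hα : 0 ≤ α) (f : L2 d) :
    (𝓕 (resolventPow ζ α f) : L2 d) =ᵐ[volume]
      fun ξ => resolventSymbol ζ α ξ * (𝓕 f : L2 d) ξ :=
  fourier_fourierMultiplierL2 (memLp_resolventSymbol hζ hα) f

theorem resolventPow_eq_iff {ζ : ℂ} (hζ : 0 < ζ.re) {α : ℝ} (hα : 0 ≤ α) {f g : L2 d} :
    resolventPow ζ α f = g ↔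
      (𝓕 g : L2 d) =ᵐ[volume] fun ξ => resolventSymbol ζ α ξ * (𝓕 f : L2 d) ξ :=
  fourierMultiplierL2_eq_iff (memLp_resolventSymbol hζ hα)

theorem resolventPow_comp {ζ : ℂ} (hζ : 0 < ζ.re) {α β : ℝ} (hα : 0 ≤ α) (hβ : 0 ≤ β)
    (f : L2 d) : resolventPow ζ α (resolventPow ζ β f) = resolventPow ζ (α + β) f := by
  refine (resolventPow_eq_iff hζ hα).2 ?_
  filter_upwards [fourier_resolventPow hζ (add_nonneg hα hβ) f, fourier_resolventPow hζ hβ f]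
    with ξ h1 h2
  rw [h1, h2, ← mul_assoc, resolventSymbol_mul hζ]

theorem inner_resolventPow {ζ : ℂ} (hζ : 0 < ζ.re) {α : ℝ} (hα : 0 ≤ α) (f g : L2 d) :
    inner ℂ f (resolventPow ζ α g) = inner ℂ (resolventPow (conj ζ) α f) g := by
  have h : (fun ξ : Rd d => conj (resolventSymbol ζ α ξ)) = resolventSymbol (conj ζ) α :=
    funext fun ξ => conj_resolventSymbol hζ α ξ
  have hm' := memLp_resolventSymbol (d := d) (ζ := conj ζ) (by simpa using hζ) hα
  have := inner_fourierMultiplierL2 (memLp_resolventSymbol hζ hα) (h ▸ hm') f g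
  rw [h] at this
  exact this

theorem adjoint_resolventPow {ζ : ℂ} (hζ : 0 < ζ.re) {α : ℝ} (hα : 0 ≤ α) :
    (resolventPow ζ α : L2 d →L[ℂ] L2 d).adjoint = resolventPow (conj ζ) α :=
  ((ContinuousLinearMap.eq_adjoint_iff _ _).2 fun f g =>
    (inner_resolventPow hζ hα f g).symm).symm

theorem resolventPow_injective {ζ : ℂ} (hζ : 0 < ζ.re) {α : ℝ} (hα : 0 ≤ α) :
    Function.Injective (resolventPow ζ α : L2 d →L[ℂ] L2 d) := by
  intro f g hfg
  refine L2_ext_fourier ?_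
  have h1 := fourier_resolventPow hζ hα f
  rw [hfg] at h1
  filter_upwards [h1, fourier_resolventPow hζ hα g] with ξ h1 h2
  rw [h2] at h1
  exact mul_left_cancel₀ (resolventSymbol_ne_zero hζ α ξ) h1.symm

theorem denseRange_resolventPow {ζ : ℂ} (hζ : 0 < ζ.re) {α : ℝ} (hα : 0 ≤ α) :
    DenseRange (resolventPow ζ α : L2 d →L[ℂ] L2 d) := by
  have h1 : (resolventPow ζ α : L2 d →L[ℂ] L2 d).rangeᗮ = ⊥ := by
    rw [ContinuousLinearMap.orthogonal_range, adjoint_resolventPow hζ hα]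
    exact LinearMap.ker_eq_bot.2 (resolventPow_injective (by simpa using hζ) hα)
  have h2 := Submodule.dense_iff_topologicalClosure_eq_top.2
    (Submodule.topologicalClosure_eq_top_iff.2 h1)
  exact h2

theorem norm_resolventPow_le {ζ : ℂ} (hζ : 0 < ζ.re) {α : ℝ} (hα : 0 ≤ α) :
    ‖(resolventPow ζ α : L2 d →L[ℂ] L2 d)‖ ≤ ‖ζ‖ ^ (-α) := by
  refine norm_fourierMultiplierL2_le (memLp_resolventSymbol hζ hα) fun ξ => ?_
  rw [norm_resolventSymbol]
  have hζ0 : 0 < ‖ζ‖ := norm_pos_iff.2 (by rintro rfl; simp at hζ)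
  refine Real.rpow_le_rpow_of_nonpos hζ0 ?_ (by linarith)
  rw [← sq_le_sq₀ (norm_nonneg _) (norm_nonneg _), ← Complex.normSq_eq_norm_sq,
    ← Complex.normSq_eq_norm_sq, Complex.normSq_apply, Complex.normSq_apply]
  have := laplaceSymbol_nonneg ξ
  simp
  nlinarith

/-! ### Weak gradients and the Fourier transform -/

/-- `w` is the gradient of `u` on the Fourier side. -/
def IsFourierGradient (u : L2 d) (w : Fin d → L2 d) : Prop :=
  ∀ j, (𝓕 (w j) : L2 d) =ᵐ[volume]
    fun ξ => 2 * Real.pi * Complex.I * (ξ j : ℂ) * (𝓕 u : L2 d) ξ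

/-- The vector field with the components `w j`. -/
def vecField (w : Fin d → L2 d) (x : Rd d) : EuclideanSpace ℂ (Fin d) :=
  WithLp.toLp 2 fun j => w j x

@[simp]
theorem vecField_apply (w : Fin d → L2 d) (x : Rd d) (j : Fin d) : vecField w x j = w j x := rfl

theorem memLp_vecField (w : Fin d → L2 d) : MemLp (vecField w) 2 volume :=
  memLp_piLp_iff.2 fun j => Lp.memLp (w j)

theorem eq_of_forall_integral_schwartz {h f : Rd d → ℂ} (hh : LocallyIntegrable h volume)
    (hf : LocallyIntegrable f volume)
    (H : ∀ g : 𝓢(Rd d, ℂ), ∫ x, g x * h x = ∫ x, g x * f x) : h =ᵐ[volume] f := by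
  refine ae_eq_of_integral_contDiff_smul_eq hh hf fun g hg hgc => ?_
  have hgc' : HasCompactSupport (Complex.ofRealCLM ∘ g) := hgc.comp_left rfl
  have := H (hgc'.toSchwartzMap (Complex.ofRealCLM.contDiff.comp hg))
  exact (integral_congr_ae (Eventually.of_forall fun x => Complex.real_smul)).trans
    (this.trans (integral_congr_ae (Eventually.of_forall fun x => Complex.real_smul.symm)))

/-- Differentiation of a square integrable function in the sense of distributions is
multiplication by `2πi ξ_j` on the Fourier side. -/
theorem lineDeriv_eq_iff_fourier {u w : L2 d} {j : Fin d} :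
    (∂_{EuclideanSpace.single j (1 : ℝ)} (Lp.toTemperedDistribution u : 𝓢'(Rd d, ℂ))
      = Lp.toTemperedDistribution w) ↔
    (𝓕 w : L2 d) =ᵐ[volume] fun ξ => 2 * Real.pi * Complex.I * (ξ j : ℂ) * (𝓕 u : L2 d) ξ := by
  have hinj : (∂_{EuclideanSpace.single j (1 : ℝ)} (Lp.toTemperedDistribution u : 𝓢'(Rd d, ℂ))
      = Lp.toTemperedDistribution w) ↔
      𝓕 (∂_{EuclideanSpace.single j (1 : ℝ)} (Lp.toTemperedDistribution u : 𝓢'(Rd d, ℂ)))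
      = 𝓕 (Lp.toTemperedDistribution w : 𝓢'(Rd d, ℂ)) := by
    refine ⟨fun h => by rw [h], fun h => ?_⟩
    have := congrArg (fun T : 𝓢'(Rd d, ℂ) => 𝓕⁻ T) h
    simpa only [fourierInv_fourier_eq] using this
  have happ : ∀ g : 𝓢(Rd d, ℂ),
      (𝓕 (∂_{EuclideanSpace.single j (1 : ℝ)} (Lp.toTemperedDistribution u : 𝓢'(Rd d, ℂ)))) g =
        ∫ ξ, g ξ * (2 * Real.pi * Complex.I * (ξ j : ℂ) * (𝓕 u : L2 d) ξ) := by
    intro g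
    rw [TemperedDistribution.fourier_lineDerivOp_eq, Lp.fourier_toTemperedDistribution_eq]
    have htg : Function.HasTemperateGrowth
        (fun x : Rd d => ((inner ℝ x (EuclideanSpace.single j (1 : ℝ)) : ℝ) : ℂ)) := by fun_prop
    change (2 * (Real.pi : ℂ) * Complex.I) •
      (TemperedDistribution.smulLeftCLM ℂ
        (fun x : Rd d => ((inner ℝ x (EuclideanSpace.single j (1 : ℝ)) : ℝ) : ℂ))
        (Lp.toTemperedDistribution (𝓕 u : L2 d))) g = _
    rw [TemperedDistribution.smulLeftCLM_apply_apply, Lp.toTemperedDistribution_apply,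
      smul_eq_mul, ← integral_const_mul]
    refine integral_congr_ae (Eventually.of_forall fun ξ => ?_)
    simp only
    rw [SchwartzMap.smulLeftCLM_apply_apply htg]
    have : inner ℝ ξ (EuclideanSpace.single j (1 : ℝ)) = ξ j := by
      simp [EuclideanSpace.inner_single_right]
    rw [this, smul_eq_mul, smul_eq_mul]
    ring
  have happ' : ∀ g : 𝓢(Rd d, ℂ), (𝓕 (Lp.toTemperedDistribution w : 𝓢'(Rd d, ℂ))) g =
      ∫ ξ, g ξ * (𝓕 w : L2 d) ξ := by
    intro g
    rw [Lp.fourier_toTemperedDistribution_eq, Lp.toTemperedDistribution_apply]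
    rfl
  rw [hinj]
  constructor
  · intro h
    refine eq_of_forall_integral_schwartz ((Lp.memLp _).locallyIntegrable one_le_two) ?_ ?_
    · have h1 : LocallyIntegrable (𝓕 u : L2 d) volume :=
        (Lp.memLp _).locallyIntegrable one_le_two
      have hc : Continuous fun ξ : Rd d => 2 * (Real.pi : ℂ) * Complex.I * (ξ j : ℂ) := by
        fun_prop
      exact h1.continuous_smul hc
    · intro g
      rw [← happ', ← happ, h]
  · intro h
    ext g
    rw [happ, happ']
    refine integral_congr_ae ?_
    filter_upwards [h] with ξ h
    rw [h]

/-! ### Fourier gradients and weak gradients -/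

theorem integrable_mul_of_memLp_two {f g : Rd d → ℂ} (hf : MemLp f 2 volume)
    (hg : MemLp g 2 volume) : Integrable (fun x => f x * g x) volume :=
  hf.integrable_mul hg

theorem IsFourierGradient.integral_schwartz {u : L2 d} {w : Fin d → L2 d}
    (h : IsFourierGradient u w) (φ : 𝓢(Rd d, ℂ)) (j : Fin d) :
    ∫ x, u x * fderiv ℝ φ x (EuclideanSpace.single j 1) = - ∫ x, w j x * φ x := by
  have h1 := lineDeriv_eq_iff_fourier.2 (h j)
  have h2 := congrArg (fun T : 𝓢'(Rd d, ℂ) => T φ) h1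
  simp only [TemperedDistribution.lineDerivOp_apply_apply, map_neg,
    Lp.toTemperedDistribution_apply, SchwartzMap.lineDerivOp_apply_eq_fderiv, smul_eq_mul] at h2
  simp only [mul_comm (w j _), ← h2, neg_neg, mul_comm (u _)]

theorem IsFourierGradient.isSobolevW12 {u : L2 d} {w : Fin d → L2 d}
    (h : IsFourierGradient u w) : IsSobolevW12 u (vecField w) := by
  refine ⟨Lp.memLp u, memLp_vecField w, (Lp.memLp u).locallyIntegrable one_le_two,
    (memLp_vecField w).locallyIntegrable one_le_two, ?_⟩
  intro φ hφ j
  exact h.integral_schwartz (hφ.2.toSchwartzMap hφ.1) j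

/-- Integration by parts against test functions extends to Schwartz functions for square
integrable data, by a smooth cutoff at scale `n → ∞`. -/
theorem integral_schwartz_of_forall_test {g v : Rd d → ℂ} (hg : MemLp g 2 volume)
    (hv : MemLp v 2 volume) {e : Rd d}
    (H : ∀ φ : Rd d → ℂ, IsTestFunction φ → ∫ x, g x * fderiv ℝ φ x e = - ∫ x, v x * φ x)
    (ψ : 𝓢(Rd d, ℂ)) : ∫ x, g x * fderiv ℝ ψ x e = - ∫ x, v x * ψ x := by
  let χ : ContDiffBump (0 : Rd d) := ⟨1, 2, one_pos, one_lt_two⟩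
  set c : Rd d → ℂ := fun x => ((χ x : ℝ) : ℂ) with hc
  have hcs : ContDiff ℝ ∞ c := Complex.ofRealCLM.contDiff.comp χ.contDiff
  have hcc : HasCompactSupport c :=
    χ.hasCompactSupport.comp_left (g := fun t : ℝ => (t : ℂ)) Complex.ofReal_zero
  have hc1 : ∀ x, ‖c x‖ ≤ 1 := by
    intro x
    rw [hc, Complex.norm_real, Real.norm_of_nonneg χ.nonneg]
    exact χ.le_one
  have hc0 : c 0 = 1 := by
    have : χ 0 = 1 := χ.one_of_mem_closedBall (Metric.mem_closedBall_self χ.rIn_pos.le)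
    simp [hc, this]
  obtain ⟨K, hK⟩ : ∃ K, ∀ x, ‖fderiv ℝ c x e‖ ≤ K := by
    have h1 : Continuous fun x => fderiv ℝ c x e :=
      (hcs.continuous_fderiv (by simp)).clm_apply continuous_const
    have h2 : HasCompactSupport fun x => fderiv ℝ c x e :=
      (hcc.fderiv ℝ).comp_left (g := fun L : Rd d →L[ℝ] ℂ => L e) rfl
    exact h2.exists_bound_of_continuous h1
  have hK0 : 0 ≤ K := (norm_nonneg _).trans (hK 0)
  set a : ℕ → ℝ := fun n => ((n : ℝ) + 1)⁻¹ with ha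
  have ha0 : ∀ n, 0 < a n := fun n => by positivity
  have ha1 : ∀ n, a n ≤ 1 := fun n => inv_le_one_of_one_le₀ (by simp)
  have halim : Tendsto a atTop (𝓝 0) :=
    tendsto_inv_atTop_zero.comp (tendsto_atTop_add_const_right _ _ tendsto_natCast_atTop_atTop)
  set φ : ℕ → Rd d → ℂ := fun n x => c (a n • x) * ψ x with hφ
  have hψd : ∀ x, DifferentiableAt ℝ ψ x := fun x => ψ.differentiableAt
  have hcn : ∀ n, ContDiff ℝ ∞ fun x => c (a n • x) := fun n =>
    hcs.comp (contDiff_const_smul (a n))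
  have htest : ∀ n, IsTestFunction (φ n) := by
    intro n
    refine ⟨(hcn n).mul (ψ.smooth _), ?_⟩
    exact (hcc.comp_smul (ha0 n).ne').mul_right
  have hder : ∀ n x, fderiv ℝ (φ n) x e =
      c (a n • x) * fderiv ℝ ψ x e + ((a n : ℂ) * fderiv ℝ c (a n • x) e) * ψ x := by
    intro n x
    have h1 : HasFDerivAt (fun x => c (a n • x))
        ((fderiv ℝ c (a n • x)).comp (a n • ContinuousLinearMap.id ℝ (Rd d))) x := by
      have h2 : HasFDerivAt c (fderiv ℝ c (a n • x)) (a n • x) :=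
        ((hcs.differentiable (by simp)) _).hasFDerivAt
      exact h2.comp x ((hasFDerivAt_id x).const_smul (a n))
    have h3 := (h1.mul (hψd x).hasFDerivAt).fderiv
    have h4 : fderiv ℝ (φ n) x = _ := h3
    rw [h4]
    simp only [add_apply, smul_apply, ContinuousLinearMap.comp_apply, map_smul,
      ContinuousLinearMap.id_apply, smul_eq_mul, Complex.real_smul]
    ring
  have hclim : ∀ x, Tendsto (fun n => c (a n • x)) atTop (𝓝 1) := by
    intro x
    have h1 : Tendsto (fun n => a n • x) atTop (𝓝 ((0 : ℝ) • x)) := halim.smul_const x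
    rw [zero_smul] at h1
    have h2 := (hcs.continuous.tendsto 0).comp h1
    rwa [hc0] at h2
  have hψ2 : MemLp ψ 2 volume := ψ.memLp 2 volume
  have hψe : MemLp (fun x => fderiv ℝ ψ x e) 2 volume := by
    have := (∂_{e} ψ : 𝓢(Rd d, ℂ)).memLp 2 (volume : Measure (Rd d))
    refine this.congr_norm ?_ ?_
    · have h1 : (fun x => fderiv ℝ ψ x e) = ⇑(∂_{e} ψ : 𝓢(Rd d, ℂ)) :=
        funext fun x => (SchwartzMap.lineDerivOp_apply_eq_fderiv e ψ x).symm
      rw [h1]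
      exact this.1
    · exact Eventually.of_forall fun x => by rw [SchwartzMap.lineDerivOp_apply_eq_fderiv]
  have hl1 : Tendsto (fun n => ∫ x, g x * fderiv ℝ (φ n) x e) atTop
      (𝓝 (∫ x, g x * fderiv ℝ ψ x e)) := by
    refine tendsto_integral_of_dominated_convergence
      (fun x => ‖g x * fderiv ℝ ψ x e‖ + K * ‖g x * ψ x‖) ?_ ?_ ?_ ?_
    · intro n
      refine hg.1.mul (Continuous.aestronglyMeasurable ?_)
      exact ((htest n).1.continuous_fderiv (by simp)).clm_apply continuous_const
    · exact (integrable_mul_of_memLp_two hg hψe).norm.add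
        ((integrable_mul_of_memLp_two hg hψ2).norm.const_mul K)
    · intro n
      refine Eventually.of_forall fun x => ?_
      rw [hder, norm_mul, norm_mul, norm_mul]
      have h1 : ‖c (a n • x) * fderiv ℝ ψ x e + ((a n : ℂ) * fderiv ℝ c (a n • x) e) * ψ x‖
          ≤ ‖fderiv ℝ ψ x e‖ + K * ‖ψ x‖ := by
        refine (norm_add_le _ _).trans (add_le_add ?_ ?_)
        · rw [norm_mul]
          exact mul_le_of_le_one_left (norm_nonneg _) (hc1 _)
        · rw [norm_mul, norm_mul, Complex.norm_real, Real.norm_of_nonneg (ha0 n).le]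
          gcongr
          calc a n * ‖fderiv ℝ c (a n • x) e‖ ≤ 1 * K := by
                gcongr
                · exact ha1 n
                · exact hK _
            _ = K := one_mul K
      calc _ ≤ ‖g x‖ * (‖fderiv ℝ ψ x e‖ + K * ‖ψ x‖) := by gcongr
        _ = _ := by ring
    · refine Eventually.of_forall fun x => ?_
      simp only [hder]
      have h1 : Tendsto (fun n => ((a n : ℂ) * fderiv ℝ c (a n • x) e)) atTop (𝓝 0) := by
        have h2 : Tendsto (fun n => a n * K) atTop (𝓝 0) := by simpa using halim.mul_const K
        refine squeeze_zero_norm (fun n => ?_) h2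
        rw [norm_mul, Complex.norm_real, Real.norm_of_nonneg (ha0 n).le]
        exact mul_le_mul_of_nonneg_left (hK _) (ha0 n).le
      have h3 := (((hclim x).mul_const (fderiv ℝ ψ x e)).add (h1.mul_const (ψ x))).const_mul (g x)
      simpa using h3
  have hl2 : Tendsto (fun n => ∫ x, v x * φ n x) atTop (𝓝 (∫ x, v x * ψ x)) := by
    refine tendsto_integral_of_dominated_convergence (fun x => ‖v x * ψ x‖) ?_ ?_ ?_ ?_
    · exact fun n => hv.1.mul (htest n).1.continuous.aestronglyMeasurable
    · exact (integrable_mul_of_memLp_two hv hψ2).norm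
    · intro n
      refine Eventually.of_forall fun x => ?_
      rw [norm_mul, norm_mul, norm_mul]
      gcongr
      exact mul_le_of_le_one_left (norm_nonneg _) (hc1 _)
    · refine Eventually.of_forall fun x => ?_
      simpa using ((hclim x).mul_const (ψ x)).const_mul (v x)
  refine tendsto_nhds_unique hl1 (hl2.neg.congr fun n => ?_)
  exact (H (φ n) (htest n)).symm

theorem memLp_component {v : Rd d → EuclideanSpace ℂ (Fin d)} (hv : MemLp v 2 volume)
    (j : Fin d) : MemLp (fun x => v x j) 2 volume :=
  memLp_piLp_iff.1 hv j

theorem IsSobolevW12.isFourierGradient {g : Rd d → ℂ} {v : Rd d → EuclideanSpace ℂ (Fin d)}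
    (h : IsSobolevW12 g v) :
    IsFourierGradient h.memLp.toLp fun j => (memLp_component h.memLp_grad j).toLp := by
  intro j
  refine lineDeriv_eq_iff_fourier.1 ?_
  ext ψ
  have h1 := integral_schwartz_of_forall_test h.memLp (memLp_component h.memLp_grad j)
    (fun φ hφ => h.hasWeakGradient.integral_eq φ hφ j) ψ
  simp only [TemperedDistribution.lineDerivOp_apply_apply, map_neg,
    Lp.toTemperedDistribution_apply, SchwartzMap.lineDerivOp_apply_eq_fderiv, smul_eq_mul]
  have h2 : ∫ x, fderiv ℝ ψ x (EuclideanSpace.single j 1) * (h.memLp.toLp : L2 d) x =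
      ∫ x, g x * fderiv ℝ ψ x (EuclideanSpace.single j 1) := by
    refine integral_congr_ae ?_
    filter_upwards [h.memLp.coeFn_toLp] with x hx
    rw [hx, mul_comm]
  have h3 : ∫ x, ψ x * ((memLp_component h.memLp_grad j).toLp : L2 d) x =
      ∫ x, v x j * ψ x := by
    refine integral_congr_ae ?_
    filter_upwards [(memLp_component h.memLp_grad j).coeFn_toLp] with x hx
    rw [hx, mul_comm]
  rw [h2, h3, h1, neg_neg]

/-! ### Comparison of Bessel potential scales -/

/-- `W^{1,2}` is contained in the range of `(ζ - Δ)^(-1/4)`. -/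
theorem IsFourierGradient.exists_resolventPow_quarter {g : L2 d} {v : Fin d → L2 d}
    (h : IsFourierGradient g v) {ζ : ℂ} (hζ : 0 < ζ.re) :
    ∃ k : L2 d, resolventPow ζ (1 / 4) k = g := by
  have hm : MemLp (fun ξ => resolventSymbol ζ (-(1 / 4)) ξ * (𝓕 g : L2 d) ξ) 2
      (volume : Measure (Rd d)) := by
    have hb : MemLp (fun ξ => (1 + √‖ζ‖) * ‖(𝓕 g : L2 d) ξ‖ + ∑ j, ‖(𝓕 (v j) : L2 d) ξ‖) 2
        (volume : Measure (Rd d)) := by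
      refine ((Lp.memLp (𝓕 g : L2 d)).norm.const_mul _).add ?_
      exact memLp_finsetSum _ fun j _ => (Lp.memLp (𝓕 (v j) : L2 d)).norm
    refine hb.mono' ?_ ?_
    · exact (continuous_resolventSymbol hζ _).aestronglyMeasurable.mul (Lp.memLp _).1
    · filter_upwards [eventually_all.2 h] with ξ hξ
      have h1 : ∑ j, ‖(𝓕 (v j) : L2 d) ξ‖ = 2 * Real.pi * (∑ j, |ξ j|) * ‖(𝓕 g : L2 d) ξ‖ := by
        rw [Finset.mul_sum, Finset.sum_mul]
        refine Finset.sum_congr rfl fun j _ => ?_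
        rw [hξ j]
        simp [abs_of_pos Real.pi_pos]
      rw [h1, ← add_mul, norm_mul]
      gcongr
      rw [norm_resolventSymbol]
      have h2 : ‖ξ‖ ≤ ∑ j, |ξ j| := by
        have h3 : ξ = ∑ j, EuclideanSpace.single j (ξ j) := by
          ext i; simp
        conv_lhs => rw [h3]
        refine (norm_sum_le _ _).trans (le_of_eq ?_)
        simp
      have h4 : ‖ζ + (laplaceSymbol ξ : ℂ)‖ ≤ (√‖ζ‖ + 2 * Real.pi * ‖ξ‖) ^ 2 := by
        refine (norm_add_le _ _).trans ?_
        rw [Complex.norm_real, Real.norm_of_nonneg (laplaceSymbol_nonneg ξ), laplaceSymbol]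
        have h5 := Real.sq_sqrt (norm_nonneg ζ)
        have h6 : 0 ≤ √‖ζ‖ * (2 * Real.pi * ‖ξ‖) := by positivity
        nlinarith
      set y := √‖ζ‖ + 2 * Real.pi * ‖ξ‖ with hy
      have hy0 : 0 ≤ y := by positivity
      calc ‖ζ + (laplaceSymbol ξ : ℂ)‖ ^ (-(-(1 / 4 : ℝ)))
          ≤ (y ^ 2) ^ (-(-(1 / 4 : ℝ))) := by gcongr
        _ ≤ ((1 + y) ^ 2) ^ (-(-(1 / 4 : ℝ))) := by gcongr; linarith
        _ = (1 + y) ^ (1 / 2 : ℝ) := by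
          rw [← Real.rpow_natCast, ← Real.rpow_mul (by positivity)]
          norm_num
        _ ≤ (1 + y) ^ (1 : ℝ) := Real.rpow_le_rpow_of_exponent_le (by linarith) (by norm_num)
        _ ≤ _ := by
          rw [Real.rpow_one, hy]
          have : 2 * Real.pi * ‖ξ‖ ≤ 2 * Real.pi * ∑ j, |ξ j| := by gcongr
          linarith
  obtain ⟨k, hk⟩ := exists_fourier_eq hm
  refine ⟨k, (resolventPow_eq_iff hζ (by norm_num)).2 ?_⟩
  filter_upwards [hk] with ξ hξ
  rw [hξ, ← mul_assoc, resolventSymbol_mul hζ]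
  norm_num
  rw [resolventSymbol_zero, one_mul]

/-- The range of `(ζ - Δ)^(-α)` does not depend on `ζ`. -/
theorem exists_resolventPow_eq {ζ η : ℂ} (hζ : 0 < ζ.re) (hη : 0 < η.re) {α : ℝ} (hα : 0 ≤ α)
    (h : L2 d) : ∃ k : L2 d, resolventPow η α k = resolventPow ζ α h := by
  set m : Rd d → ℂ := fun ξ => resolventSymbol η (-α) ξ * resolventSymbol ζ α ξ with hm
  have hmb : ∀ ξ, ‖m ξ‖ ≤ (‖η‖ / ζ.re + 1) ^ α := by
    intro ξ
    rw [hm, norm_mul, norm_resolventSymbol, norm_resolventSymbol, neg_neg,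
      Real.rpow_neg (norm_nonneg _), ← div_eq_mul_inv, ← Real.div_rpow (norm_nonneg _)
      (norm_nonneg _)]
    have h0 := le_re_add_laplaceSymbol ζ ξ
    have hs := laplaceSymbol_nonneg ξ
    refine Real.rpow_le_rpow (by positivity) ?_ hα
    rw [div_le_iff₀ (by linarith)]
    calc ‖η + (laplaceSymbol ξ : ℂ)‖ ≤ ‖η‖ + laplaceSymbol ξ := by
          refine (norm_add_le _ _).trans ?_
          rw [Complex.norm_real, Real.norm_of_nonneg hs]
      _ ≤ (‖η‖ / ζ.re + 1) * (ζ.re + laplaceSymbol ξ) := by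
          have h1 : ‖η‖ / ζ.re * ζ.re = ‖η‖ := by field_simp
          have h2 : 0 ≤ ‖η‖ / ζ.re * laplaceSymbol ξ := by positivity
          nlinarith
      _ ≤ _ := by gcongr
  have hmL : MemLp m ∞ (volume : Measure (Rd d)) := memLp_top_of_continuous
    ((continuous_resolventSymbol hη (-α)).mul (continuous_resolventSymbol hζ α)) hmb
  refine ⟨fourierMultiplierL2 m h, (resolventPow_eq_iff hη hα).2 ?_⟩
  filter_upwards [fourier_resolventPow hζ hα h, fourier_fourierMultiplierL2 hmL h] with ξ h1 h2
  rw [h1, h2, hm, ← mul_assoc, ← mul_assoc, resolventSymbol_mul hη, add_neg_cancel,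
    resolventSymbol_zero, one_mul]

/-! ### The operators `H` and `S` -/

theorem L2_norm_sq_eq_integral (f : L2 d) : ‖f‖ ^ 2 = ∫ x, ‖f x‖ ^ 2 := by
  have h1 : (inner ℂ f f : ℂ) = ((‖f‖ ^ 2 : ℝ) : ℂ) := by
    rw [inner_self_eq_norm_sq_to_K]; norm_cast
  rw [L2_inner_eq_integral] at h1
  have h2 : ∫ x, f x * conj (f x) = ((∫ x, ‖f x‖ ^ 2 : ℝ) : ℂ) := by
    rw [← integral_complex_ofReal]
    refine integral_congr_ae (Eventually.of_forall fun x => ?_)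
    simp only
    rw [Complex.mul_conj, Complex.normSq_eq_norm_sq]
  rw [h2] at h1
  exact_mod_cast h1.symm

theorem L2_integrable_norm_sq (f : L2 d) : Integrable fun x => ‖f x‖ ^ 2 :=
  (Lp.memLp f).integrable_norm_pow (by norm_num)

theorem norm_resolventSymbol_le_of_le_re {ζ : ℂ} {lam : ℝ} (hlam : 0 < lam) (hζ : lam ≤ ζ.re)
    {α : ℝ} (hα : 0 ≤ α) (ξ : Rd d) :
    ‖resolventSymbol ζ α ξ‖ ≤ ‖resolventSymbol (lam : ℂ) α ξ‖ := by
  rw [norm_resolventSymbol, norm_resolventSymbol]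
  have h1 := le_re_add_laplaceSymbol ζ ξ
  have hs := laplaceSymbol_nonneg ξ
  have h2 : ‖(lam : ℂ) + (laplaceSymbol ξ : ℂ)‖ = lam + laplaceSymbol ξ := by
    rw [← Complex.ofReal_add, Complex.norm_real, Real.norm_of_nonneg (by linarith)]
  refine Real.rpow_le_rpow_of_nonpos ?_ ?_ (by linarith)
  · rw [h2]; linarith
  · rw [h2]; linarith

theorem norm_resolventSymbol_mul_neg_le_one {ζ : ℂ} {lam : ℝ} (hlam : 0 < lam)
    (hζ : lam ≤ ζ.re) {α : ℝ} (hα : 0 ≤ α) (ξ : Rd d) :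
    ‖resolventSymbol (lam : ℂ) (-α) ξ * resolventSymbol ζ α ξ‖ ≤ 1 := by
  rw [norm_mul]
  calc _ ≤ ‖resolventSymbol (lam : ℂ) (-α) ξ‖ * ‖resolventSymbol (lam : ℂ) α ξ‖ := by
        gcongr; exact norm_resolventSymbol_le_of_le_re hlam hζ hα ξ
    _ = 1 := by
        rw [← norm_mul, resolventSymbol_mul (by simpa using hlam), neg_add_cancel,
          resolventSymbol_zero, norm_one]

/-- The operator `|b|^(1/2) (lam - Δ)^(-1/4)`. -/
theorem WeakFormBound.exists_operator {b : Rd d → Rd d} {δ lam : ℝ}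
    (hb : AEStronglyMeasurable b volume) (h : WeakFormBound b δ lam) :
    ∃ K : L2 d →L[ℂ] L2 d, (∀ f : L2 d, K f =ᵐ[volume]
      fun x => ((√‖b x‖ : ℝ) : ℂ) * (resolventPow (lam : ℂ) (1 / 4) f : L2 d) x) ∧
      ‖K‖ ≤ √δ := by
  have hsq : AEStronglyMeasurable (fun x => ((√‖b x‖ : ℝ) : ℂ)) volume :=
    Complex.continuous_ofReal.comp_aestronglyMeasurable
      (Real.continuous_sqrt.comp_aestronglyMeasurable hb.norm)
  have hmem : ∀ f : L2 d, MemLp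
      (fun x => ((√‖b x‖ : ℝ) : ℂ) * (resolventPow (lam : ℂ) (1 / 4) f : L2 d) x) 2 volume :=
    fun f => ⟨hsq.mul (Lp.memLp _).1,
      (h f).trans_lt (ENNReal.mul_lt_top ENNReal.ofReal_lt_top enorm_lt_top)⟩
  let K₀ : L2 d →ₗ[ℂ] L2 d :=
    { toFun := fun f => (hmem f).toLp
      map_add' := by
        intro f g
        refine Lp.ext ?_
        filter_upwards [(hmem (f + g)).coeFn_toLp, (hmem f).coeFn_toLp, (hmem g).coeFn_toLp,
          Lp.coeFn_add ((hmem f).toLp) ((hmem g).toLp),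
          Lp.coeFn_add (resolventPow (lam : ℂ) (1 / 4) f) (resolventPow (lam : ℂ) (1 / 4) g)]
          with x h1 h2 h3 h4 h5
        rw [h4, Pi.add_apply, h2, h3, h1, map_add, h5, Pi.add_apply, mul_add]
      map_smul' := by
        intro c f
        refine Lp.ext ?_
        filter_upwards [(hmem (c • f)).coeFn_toLp, (hmem f).coeFn_toLp,
          Lp.coeFn_smul c ((hmem f).toLp),
          Lp.coeFn_smul c (resolventPow (lam : ℂ) (1 / 4) f)] with x h1 h2 h3 h4
        rw [RingHom.id_apply, h3, Pi.smul_apply, h2, h1, map_smul, h4, Pi.smul_apply, smul_eq_mul,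
          smul_eq_mul]
        ring }
  have hbound : ∀ f, ‖K₀ f‖ ≤ √δ * ‖f‖ := by
    intro f
    have h1 : ‖K₀ f‖ = (eLpNorm (fun x => ((√‖b x‖ : ℝ) : ℂ) *
      (resolventPow (lam : ℂ) (1 / 4) f : L2 d) x) 2 volume).toReal := Lp.norm_toLp _ (hmem f)
    rw [h1]
    refine (ENNReal.toReal_mono (ENNReal.mul_ne_top ENNReal.ofReal_ne_top enorm_ne_top)
      (h f)).trans (le_of_eq ?_)
    rw [ENNReal.toReal_mul, ENNReal.toReal_ofReal (Real.sqrt_nonneg _), toReal_enorm]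
  exact ⟨K₀.mkContinuous _ hbound, fun f => (hmem f).coeFn_toLp,
    LinearMap.mkContinuous_norm_le _ (Real.sqrt_nonneg _) _⟩

/-- `H` is `|b|^{1/2} (lam - Δ)^(-1/4)` composed with the contraction
`(lam - Δ)^(1/4) (conj ζ - Δ)^(-1/4)`. -/
theorem exists_operatorH {b : Rd d → Rd d} {δ lam : ℝ} (hb : AEStronglyMeasurable b volume)
    (hlam : 0 < lam) (h : WeakFormBound b δ lam) {ζ : ℂ} (hζ : lam ≤ ζ.re) :
    ∃ H : L2 d →L[ℂ] L2 d, IsOperatorH b ζ H ∧ ‖H‖ ≤ √δ := by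
  obtain ⟨K, hK, hKn⟩ := h.exists_operator hb
  have hζ' : lam ≤ (conj ζ).re := by simpa using hζ
  have hζ0 : 0 < (conj ζ).re := hlam.trans_le hζ'
  have hlam' : 0 < ((lam : ℂ)).re := by simpa using hlam
  have hm1 := norm_resolventSymbol_mul_neg_le_one (d := d) hlam hζ' (α := 1 / 4) (by norm_num)
  have hm : MemLp (fun ξ : Rd d => resolventSymbol (lam : ℂ) (-(1 / 4)) ξ *
      resolventSymbol (conj ζ) (1 / 4) ξ) ∞ volume :=
    memLp_top_of_continuous
      ((continuous_resolventSymbol hlam' _).mul (continuous_resolventSymbol hζ0 _)) hm1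
  set G : L2 d →L[ℂ] L2 d := fourierMultiplierL2 (fun ξ : Rd d =>
    resolventSymbol (lam : ℂ) (-(1 / 4)) ξ * resolventSymbol (conj ζ) (1 / 4) ξ) with hG
  have hfac : ∀ f, resolventPow (lam : ℂ) (1 / 4) (G f) = resolventPow (conj ζ) (1 / 4) f := by
    intro f
    refine (resolventPow_eq_iff hlam' (by norm_num)).2 ?_
    filter_upwards [fourier_resolventPow hζ0 (α := 1 / 4) (by norm_num) f,
      fourier_fourierMultiplierL2 hm f] with ξ h1 h2
    rw [h1, h2, ← mul_assoc, ← mul_assoc, resolventSymbol_mul hlam', add_neg_cancel,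
      resolventSymbol_zero, one_mul]
  refine ⟨K ∘L G, fun f => ?_, ?_⟩
  · have := hK (G f)
    rwa [hfac] at this
  · calc ‖K ∘L G‖ ≤ ‖K‖ * ‖G‖ := ContinuousLinearMap.opNorm_comp_le _ _
      _ ≤ √δ * 1 := by
        gcongr
        exact norm_fourierMultiplierL2_le hm hm1
      _ = √δ := mul_one _

/-- The symbol of `∂_j (ζ - Δ)^(-3/4) (lam - Δ)^(1/4)`. -/
def gradientSymbol (ζ : ℂ) (lam : ℝ) (j : Fin d) (ξ : Rd d) : ℂ :=
  2 * Real.pi * Complex.I * (ξ j : ℂ) *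
    (resolventSymbol (lam : ℂ) (-(1 / 4)) ξ * resolventSymbol ζ (3 / 4) ξ)

theorem sum_norm_gradientSymbol_sq_le {ζ : ℂ} {lam : ℝ} (hlam : 0 < lam) (hζ : lam ≤ ζ.re)
    (ξ : Rd d) : ∑ j, ‖gradientSymbol ζ lam j ξ‖ ^ 2 ≤ 1 := by
  have hζ0 : 0 < ζ.re := hlam.trans_le hζ
  have h1 : ∑ j, ‖gradientSymbol ζ lam j ξ‖ ^ 2 = laplaceSymbol ξ *
      (‖resolventSymbol (lam : ℂ) (-(1 / 4)) ξ‖ * ‖resolventSymbol ζ (3 / 4) ξ‖) ^ 2 := by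
    have h2 : laplaceSymbol ξ = ∑ j, (2 * Real.pi) ^ 2 * (ξ j) ^ 2 := by
      rw [← Finset.mul_sum, laplaceSymbol, mul_pow, EuclideanSpace.norm_sq_eq]
      simp
    rw [h2, Finset.sum_mul]
    refine Finset.sum_congr rfl fun j _ => ?_
    rw [gradientSymbol, norm_mul, norm_mul _ (resolventSymbol ζ _ ξ)]
    simp only [norm_mul, Complex.norm_ofNat, Complex.norm_real, Complex.norm_I, Real.norm_eq_abs,
      abs_of_pos Real.pi_pos, mul_one]
    rw [mul_pow, mul_pow (2 * Real.pi) |ξ j| 2, sq_abs]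
  have h3 : resolventSymbol ζ (3 / 4) ξ = resolventSymbol ζ (1 / 2) ξ *
      resolventSymbol ζ (1 / 4) ξ := by rw [resolventSymbol_mul hζ0]; norm_num
  have h4 := norm_resolventSymbol_mul_neg_le_one (d := d) hlam hζ (α := 1 / 4) (by norm_num) ξ
  have h5 : ‖resolventSymbol (lam : ℂ) (-(1 / 4)) ξ‖ * ‖resolventSymbol ζ (3 / 4) ξ‖ ≤
      ‖resolventSymbol ζ (1 / 2) ξ‖ := by
    rw [norm_mul] at h4
    rw [h3, norm_mul]
    calc _ = ‖resolventSymbol ζ (1 / 2) ξ‖ * (‖resolventSymbol (lam : ℂ) (-(1 / 4)) ξ‖ *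
          ‖resolventSymbol ζ (1 / 4) ξ‖) := by ring
      _ ≤ ‖resolventSymbol ζ (1 / 2) ξ‖ * 1 := by gcongr
      _ = _ := mul_one _
  have hs := laplaceSymbol_nonneg ξ
  have h6 := le_re_add_laplaceSymbol ζ ξ
  have hpos : 0 < ‖ζ + (laplaceSymbol ξ : ℂ)‖ := by linarith
  rw [h1]
  calc _ ≤ laplaceSymbol ξ * ‖resolventSymbol ζ (1 / 2) ξ‖ ^ 2 := by gcongr
    _ = laplaceSymbol ξ * ‖ζ + (laplaceSymbol ξ : ℂ)‖⁻¹ := by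
      rw [norm_resolventSymbol, ← Real.rpow_natCast, ← Real.rpow_mul (norm_nonneg _)]
      norm_num
      left
      exact Real.rpow_neg_one _
    _ ≤ 1 := by
      rw [← div_eq_mul_inv, div_le_one hpos]
      linarith

theorem sqrtField_apply_eq (b : Rd d → Rd d) (x : Rd d) (j : Fin d) :
    sqrtField b x j = (b x j / ‖b x‖) * √‖b x‖ := by
  rw [sqrtField, PiLp.smul_apply, smul_eq_mul]
  rcases eq_or_ne (b x) 0 with h | h
  · simp [h]
  · have h1 : 0 < ‖b x‖ := norm_pos_iff.2 h
    have h2 : 0 < √‖b x‖ := Real.sqrt_pos.2 h1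
    have h3 := Real.mul_self_sqrt h1.le
    field_simp
    rw [sq, h3, mul_comm]

theorem sum_div_norm_sq_le (b : Rd d) : ∑ j, (b j / ‖b‖) ^ 2 ≤ 1 := by
  simp only [div_pow]
  rw [← Finset.sum_div, EuclideanSpace.norm_sq_eq]
  simp only [Real.norm_eq_abs, sq_abs]
  exact div_self_le_one _

/-- The operator `S`, with its gradient in `L²`. Up to the factor `b / |b|`, it is the composition
of `|b|^{1/2} (lam - Δ)^(-1/4)` with the vector of Fourier multipliers `gradientSymbol`, which is a
contraction. -/
theorem exists_operatorS {b : Rd d → Rd d} {δ lam : ℝ}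
    (hb : AEStronglyMeasurable b volume)
    (hlam : 0 < lam) (h : WeakFormBound b δ lam) {ζ : ℂ} (hζ : lam ≤ ζ.re) :
    ∃ S : L2 d →L[ℂ] L2 d, (∀ f : L2 d, ∃ w : Fin d → L2 d,
      IsFourierGradient (resolventPow ζ (3 / 4) f) w ∧
        S f =ᵐ[volume] fun x => dotC (sqrtField b x) (vecField w x)) ∧ ‖S‖ ≤ √δ := by
  obtain ⟨K, hK, hKn⟩ := h.exists_operator hb
  have hζ0 : 0 < ζ.re := hlam.trans_le hζ
  have hlam' : 0 < ((lam : ℂ)).re := by simpa using hlam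
  have hg1 : ∀ (j : Fin d) ξ, ‖gradientSymbol ζ lam j ξ‖ ≤ 1 := by
    intro j ξ
    have h1 := sum_norm_gradientSymbol_sq_le hlam hζ ξ
    have h2 : ‖gradientSymbol ζ lam j ξ‖ ^ 2 ≤ ∑ j, ‖gradientSymbol ζ lam j ξ‖ ^ 2 :=
      Finset.single_le_sum (f := fun j => ‖gradientSymbol ζ lam j ξ‖ ^ 2)
        (fun i _ => sq_nonneg _) (Finset.mem_univ j)
    exact (sq_le_one_iff₀ (norm_nonneg _)).1 (h2.trans h1)
  have hgm : ∀ j : Fin d, MemLp (gradientSymbol ζ lam j) ∞ (volume : Measure (Rd d)) := by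
    intro j
    refine memLp_top_of_continuous ?_ (hg1 j)
    unfold gradientSymbol
    exact (by fun_prop : Continuous fun ξ : Rd d => 2 * (Real.pi : ℂ) * Complex.I * (ξ j : ℂ)).mul
      ((continuous_resolventSymbol hlam' _).mul (continuous_resolventSymbol hζ0 _))
  set G : Fin d → L2 d →L[ℂ] L2 d := fun j => fourierMultiplierL2 (gradientSymbol ζ lam j)
  have he : ∀ j : Fin d, MemLp (fun x => ((b x j / ‖b x‖ : ℝ) : ℂ)) ∞
      (volume : Measure (Rd d)) := by
    intro j
    have hbj : AEStronglyMeasurable (fun x => b x j) (volume : Measure (Rd d)) :=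
      (EuclideanSpace.proj (𝕜 := ℝ) j).continuous.comp_aestronglyMeasurable hb
    refine memLp_top_of_bound (C := 1) (Complex.continuous_ofReal.comp_aestronglyMeasurable
      (hbj.aemeasurable.div hb.norm.aemeasurable).aestronglyMeasurable)
      (Eventually.of_forall fun x => ?_)
    rw [Complex.norm_real, norm_div, norm_norm]
    exact div_le_one_of_le₀ (PiLp.norm_apply_le (b x) j) (norm_nonneg _)
  set S : L2 d →L[ℂ] L2 d := ∑ j, mulL2 (he j) ∘L K ∘L G j with hS
  have hSf : ∀ f, S f =ᵐ[volume] fun x =>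
      ∑ j, ((b x j / ‖b x‖ : ℝ) : ℂ) * (K (G j f) : L2 d) x := by
    intro f
    have h1 : S f = ∑ j, mulL2 (he j) (K (G j f)) := by
      rw [hS, sum_apply]; rfl
    rw [h1]
    have h2 := Lp.coeFn_finsetSum Finset.univ fun j => mulL2 (he j) (K (G j f))
    have h3 := eventually_all.2 fun j => coeFn_mulL2 (he j) (K (G j f))
    filter_upwards [h2, h3] with x h2 h3
    rw [h2, Finset.sum_apply]
    exact Finset.sum_congr rfl fun j _ => h3 j
  refine ⟨S, fun f => ⟨fun j => resolventPow (lam : ℂ) (1 / 4) (G j f), ?_, ?_⟩, ?_⟩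
  · intro j
    filter_upwards [fourier_resolventPow hlam' (α := 1 / 4) (by norm_num) (G j f),
      fourier_fourierMultiplierL2 (hgm j) f, fourier_resolventPow hζ0 (α := 3 / 4) (by norm_num) f]
      with ξ h1 h2 h3
    rw [h1, h2, h3, gradientSymbol]
    have h4 : resolventSymbol (lam : ℂ) (1 / 4) ξ * resolventSymbol (lam : ℂ) (-(1 / 4)) ξ = 1 := by
      rw [resolventSymbol_mul hlam', add_neg_cancel, resolventSymbol_zero]
    linear_combination (2 * Real.pi * Complex.I * (ξ j : ℂ) * resolventSymbol ζ (3 / 4) ξ *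
      (𝓕 f : L2 d) ξ) * h4
  · filter_upwards [hSf f, eventually_all.2 fun j => hK (G j f)] with x h1 h2
    rw [h1, dotC]
    refine Finset.sum_congr rfl fun j _ => ?_
    rw [h2 j, sqrtField_apply_eq, vecField_apply]
    push_cast
    ring
  · refine ContinuousLinearMap.opNorm_le_bound _ (Real.sqrt_nonneg _) fun f => ?_
    refine le_of_sq_le_sq ?_ (by positivity)
    have h1 : ‖S f‖ ^ 2 ≤ ∑ j, ‖K (G j f)‖ ^ 2 := by
      simp only [L2_norm_sq_eq_integral]
      rw [← integral_finsetSum _ fun j _ => L2_integrable_norm_sq _]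
      refine integral_mono_ae (L2_integrable_norm_sq _)
        (integrable_finsetSum _ fun j _ => L2_integrable_norm_sq _) ?_
      filter_upwards [hSf f] with x hx
      rw [hx]
      calc ‖∑ j, ((b x j / ‖b x‖ : ℝ) : ℂ) * (K (G j f) : L2 d) x‖ ^ 2
          ≤ (∑ j, |b x j / ‖b x‖| * ‖(K (G j f) : L2 d) x‖) ^ 2 := by
            gcongr
            refine (norm_sum_le _ _).trans (le_of_eq (Finset.sum_congr rfl fun j _ => ?_))
            rw [norm_mul, Complex.norm_real, Real.norm_eq_abs]
        _ ≤ (∑ j, |b x j / ‖b x‖| ^ 2) * ∑ j, ‖(K (G j f) : L2 d) x‖ ^ 2 :=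
            Finset.sum_mul_sq_le_sq_mul_sq _ _ _
        _ ≤ 1 * ∑ j, ‖(K (G j f) : L2 d) x‖ ^ 2 := by
            gcongr
            simp only [sq_abs]
            exact sum_div_norm_sq_le (b x)
        _ = _ := one_mul _
    have h2 : ∑ j, ‖G j f‖ ^ 2 ≤ ‖f‖ ^ 2 := by
      have h3 : ∀ j, ‖G j f‖ ^ 2 = ∫ ξ, ‖(𝓕 (G j f) : L2 d) ξ‖ ^ 2 := fun j => by
        rw [← L2_norm_sq_eq_integral, Lp.norm_fourier_eq]
      simp only [h3]
      rw [← integral_finsetSum _ fun j _ => L2_integrable_norm_sq _, ← Lp.norm_fourier_eq f,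
        L2_norm_sq_eq_integral]
      refine integral_mono_ae (integrable_finsetSum _ fun j _ => L2_integrable_norm_sq _)
        (L2_integrable_norm_sq _) ?_
      filter_upwards [eventually_all.2 fun j => fourier_fourierMultiplierL2 (hgm j) f] with ξ hξ
      have h4 : ∑ j, ‖(𝓕 (G j f) : L2 d) ξ‖ ^ 2 =
          (∑ j, ‖gradientSymbol ζ lam j ξ‖ ^ 2) * ‖(𝓕 f : L2 d) ξ‖ ^ 2 := by
        rw [Finset.sum_mul]
        refine Finset.sum_congr rfl fun j _ => ?_
        rw [hξ j, norm_mul, mul_pow]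
      rw [h4]
      exact mul_le_of_le_one_left (sq_nonneg _) (sum_norm_gradientSymbol_sq_le hlam hζ ξ)
    calc ‖S f‖ ^ 2 ≤ ∑ j, ‖K (G j f)‖ ^ 2 := h1
      _ ≤ ∑ j, (√δ) ^ 2 * ‖G j f‖ ^ 2 := by
        refine Finset.sum_le_sum fun j _ => ?_
        rw [← mul_pow]
        gcongr
        exact K.le_of_opNorm_le hKn _
      _ = (√δ) ^ 2 * ∑ j, ‖G j f‖ ^ 2 := by rw [Finset.mul_sum]
      _ ≤ (√δ) ^ 2 * ‖f‖ ^ 2 := by gcongr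
      _ = _ := by rw [mul_pow]

/-! ### Inverses of `1 + AB` and `1 + BA` -/

section Ring

variable {𝔸 : Type*}

theorem ring_inverse_eq_of_mul_eq_one [Ring 𝔸] {x y : 𝔸} (hx : IsUnit x) (h : x * y = 1) :
    Ring.inverse x = y := by
  calc Ring.inverse x = Ring.inverse x * (x * y) := by rw [h, mul_one]
    _ = y := by rw [← mul_assoc, Ring.inverse_mul_cancel x hx, one_mul]

theorem ring_inverse_one_add_mul [Ring 𝔸] {a b : 𝔸} (h₁ : IsUnit (1 + a * b))
    (h₂ : IsUnit (1 + b * a)) :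
    Ring.inverse (1 + a * b) = 1 - a * (Ring.inverse (1 + b * a) * b) := by
  refine ring_inverse_eq_of_mul_eq_one h₁ ?_
  have h3 := Ring.mul_inverse_cancel _ h₂
  set J := Ring.inverse (1 + b * a)
  have h4 : J + b * a * J = 1 := by rw [← h3, add_mul, one_mul]
  calc (1 + a * b) * (1 - a * (J * b)) = 1 + a * b - a * ((J + b * a * J) * b) := by noncomm_ring
    _ = 1 := by rw [h4, one_mul, add_sub_cancel_right]

theorem isUnit_one_add_of_norm_lt_one [NormedRing 𝔸] [CompleteSpace 𝔸] {t : 𝔸} (h : ‖t‖ < 1) :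
    IsUnit (1 + t) := by
  have h1 : ‖-t‖ < 1 := by rwa [norm_neg]
  have h2 := (Units.oneSub (-t) h1).isUnit
  rwa [Units.val_oneSub, sub_neg_eq_add] at h2

end Ring

theorem norm_ring_inverse_one_add_le {T : L2 d →L[ℂ] L2 d} {δ : ℝ} (hT : ‖T‖ ≤ δ) (hδ : δ < 1) :
    ‖Ring.inverse (1 + T)‖ ≤ (1 - δ)⁻¹ := by
  have h1 := Ring.mul_inverse_cancel _ (isUnit_one_add_of_norm_lt_one (hT.trans_lt hδ))
  have hδ' : 0 < 1 - δ := by linarith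
  refine ContinuousLinearMap.opNorm_le_bound _ (by positivity) fun f => ?_
  set y := Ring.inverse (1 + T) f with hy
  have h2 : y + T y = f := DFunLike.congr_fun h1 f
  have h3 : ‖T y‖ ≤ δ * ‖y‖ := T.le_of_opNorm_le hT y
  have h4 : ‖y‖ ≤ ‖f‖ + ‖T y‖ := by
    have := norm_sub_le (y + T y) (T y)
    rwa [add_sub_cancel_right, h2] at this
  rw [inv_mul_eq_div, le_div_iff₀ hδ']
  linarith

/-! ### The weak formulation -/

/-- `u` lies in the Bessel potential space of order `3/2` and `-Δu + b · ∇u = f` in the weak sense: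
`⟨f, g⟩ = ⟨∇u, ∇g⟩ + ⟨b^{1/2} · ∇u, |b|^{1/2} g⟩` for all `g` in `W^{1,2}`. The relation does not
involve a spectral parameter. The products `|b|^{1/2} g` and `b^{1/2} · ∇u` enter through their
classes `p` and `q` in `L²`; the requirement on `u` is what makes it the image of some
`(ζ - Δ)^(-3/4)`, on which `S` is defined. -/
def IsWeakSolution (b : Rd d → Rd d) (u f : L2 d) : Prop :=
  (∃ h, resolventPow 1 (3 / 4) h = u) ∧
    ∃ w : Fin d → L2 d, IsFourierGradient u w ∧
      ∃ q : L2 d, (q =ᵐ[volume] fun x => dotC (sqrtField b x) (vecField w x)) ∧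
        ∀ (g : L2 d) (v : Fin d → L2 d) (p : L2 d), IsFourierGradient g v →
          (p =ᵐ[volume] fun x => ((√‖b x‖ : ℝ) : ℂ) * g x) →
          inner ℂ g f = ∑ j, inner ℂ (v j) (w j) + inner ℂ p q

theorem IsFourierGradient.unique {u : L2 d} {w w' : Fin d → L2 d} (h : IsFourierGradient u w)
    (h' : IsFourierGradient u w') : w = w' :=
  funext fun j => L2_ext_fourier ((h j).trans (h' j).symm)

theorem L2_integrable_mul_conj (f g : L2 d) : Integrable fun x => g x * conj (f x) :=
  integrable_mul_of_memLp_two (Lp.memLp g) (Lp.memLp f).star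

theorem L2_inner_eq_integral_fourier (f g : L2 d) :
    inner ℂ f g = ∫ ξ, (𝓕 g : L2 d) ξ * conj ((𝓕 f : L2 d) ξ) := by
  rw [← Lp.inner_fourier_eq, L2_inner_eq_integral]

theorem resolventPow_quarter_quarter {ζ : ℂ} (hζ : 0 < ζ.re) (f : L2 d) :
    resolventPow ζ (1 / 4) (resolventPow ζ (1 / 4) f) = resolventPow ζ (1 / 2) f := by
  have h0 : (0 : ℝ) ≤ 1 / 4 := by norm_num
  have h1 : (1 / 4 : ℝ) + 1 / 4 = 1 / 2 := by norm_num
  rw [resolventPow_comp hζ h0 h0, h1]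

theorem resolventPow_three_quarters_quarter {ζ : ℂ} (hζ : 0 < ζ.re) (f : L2 d) :
    resolventPow ζ (3 / 4) (resolventPow ζ (1 / 4) f) = resolventPow ζ 1 f := by
  have h0 : (0 : ℝ) ≤ 1 / 4 := by norm_num
  have h1 : (0 : ℝ) ≤ 3 / 4 := by norm_num
  have h2 : (3 / 4 : ℝ) + 1 / 4 = 1 := by norm_num
  rw [resolventPow_comp hζ h1 h0, h2]

/-- `⟨∇u, ∇g⟩ + ζ ⟨u, g⟩` in terms of the sources of `u` and `g`: the powers `3/4` and `1/4` of the
resolvent add up to the inverse of `ζ - Δ`. -/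
theorem sum_inner_gradient_add {ζ : ℂ} (hζ : 0 < ζ.re) {g k u h : L2 d} {v w : Fin d → L2 d}
    (hv : IsFourierGradient g v) (hw : IsFourierGradient u w)
    (hg : resolventPow (conj ζ) (1 / 4) k = g) (hu : resolventPow ζ (3 / 4) h = u) :
    ∑ j, inner ℂ (v j) (w j) + ζ * inner ℂ g u = inner ℂ k h := by
  have hζ' : 0 < (conj ζ).re := by simpa using hζ
  simp only [L2_inner_eq_integral_fourier]
  rw [← integral_finsetSum _ fun j _ => L2_integrable_mul_conj _ _, ← integral_const_mul,
    ← integral_add (integrable_finsetSum _ fun j _ => L2_integrable_mul_conj _ _)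
      ((L2_integrable_mul_conj _ _).const_mul _)]
  refine integral_congr_ae ?_
  filter_upwards [eventually_all.2 hv, eventually_all.2 hw,
    (resolventPow_eq_iff hζ' (by norm_num)).1 hg, (resolventPow_eq_iff hζ (by norm_num)).1 hu]
    with ξ h1 h2 h3 h4
  have h5 : ∑ j, (𝓕 (w j) : L2 d) ξ * conj ((𝓕 (v j) : L2 d) ξ) =
      (laplaceSymbol ξ : ℂ) * ((𝓕 u : L2 d) ξ * conj ((𝓕 g : L2 d) ξ)) := by
    have h6 : laplaceSymbol ξ = ∑ j, (2 * Real.pi) ^ 2 * (ξ j) ^ 2 := by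
      rw [← Finset.mul_sum, laplaceSymbol, mul_pow, EuclideanSpace.norm_sq_eq]
      simp
    rw [h6, Complex.ofReal_sum, Finset.sum_mul]
    refine Finset.sum_congr rfl fun j _ => ?_
    rw [h1 j, h2 j]
    simp only [map_mul, Complex.conj_ofReal, Complex.conj_I, map_ofNat]
    push_cast
    linear_combination (-4 * (Real.pi : ℂ) ^ 2 * (ξ j : ℂ) ^ 2 * (𝓕 u : L2 d) ξ *
      conj ((𝓕 g : L2 d) ξ)) * Complex.I_mul_I
  have h7 : conj (resolventSymbol (conj ζ) (1 / 4) ξ) = resolventSymbol ζ (1 / 4) ξ := by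
    rw [conj_resolventSymbol hζ', Complex.conj_conj]
  have h8 : (ζ + (laplaceSymbol ξ : ℂ)) *
      (resolventSymbol ζ (3 / 4) ξ * resolventSymbol ζ (1 / 4) ξ) = 1 := by
    rw [← resolventSymbol_neg_one, resolventSymbol_mul hζ, resolventSymbol_mul hζ]
    norm_num
    exact resolventSymbol_zero ζ ξ
  rw [h5, h3, h4, map_mul, h7]
  linear_combination ((𝓕 h : L2 d) ξ * conj ((𝓕 k : L2 d) ξ)) * h8

theorem exists_fourierGradient_resolventPow_half {ζ : ℂ} (hζ : 0 < ζ.re) (k : L2 d) :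
    ∃ v : Fin d → L2 d, IsFourierGradient (resolventPow ζ (1 / 2) k) v := by
  have hm : ∀ j : Fin d, MemLp (fun ξ : Rd d => 2 * Real.pi * Complex.I * (ξ j : ℂ) *
      resolventSymbol ζ (1 / 2) ξ) ∞ volume := by
    intro j
    refine memLp_top_of_continuous (C := 1) ?_ fun ξ => ?_
    · exact (by fun_prop : Continuous fun ξ : Rd d =>
        2 * (Real.pi : ℂ) * Complex.I * (ξ j : ℂ)).mul (continuous_resolventSymbol hζ _)
    · have hs := laplaceSymbol_nonneg ξ
      have h6 := le_re_add_laplaceSymbol ζ ξ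
      have hpos : 0 < ‖ζ + (laplaceSymbol ξ : ℂ)‖ := by linarith
      have h1 : ‖2 * (Real.pi : ℂ) * Complex.I * (ξ j : ℂ)‖ ≤ √(laplaceSymbol ξ) := by
        rw [laplaceSymbol, Real.sqrt_sq (by positivity)]
        simp only [norm_mul, Complex.norm_ofNat, Complex.norm_real, Complex.norm_I,
          Real.norm_eq_abs, abs_of_pos Real.pi_pos, mul_one]
        gcongr
        exact PiLp.norm_apply_le ξ j
      rw [norm_mul, norm_resolventSymbol, Real.rpow_neg (norm_nonneg _), ← Real.sqrt_eq_rpow,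
        ← div_eq_mul_inv, div_le_one (Real.sqrt_pos.2 hpos)]
      exact h1.trans (Real.sqrt_le_sqrt (by linarith))
  refine ⟨fun j => fourierMultiplierL2 (fun ξ : Rd d => 2 * Real.pi * Complex.I * (ξ j : ℂ) *
      resolventSymbol ζ (1 / 2) ξ) k, fun j => ?_⟩
  filter_upwards [fourier_fourierMultiplierL2 (hm j) k,
    fourier_resolventPow hζ (α := 1 / 2) (by norm_num) k] with ξ h1 h2
  rw [h1, h2, mul_assoc]

set_option maxHeartbeats 1000000 in
/-- The weak equation `(ζ - Δ + b · ∇) u = f` is the equation `(1 + H*S) h = (ζ - Δ)^(-1/4) f` for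
the source `h` of `u = (ζ - Δ)^(-3/4) h`. -/
theorem isWeakSolution_iff {b : Rd d → Rd d} {ζ : ℂ} (hζ : 0 < ζ.re) {H S : L2 d →L[ℂ] L2 d}
    (hH : IsOperatorH b ζ H)
    (hS : ∀ f : L2 d, ∃ w : Fin d → L2 d, IsFourierGradient (resolventPow ζ (3 / 4) f) w ∧
      S f =ᵐ[volume] fun x => dotC (sqrtField b x) (vecField w x)) (u f : L2 d) :
    IsWeakSolution b u (f - ζ • u) ↔
      ∃ h, resolventPow ζ (3 / 4) h = u ∧
        (1 + H.adjoint ∘L S) h = resolventPow ζ (1 / 4) f := by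
  have hζ' : 0 < (conj ζ).re := by simpa using hζ
  have hpH : ∀ (k g p : L2 d), resolventPow (conj ζ) (1 / 4) k = g →
      (p =ᵐ[volume] fun x => ((√‖b x‖ : ℝ) : ℂ) * g x) → p = H k := by
    rintro k g p rfl hp
    exact Lp.ext (hp.trans (hH k).symm)
  -- both formulations, tested with `g = (conj ζ - Δ)^(-1/4) k`
  have key : ∀ (h k g p : L2 d) (v w : Fin d → L2 d), resolventPow ζ (3 / 4) h = u →
      resolventPow (conj ζ) (1 / 4) k = g → p = H k →
      IsFourierGradient g v → IsFourierGradient u w →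
      (inner ℂ g (f - ζ • u) = ∑ j, inner ℂ (v j) (w j) + inner ℂ p (S h) ↔
        inner ℂ k ((1 + H.adjoint ∘L S) h) = inner ℂ k (resolventPow ζ (1 / 4) f)) := by
    intro h k g p v w hu hg hp hv hw
    have h1 := sum_inner_gradient_add hζ hv hw hg hu
    have h2 : inner ℂ k (resolventPow ζ (1 / 4) f) = inner ℂ g f := by
      rw [inner_resolventPow hζ (by norm_num), hg]
    have h3 : inner ℂ k ((1 + H.adjoint ∘L S) h) = inner ℂ k h + inner ℂ p (S h) := by
      rw [add_apply, inner_add_right, one_apply_eq_self, ContinuousLinearMap.comp_apply,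
        ContinuousLinearMap.adjoint_inner_right, hp]
    rw [h2, h3, inner_sub_right, inner_smul_right, ← h1]
    constructor <;> intro h4 <;> linear_combination -h4
  constructor
  · rintro ⟨⟨h₀, hh₀⟩, w, hw, q, hq, hweak⟩
    obtain ⟨h, hh⟩ := exists_resolventPow_eq (ζ := 1) (η := ζ) (by simp) hζ (α := 3 / 4)
      (by norm_num) h₀
    rw [hh₀] at hh
    refine ⟨h, hh, ?_⟩
    have hqS : q = S h := by
      obtain ⟨w', hw', hSw'⟩ := hS h
      rw [hh] at hw'
      rw [hw'.unique hw] at hSw'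
      exact Lp.ext (hq.trans hSw'.symm)
    have h14 : (0 : ℝ) ≤ 1 / 4 := by norm_num
    refine resolventPow_injective hζ h14 ?_
    refine ext_inner_left ℂ fun k => ?_
    have hin := fun x : L2 d => inner_resolventPow hζ h14 k x
    refine (hin _).trans (Eq.trans ?_ (hin _).symm)
    obtain ⟨v, hv⟩ := exists_fourierGradient_resolventPow_half hζ' k
    have hg : resolventPow (conj ζ) (1 / 4) (resolventPow (conj ζ) (1 / 4) k) =
        resolventPow (conj ζ) (1 / 2) k := resolventPow_quarter_quarter hζ' k
    refine (key h _ _ _ v w hh hg rfl hv hw).1 ?_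
    have hHp := hH (resolventPow (conj ζ) (1 / 4) k)
    rw [hg] at hHp
    rw [hweak _ v _ hv hHp, hqS]
  · rintro ⟨h, hh, heq⟩
    obtain ⟨h₀, hh₀⟩ := exists_resolventPow_eq (ζ := ζ) (η := 1) hζ (by simp) (α := 3 / 4)
      (by norm_num) h
    obtain ⟨w, hw, hSw⟩ := hS h
    rw [hh] at hw
    refine ⟨⟨h₀, hh₀.trans hh⟩, w, hw, S h, hSw, fun g v p hv hp => ?_⟩
    obtain ⟨k, hk⟩ := hv.exists_resolventPow_quarter hζ'
    exact (key h k g p v w hh hk (hpH k g p hk hp) hv hw).2 (by rw [heq])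

theorem norm_comp_le_of_norm_le_sqrt {A B : L2 d →L[ℂ] L2 d} {δ : ℝ} (hδ : 0 ≤ δ)
    (hA : ‖A‖ ≤ √δ) (hB : ‖B‖ ≤ √δ) : ‖A ∘L B‖ ≤ δ := by
  calc _ ≤ ‖A‖ * ‖B‖ := ContinuousLinearMap.opNorm_comp_le A B
    _ ≤ √δ * √δ := mul_le_mul hA hB (norm_nonneg B) (Real.sqrt_nonneg δ)
    _ = δ := Real.mul_self_sqrt hδ

/-! ### The operators `(ζ - Δ)^(-3/4) J (ζ - Δ)^(-1/4)` -/

section Factorization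

variable {ζ : ℂ} {J : L2 d →L[ℂ] L2 d}

theorem injective_resolventPow_comp (hζ : 0 < ζ.re) (hJ : Function.Injective J) :
    Function.Injective (resolventPow ζ (3 / 4) ∘L J ∘L resolventPow ζ (1 / 4)) := by
  have h14 : (0 : ℝ) ≤ 1 / 4 := by norm_num
  have h34 : (0 : ℝ) ≤ 3 / 4 := by norm_num
  exact (resolventPow_injective hζ h34).comp (hJ.comp (resolventPow_injective hζ h14))

theorem denseRange_resolventPow_comp (hζ : 0 < ζ.re) (hJ : Function.Surjective J) :
    DenseRange (resolventPow ζ (3 / 4) ∘L J ∘L resolventPow ζ (1 / 4)) := by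
  have h14 : (0 : ℝ) ≤ 1 / 4 := by norm_num
  have h34 : (0 : ℝ) ≤ 3 / 4 := by norm_num
  exact (denseRange_resolventPow hζ h34).comp
    (hJ.denseRange.comp (denseRange_resolventPow hζ h14) J.continuous)
    (ContinuousLinearMap.continuous _)

theorem norm_resolventPow_comp_le (hζ : 0 < ζ.re) {C : ℝ} (hC : 0 ≤ C) (hJ : ‖J‖ ≤ C) :
    ‖resolventPow ζ (3 / 4) ∘L J ∘L resolventPow ζ (1 / 4)‖ ≤ C * ‖ζ‖⁻¹ := by
  have h14 : ‖(resolventPow ζ (1 / 4) : L2 d →L[ℂ] L2 d)‖ ≤ ‖ζ‖ ^ (-(1 / 4) : ℝ) :=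
    norm_resolventPow_le hζ (by norm_num)
  have h34 : ‖(resolventPow ζ (3 / 4) : L2 d →L[ℂ] L2 d)‖ ≤ ‖ζ‖ ^ (-(3 / 4) : ℝ) :=
    norm_resolventPow_le hζ (by norm_num)
  have hζp : 0 < ‖ζ‖ := norm_pos_iff.2 (by rintro rfl; simp at hζ)
  have hpow : ‖ζ‖ ^ (-(3 / 4) : ℝ) * ‖ζ‖ ^ (-(1 / 4) : ℝ) = ‖ζ‖⁻¹ := by
    rw [← Real.rpow_add hζp, ← Real.rpow_neg_one]
    norm_num
  have h1 : ‖J ∘L (resolventPow ζ (1 / 4) : L2 d →L[ℂ] L2 d)‖ ≤ C * ‖ζ‖ ^ (-(1 / 4) : ℝ) :=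
    (ContinuousLinearMap.opNorm_comp_le J _).trans (mul_le_mul hJ h14 (norm_nonneg _) hC)
  refine (ContinuousLinearMap.opNorm_comp_le (resolventPow ζ (3 / 4) : L2 d →L[ℂ] L2 d) _).trans
    ((mul_le_mul h34 h1 (norm_nonneg _) (by positivity)).trans_eq ?_)
  rw [← hpow]
  ring

/-- The factorized resolvent as a perturbation of `(ζ - Δ)⁻¹`, by the identity
`(1 + AS)⁻¹ = 1 - A(1 + SA)⁻¹S`. -/
theorem resolventPow_comp_eq_sub (hζ : 0 < ζ.re) {A S : L2 d →L[ℂ] L2 d}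
    (h₁ : IsUnit (1 + A ∘L S)) (h₂ : IsUnit (1 + S ∘L A)) :
    resolventPow ζ (3 / 4) ∘L Ring.inverse (1 + A ∘L S) ∘L resolventPow ζ (1 / 4) =
      resolventPow ζ 1 - resolventPow ζ (3 / 4) ∘L A ∘L
        Ring.inverse (1 + S ∘L A) ∘L S ∘L resolventPow ζ (1 / 4) := by
  have h3 : Ring.inverse (1 + A ∘L S) = 1 - A ∘L (Ring.inverse (1 + S ∘L A) ∘L S) :=
    ring_inverse_one_add_mul h₁ h₂
  rw [h3]
  generalize Ring.inverse (1 + S ∘L A) = K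
  refine ContinuousLinearMap.ext fun f => ?_
  have h4 := resolventPow_three_quarters_quarter hζ f
  rw [sub_apply, ← h4]
  exact map_sub (resolventPow ζ (3 / 4)) (resolventPow ζ (1 / 4) f)
    (A (K (S (resolventPow ζ (1 / 4) f))))

theorem isWeakSolution_iff_resolvent {b : Rd d → Rd d} (hζ : 0 < ζ.re)
    {H S : L2 d →L[ℂ] L2 d} (hH : IsOperatorH b ζ H)
    (hS : ∀ f : L2 d, ∃ w : Fin d → L2 d, IsFourierGradient (resolventPow ζ (3 / 4) f) w ∧
      S f =ᵐ[volume] fun x => dotC (sqrtField b x) (vecField w x))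
    (hJ1 : ∀ f, J ((1 + H.adjoint ∘L S) f) = f) (hJ2 : ∀ f, (1 + H.adjoint ∘L S) (J f) = f)
    (u f : L2 d) :
    IsWeakSolution b u (f - ζ • u) ↔
      (resolventPow ζ (3 / 4) ∘L J ∘L resolventPow ζ (1 / 4)) f = u := by
  refine (isWeakSolution_iff hζ hH hS u f).trans ⟨?_, fun hu => ⟨_, hu, hJ2 _⟩⟩
  rintro ⟨h, hh, heq⟩
  have h1 : J (resolventPow ζ (1 / 4) f) = h := by rw [← heq, hJ1]
  change resolventPow ζ (3 / 4) (J (resolventPow ζ (1 / 4) f)) = u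
  rw [h1, hh]

end Factorization

/-- The operators `H`, `S` and `R = (ζ - Δ)^(-3/4) (1 + H*S)⁻¹ (ζ - Δ)^(-1/4)`, where `R` solves
the weak equation at `ζ`. -/
theorem exists_resolvent {b : Rd d → Rd d} {δ lam : ℝ} (hδ0 : 0 ≤ δ) (hδ1 : δ < 1)
    (hb : AEStronglyMeasurable b volume) (hlam : 0 < lam) (h : WeakFormBound b δ lam) {ζ : ℂ}
    (hζ : lam ≤ ζ.re) :
    ∃ R H S : L2 d →L[ℂ] L2 d,
      (∀ u f, IsWeakSolution b u (f - ζ • u) ↔ R f = u) ∧ Function.Injective R ∧ DenseRange R ∧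
      IsOperatorH b ζ H ∧ IsOperatorS b ζ S ∧
      ‖H.adjoint ∘L S‖ ≤ δ ∧
      IsUnit (1 + H.adjoint ∘L S) ∧
      R = resolventPow ζ (3 / 4) ∘L Ring.inverse (1 + H.adjoint ∘L S) ∘L
        resolventPow ζ (1 / 4) ∧
      IsUnit (1 + S ∘L H.adjoint) ∧
      R = resolventPow ζ 1 - resolventPow ζ (3 / 4) ∘L H.adjoint ∘L
        Ring.inverse (1 + S ∘L H.adjoint) ∘L S ∘L resolventPow ζ (1 / 4) ∧
      ‖R‖ ≤ (1 - δ)⁻¹ * ‖ζ‖⁻¹ :=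
  (exists_operatorH hb hlam h hζ).elim fun H hH => (exists_operatorS hb hlam h hζ).elim fun S hS =>
  have hζ0 : 0 < ζ.re := hlam.trans_le hζ
  have hHn : ‖H.adjoint‖ ≤ √δ := (LinearIsometryEquiv.norm_map _ _).trans_le hH.2
  have hHS : ‖H.adjoint ∘L S‖ ≤ δ := norm_comp_le_of_norm_le_sqrt hδ0 hHn hS.2
  have hSH : ‖S ∘L H.adjoint‖ ≤ δ := norm_comp_le_of_norm_le_sqrt hδ0 hS.2 hHn
  have hU1 : IsUnit (1 + H.adjoint ∘L S) := isUnit_one_add_of_norm_lt_one (hHS.trans_lt hδ1)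
  have hU2 : IsUnit (1 + S ∘L H.adjoint) := isUnit_one_add_of_norm_lt_one (hSH.trans_lt hδ1)
  have hJ1 : ∀ f, Ring.inverse (1 + H.adjoint ∘L S) ((1 + H.adjoint ∘L S) f) = f := fun f =>
    DFunLike.congr_fun (Ring.inverse_mul_cancel _ hU1) f
  have hJ2 : ∀ f, (1 + H.adjoint ∘L S) (Ring.inverse (1 + H.adjoint ∘L S) f) = f := fun f =>
    DFunLike.congr_fun (Ring.mul_inverse_cancel _ hU1) f
  have hSw : IsOperatorS b ζ S := fun f => (hS.1 f).elim fun w hw =>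
    ⟨vecField w, hw.1.isSobolevW12.hasWeakGradient, hw.2⟩
  ⟨_, H, S, isWeakSolution_iff_resolvent hζ0 hH.1 hS.1 hJ1 hJ2,
    injective_resolventPow_comp hζ0 (Function.LeftInverse.injective hJ2),
    denseRange_resolventPow_comp hζ0 (Function.RightInverse.surjective hJ1), hH.1, hSw,
    hHS, hU1, rfl, hU2, resolventPow_comp_eq_sub hζ0 hU1 hU2,
    norm_resolventPow_comp_le hζ0 (inv_nonneg.2 (sub_nonneg.2 hδ1.le))
      (norm_ring_inverse_one_add_le hHS hδ1)⟩

/-! ### The operator `Λ` -/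

/-- The operator whose graph is the weak equation. One resolvent at a real point shows that the
relation is the graph of an operator (as `R` is injective) and that the domain is dense (as it
contains the range of `R`). -/
theorem exists_linearPMap_isWeakSolution {b : Rd d → Rd d} {δ lam : ℝ} (hδ0 : 0 ≤ δ)
    (hδ1 : δ < 1) (hb : AEStronglyMeasurable b volume) (hlam : 0 < lam)
    (h : WeakFormBound b δ lam) :
    ∃ Λ : L2 d →ₗ.[ℂ] L2 d, (∀ u f, (u, f) ∈ Λ.graph ↔ IsWeakSolution b u f) ∧
      Dense (Λ.domain : Set (L2 d)) := by
  obtain ⟨R, -, -, hR, hinj, hdense, -⟩ := exists_resolvent hδ0 hδ1 hb hlam h (ζ := lam)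
    (by simp)
  let G : Submodule ℂ (L2 d × L2 d) :=
    { carrier := {x | R (x.2 + (lam : ℂ) • x.1) = x.1}
      add_mem' := by
        rintro ⟨u, f⟩ ⟨u', f'⟩ (h1 : R (f + (lam : ℂ) • u) = u)
          (h2 : R (f' + (lam : ℂ) • u') = u')
        change R (f + f' + (lam : ℂ) • (u + u')) = u + u'
        conv_rhs => rw [← h1, ← h2]
        rw [← map_add]
        congr 1
        rw [smul_add]; abel
      zero_mem' := by
        change R (0 + (lam : ℂ) • 0) = 0
        rw [smul_zero, add_zero, map_zero]
      smul_mem' := by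
        rintro c ⟨u, f⟩ (h1 : R (f + (lam : ℂ) • u) = u)
        change R (c • f + (lam : ℂ) • (c • u)) = c • u
        rw [smul_comm, ← smul_add, map_smul, h1] }
  have hG : ∀ u f, (u, f) ∈ G ↔ R (f + (lam : ℂ) • u) = u := fun u f => Iff.rfl
  have hgraph : G.toLinearPMap.graph = G := by
    refine Submodule.toLinearPMap_graph_eq G ?_
    rintro ⟨u, f⟩ hx (rfl : u = 0)
    rw [hG, smul_zero, add_zero] at hx
    exact hinj (hx.trans (map_zero R).symm)
  have hΛ : ∀ u f, (u, f) ∈ G.toLinearPMap.graph ↔ IsWeakSolution b u f := by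
    intro u f
    rw [hgraph, hG, ← hR, add_sub_cancel_right]
  refine ⟨G.toLinearPMap, hΛ, ?_⟩
  refine hdense.mono ?_
  rintro _ ⟨f, rfl⟩
  have h1 : (R f, f - (lam : ℂ) • R f) ∈ G.toLinearPMap.graph := by
    rw [hgraph, hG, sub_add_cancel]
  exact LinearPMap.mem_domain_of_mem_graph h1

theorem isResolventAt_neg {Λ : L2 d →ₗ.[ℂ] L2 d} {b : Rd d → Rd d}
    (hΛ : ∀ u f, (u, f) ∈ Λ.graph ↔ IsWeakSolution b u f) {ζ : ℂ} {R : L2 d →L[ℂ] L2 d}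
    (hR : ∀ u f, IsWeakSolution b u (f - ζ • u) ↔ R f = u) : IsResolventAt (-Λ) ζ R := by
  constructor
  · intro f
    have h1 : ((f : L2 d), Λ f) ∈ Λ.graph := Λ.mem_graph f
    have h2 := (hΛ _ _).1 h1
    change R (ζ • (f : L2 d) - -(Λ f)) = f
    rw [← hR, sub_neg_eq_add, add_sub_cancel_left]
    exact h2
  · intro g
    have h1 := (hΛ _ _).2 ((hR (R g) g).2 rfl)
    obtain ⟨y, hy1, hy2⟩ := (LinearPMap.mem_graph_iff Λ).1 h1
    refine ⟨y, hy1, ?_⟩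
    change ζ • (y : L2 d) - -(Λ y) = g
    simp only at hy1 hy2
    rw [hy2, hy1]
    abel

/-! ### Test functions -/

/-- The classical partial derivative `∂_j φ`. -/
def partialDeriv (j : Fin d) (φ : Rd d → ℂ) (x : Rd d) : ℂ :=
  fderiv ℝ φ x (EuclideanSpace.single j 1)

theorem IsTestFunction.differentiable {φ : Rd d → ℂ} (h : IsTestFunction φ) :
    Differentiable ℝ φ := h.1.differentiable (by simp)

theorem IsTestFunction.continuous {φ : Rd d → ℂ} (h : IsTestFunction φ) : Continuous φ :=
  h.1.continuous

theorem contDiff_partialDeriv {φ : Rd d → ℂ} (h : ContDiff ℝ ∞ φ) (j : Fin d) :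
    ContDiff ℝ ∞ (partialDeriv j φ) :=
  (h.fderiv_right (m := ∞) (by simp)).clm_apply contDiff_const

theorem IsTestFunction.partialDeriv {φ : Rd d → ℂ} (h : IsTestFunction φ) (j : Fin d) :
    IsTestFunction (partialDeriv j φ) :=
  ⟨contDiff_partialDeriv h.1 j,
    (h.2.fderiv ℝ).comp_left (g := fun L : Rd d →L[ℝ] ℂ => L (EuclideanSpace.single j 1)) rfl⟩

theorem IsTestFunction.conj {φ : Rd d → ℂ} (h : IsTestFunction φ) :
    IsTestFunction fun x => conj (φ x) :=
  ⟨Complex.conjCLE.contDiff.comp h.1, h.2.comp_left (g := fun z : ℂ => conj z) (map_zero _)⟩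

theorem IsTestFunction.mul_contDiff {φ ψ : Rd d → ℂ} (h : IsTestFunction φ)
    (hψ : ContDiff ℝ ∞ ψ) : IsTestFunction fun x => φ x * ψ x :=
  ⟨h.1.mul hψ, h.2.mul_right⟩

theorem partialDeriv_conj {φ : Rd d → ℂ} (h : Differentiable ℝ φ) (j : Fin d) (x : Rd d) :
    partialDeriv j (fun x => conj (φ x)) x = conj (partialDeriv j φ x) := by
  have h1 : HasFDerivAt (fun x => conj (φ x))
      ((Complex.conjCLE : ℂ →L[ℝ] ℂ).comp (fderiv ℝ φ x)) x :=
    (Complex.conjCLE : ℂ →L[ℝ] ℂ).hasFDerivAt.comp x (h x).hasFDerivAt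
  rw [partialDeriv, h1.fderiv]
  rfl

theorem partialDeriv_mul {φ ψ : Rd d → ℂ} (h : Differentiable ℝ φ) (hψ : Differentiable ℝ ψ)
    (j : Fin d) (x : Rd d) :
    partialDeriv j (fun x => φ x * ψ x) x =
      φ x * partialDeriv j ψ x + partialDeriv j φ x * ψ x := by
  have h1 := ((h x).hasFDerivAt.mul (hψ x).hasFDerivAt).fderiv
  have h2 : fderiv ℝ (fun x => φ x * ψ x) x = _ := h1
  rw [partialDeriv, h2]
  simp only [add_apply, smul_apply, smul_eq_mul, partialDeriv]
  ring

theorem partialDeriv_schwartz (ψ : 𝓢(Rd d, ℂ)) (j : Fin d) :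
    partialDeriv j ψ = ⇑(∂_{EuclideanSpace.single j (1 : ℝ)} ψ : 𝓢(Rd d, ℂ)) :=
  funext fun x => (SchwartzMap.lineDerivOp_apply_eq_fderiv _ ψ x).symm

theorem laplacian_schwartz_apply (ψ : 𝓢(Rd d, ℂ)) (x : Rd d) :
    (Laplacian.laplacian ψ : 𝓢(Rd d, ℂ)) x = ∑ j, partialDeriv j (partialDeriv j ψ) x := by
  rw [SchwartzMap.laplacian_eq_sum (EuclideanSpace.basisFun (Fin d) ℝ), sum_apply]
  refine Finset.sum_congr rfl fun j _ => ?_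
  rw [EuclideanSpace.basisFun_apply, partialDeriv_schwartz, partialDeriv_schwartz]

theorem IsTestFunction.laplacian_apply {φ : Rd d → ℂ} (h : IsTestFunction φ) (x : Rd d) :
    Laplacian.laplacian φ x = ∑ j, WeaklyFormBounded.partialDeriv j
      (WeaklyFormBounded.partialDeriv j φ) x := by
  have h1 := laplacian_schwartz_apply (h.2.toSchwartzMap h.1) x
  rw [SchwartzMap.laplacian_apply] at h1
  exact h1

theorem IsTestFunction.memLp {φ : Rd d → ℂ} (h : IsTestFunction φ) : MemLp φ 2 volume :=
  h.continuous.memLp_of_hasCompactSupport h.2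

theorem IsTestFunction.isSobolevW12 {φ : Rd d → ℂ} (h : IsTestFunction φ) :
    IsSobolevW12 φ fun x => WithLp.toLp 2 fun j => WeaklyFormBounded.partialDeriv j φ x := by
  have h2 : MemLp (fun x => WithLp.toLp 2 fun j => WeaklyFormBounded.partialDeriv j φ x :
      Rd d → EuclideanSpace ℂ (Fin d)) 2 volume :=
    memLp_piLp_iff.2 fun j => (h.partialDeriv j).memLp
  refine ⟨h.memLp, h2, h.memLp.locallyIntegrable one_le_two, h2.locallyIntegrable one_le_two, ?_⟩
  intro χ hχ j
  have hint : ∀ {α β : Rd d → ℂ}, IsTestFunction α → IsTestFunction β →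
      Integrable fun x => α x * β x := fun hα hβ => integrable_mul_of_memLp_two hα.memLp hβ.memLp
  exact integral_mul_fderiv_eq_neg_fderiv_mul_of_integrable (hint (h.partialDeriv j) hχ)
    (hint h (hχ.partialDeriv j)) (hint h hχ)
    (fun x _ => h.differentiable x) fun x _ => hχ.differentiable x

theorem IsTestFunction.integrable_mul {φ u : Rd d → ℂ} (h : IsTestFunction φ)
    (hu : LocallyIntegrable u volume) : Integrable fun x => u x * φ x :=
  hu.integrable_smul_right_of_hasCompactSupport h.continuous h.2

theorem HasWeakGradient.locallyIntegrable_apply {u : Rd d → ℂ}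
    {w : Rd d → EuclideanSpace ℂ (Fin d)} (h : HasWeakGradient u w) (j : Fin d) :
    LocallyIntegrable (fun x => w x j) volume := by
  rw [locallyIntegrable_iff]
  intro K hK
  exact (EuclideanSpace.proj (𝕜 := ℂ) j : EuclideanSpace ℂ (Fin d) →L[ℂ] ℂ).integrable_comp
    (h.locallyIntegrable_grad.integrableOn_isCompact hK)

/-! ### Local Bessel potential regularity -/

/-- `(1 - (2π)⁻² Δ) v = F` with `v, F ∈ L¹` puts `v` into the Bessel potential space of
order `2`. The equation is tested with Schwartz functions. -/
theorem memSobolev_two_one_of_laplacian {v F : Lp ℂ 1 (volume : Measure (Rd d))}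
    (h : ∀ ψ : 𝓢(Rd d, ℂ), ∫ x, (Laplacian.laplacian ψ : 𝓢(Rd d, ℂ)) x * v x =
      ∫ x, ψ x * ((2 * Real.pi : ℂ) ^ 2 * (v x - F x))) :
    TemperedDistribution.MemSobolev 2 1 (Lp.toTemperedDistribution v) := by
  refine ⟨F, ?_⟩
  have hsym : (fun x : Rd d => (((1 + ‖x‖ ^ 2) ^ ((2 : ℝ) / 2) : ℝ) : ℂ)) =
      (fun _ => (1 : ℂ)) + fun x => Complex.ofReal (‖x‖ ^ 2) := by
    funext x
    norm_num
  have hadd : TemperedDistribution.fourierMultiplierCLM ℂ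
      ((fun _ => (1 : ℂ)) + fun x : Rd d => Complex.ofReal (‖x‖ ^ 2)) =
      TemperedDistribution.fourierMultiplierCLM ℂ (fun _ => (1 : ℂ)) +
        TemperedDistribution.fourierMultiplierCLM ℂ
          (fun x : Rd d => Complex.ofReal (‖x‖ ^ 2)) := by
    have := TemperedDistribution.fourierMultiplierCLM_sum ℂ (E := Rd d)
      (g := ![fun _ => (1 : ℂ), fun x => Complex.ofReal (‖x‖ ^ 2)]) (s := Finset.univ) (by
        intro i _
        fin_cases i
        · exact Function.HasTemperateGrowth.const _
        · change (fun x : Rd d => Complex.ofReal (‖x‖ ^ 2)).HasTemperateGrowth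
          fun_prop)
    simpa [Fin.sum_univ_two, Pi.add_def] using this
  rw [TemperedDistribution.besselPotential, hsym, hadd,
    TemperedDistribution.fourierMultiplierCLM_const, one_smul]
  have hlap := TemperedDistribution.laplacian_eq_fourierMultiplierCLM
    (Lp.toTemperedDistribution v : 𝓢'(Rd d, ℂ))
  ext ψ
  have h1 := congrArg (fun T : 𝓢'(Rd d, ℂ) => T ψ) hlap
  have hint : ∀ f : Lp ℂ 1 (volume : Measure (Rd d)), Integrable fun x => ψ x * f x := fun f =>
    (ψ.memLp ∞ volume).integrable_mul (Lp.memLp f)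
  have h2 : ∫ x, ψ x * ((2 * Real.pi : ℂ) ^ 2 * (v x - F x)) =
      (2 * Real.pi : ℂ) ^ 2 * ((∫ x, ψ x * v x) - ∫ x, ψ x * F x) := by
    rw [← integral_sub (hint v) (hint F), ← integral_const_mul]
    refine integral_congr_ae (Eventually.of_forall fun x => ?_)
    change ψ x * ((2 * Real.pi : ℂ) ^ 2 * (v x - F x)) =
      (2 * Real.pi : ℂ) ^ 2 * (ψ x * v x - ψ x * F x)
    ring
  have h3 := h ψ
  rw [h2] at h3
  have hπ : (2 * Real.pi : ℂ) ^ 2 ≠ 0 := by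
    have : (Real.pi : ℂ) ≠ 0 := by exact_mod_cast Real.pi_ne_zero
    exact pow_ne_zero _ (mul_ne_zero two_ne_zero this)
  change _ = (-(2 * Real.pi) ^ 2 : ℝ) • (TemperedDistribution.fourierMultiplierCLM ℂ
    (fun x : Rd d => Complex.ofReal (‖x‖ ^ 2)) (Lp.toTemperedDistribution v)) ψ at h1
  rw [TemperedDistribution.laplacian_apply_apply, Lp.toTemperedDistribution_apply] at h1
  simp only [smul_eq_mul] at h1
  rw [h3] at h1
  change (Lp.toTemperedDistribution v : 𝓢'(Rd d, ℂ)) ψ +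
    (TemperedDistribution.fourierMultiplierCLM ℂ
    (fun x : Rd d => Complex.ofReal (‖x‖ ^ 2)) (Lp.toTemperedDistribution v)) ψ = _
  rw [Lp.toTemperedDistribution_apply, Lp.toTemperedDistribution_apply]
  simp only [smul_eq_mul]
  rw [Complex.real_smul] at h1
  generalize (TemperedDistribution.fourierMultiplierCLM ℂ
    (fun x : Rd d => Complex.ofReal (‖x‖ ^ 2)) (Lp.toTemperedDistribution v)) ψ = T at h1 ⊢
  push_cast at h1
  refine mul_left_cancel₀ hπ ?_
  linear_combination h1

/-- If `-Δu = G` weakly with `G` locally integrable, then `u` has two derivatives in `L¹_loc` in the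
sense of Bessel potentials: `Δ(φu) = -φG + 2∇φ · ∇u + uΔφ` is integrable. -/
theorem memBesselPotentialLoc_of_weak {u G : Rd d → ℂ} {w : Rd d → EuclideanSpace ℂ (Fin d)}
    (h : HasWeakGradient u w) (hG : LocallyIntegrable G volume)
    (hweak : ∀ χ, IsTestFunction χ →
      ∑ j, ∫ x, w x j * partialDeriv j χ x = ∫ x, G x * χ x) :
    MemBesselPotentialLoc 2 1 u := by
  intro φ hφ
  have hv : Integrable (fun x => φ x * u x) volume := by
    simpa only [mul_comm] using hφ.integrable_mul h.locallyIntegrable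
  set Lφ : Rd d → ℂ := fun x => ∑ j, (2 * (w x j * partialDeriv j φ x) +
    u x * partialDeriv j (partialDeriv j φ) x) - G x * φ x with hL
  have hwφ : ∀ j, Integrable fun x => w x j * partialDeriv j φ x := fun j =>
    (hφ.partialDeriv j).integrable_mul (h.locallyIntegrable_apply j)
  have huφ : ∀ j, Integrable fun x => u x * partialDeriv j (partialDeriv j φ) x := fun j =>
    ((hφ.partialDeriv j).partialDeriv j).integrable_mul h.locallyIntegrable
  have hLint : Integrable Lφ volume :=
    (integrable_finsetSum _ fun j _ => ((hwφ j).const_mul 2).add (huφ j)).sub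
      (hφ.integrable_mul hG)
  have hF : Integrable (fun x => φ x * u x - ((2 * Real.pi : ℂ) ^ 2)⁻¹ * Lφ x) volume :=
    hv.sub (hLint.const_mul _)
  refine ⟨(memLp_one_iff_integrable.2 hv).toLp, MemLp.coeFn_toLp _, ?_⟩
  refine memSobolev_two_one_of_laplacian (F := (memLp_one_iff_integrable.2 hF).toLp) fun ψ => ?_
  have hψ : ContDiff ℝ ∞ ψ := ψ.smooth _
  have hψd : Differentiable ℝ ψ := ψ.differentiable
  have hψ' : ∀ j, ContDiff ℝ ∞ (partialDeriv j ψ) := fun j => contDiff_partialDeriv hψ j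
  have hr : ∫ x, ψ x * ((2 * Real.pi : ℂ) ^ 2 *
      (((memLp_one_iff_integrable.2 hv).toLp : Lp ℂ 1 (volume : Measure (Rd d))) x -
        ((memLp_one_iff_integrable.2 hF).toLp : Lp ℂ 1 (volume : Measure (Rd d))) x)) =
      ∫ x, Lφ x * ψ x := by
    refine integral_congr_ae ?_
    filter_upwards [(memLp_one_iff_integrable.2 hv).coeFn_toLp,
      (memLp_one_iff_integrable.2 hF).coeFn_toLp] with x h1 h2
    rw [h1, h2]
    have : (Real.pi : ℂ) ≠ 0 := by exact_mod_cast Real.pi_ne_zero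
    field_simp
    ring
  have hl : ∫ x, (Laplacian.laplacian ψ : 𝓢(Rd d, ℂ)) x *
      ((memLp_one_iff_integrable.2 hv).toLp : Lp ℂ 1 (volume : Measure (Rd d))) x =
      ∫ x, ∑ j, u x * (φ x * partialDeriv j (partialDeriv j ψ) x) := by
    refine integral_congr_ae ?_
    filter_upwards [(memLp_one_iff_integrable.2 hv).coeFn_toLp] with x h1
    rw [h1, laplacian_schwartz_apply, Finset.sum_mul]
    exact Finset.sum_congr rfl fun j _ => by ring
  -- every integrand below contains `φ` or one of its derivatives as a factor, hence is integrable
  have hu : ∀ {α β : Rd d → ℂ}, IsTestFunction α → ContDiff ℝ ∞ β →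
      Integrable fun x => u x * (α x * β x) := fun hα hβ =>
    (hα.mul_contDiff hβ).integrable_mul h.locallyIntegrable
  have hw : ∀ (j : Fin d) {α β : Rd d → ℂ}, IsTestFunction α → ContDiff ℝ ∞ β →
      Integrable fun x => w x j * (α x * β x) := fun j _ _ hα hβ =>
    (hα.mul_contDiff hβ).integrable_mul (h.locallyIntegrable_apply j)
  -- Leibniz rule for the weak derivative
  have hparts : ∀ (j : Fin d) {α β : Rd d → ℂ}, IsTestFunction α → ContDiff ℝ ∞ β →
      ∫ x, u x * (α x * partialDeriv j β x) =
        - (∫ x, w x j * (α x * β x)) - ∫ x, u x * (partialDeriv j α x * β x) := by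
    intro j α β hα hβ
    have h1 := h.integral_eq _ (hα.mul_contDiff hβ) j
    have h2 : ∫ x, u x * fderiv ℝ (fun x => α x * β x) x (EuclideanSpace.single j 1) =
        (∫ x, u x * (α x * partialDeriv j β x)) + ∫ x, u x * (partialDeriv j α x * β x) := by
      rw [← integral_add (hu hα (contDiff_partialDeriv hβ j)) (hu (hα.partialDeriv j) hβ)]
      refine integral_congr_ae (Eventually.of_forall fun x => ?_)
      change u x * partialDeriv j (fun x => α x * β x) x = _
      rw [partialDeriv_mul hα.differentiable (hβ.differentiable (by simp))]
      ring
    rw [← h1, h2]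
    ring
  have hterm : ∀ j, ∫ x, u x * (φ x * partialDeriv j (partialDeriv j ψ) x) =
      (∫ x, (2 * (w x j * partialDeriv j φ x) +
        u x * partialDeriv j (partialDeriv j φ) x) * ψ x) -
        ∫ x, w x j * partialDeriv j (fun x => φ x * ψ x) x := by
    intro j
    rw [hparts j hφ (hψ' j), hparts j (hφ.partialDeriv j) hψ]
    have h1 : ∫ x, w x j * partialDeriv j (fun x => φ x * ψ x) x =
        (∫ x, w x j * (φ x * partialDeriv j ψ x)) +
          ∫ x, w x j * (partialDeriv j φ x * ψ x) := by
      rw [← integral_add (hw j hφ (hψ' j)) (hw j (hφ.partialDeriv j) hψ)]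
      refine integral_congr_ae (Eventually.of_forall fun x => ?_)
      change w x j * partialDeriv j (fun x => φ x * ψ x) x = _
      rw [partialDeriv_mul hφ.differentiable hψd]
      ring
    have h2 : ∫ x, (2 * (w x j * partialDeriv j φ x) +
        u x * partialDeriv j (partialDeriv j φ) x) * ψ x =
        2 * (∫ x, w x j * (partialDeriv j φ x * ψ x)) +
          ∫ x, u x * (partialDeriv j (partialDeriv j φ) x * ψ x) := by
      rw [← integral_const_mul, ← integral_add ((hw j (hφ.partialDeriv j) hψ).const_mul 2)
        (hu ((hφ.partialDeriv j).partialDeriv j) hψ)]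
      refine integral_congr_ae (Eventually.of_forall fun x => ?_)
      change (2 * (w x j * partialDeriv j φ x) +
        u x * partialDeriv j (partialDeriv j φ) x) * ψ x = _
      ring
    rw [h1, h2]
    ring
  have hint : ∀ j, Integrable fun x => (2 * (w x j * partialDeriv j φ x) +
      u x * partialDeriv j (partialDeriv j φ) x) * ψ x := by
    intro j
    refine (((hw j (hφ.partialDeriv j) hψ).const_mul 2).add
      (hu ((hφ.partialDeriv j).partialDeriv j) hψ)).congr (Eventually.of_forall fun x => ?_)
    change 2 * (w x j * (partialDeriv j φ x * ψ x)) +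
      u x * (partialDeriv j (partialDeriv j φ) x * ψ x) = _
    ring
  have hG' : Integrable fun x => G x * (φ x * ψ x) := (hφ.mul_contDiff hψ).integrable_mul hG
  have hLψ : ∫ x, Lφ x * ψ x = (∑ j, ∫ x, (2 * (w x j * partialDeriv j φ x) +
      u x * partialDeriv j (partialDeriv j φ) x) * ψ x) - ∫ x, G x * (φ x * ψ x) := by
    rw [← integral_finsetSum _ fun j _ => hint j,
      ← integral_sub (integrable_finsetSum _ fun j _ => hint j) hG']
    refine integral_congr_ae (Eventually.of_forall fun x => ?_)
    simp only [hL]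
    rw [sub_mul, Finset.sum_mul, mul_assoc]
  rw [hr, hl, integral_finsetSum _ fun j _ => hu hφ (contDiff_partialDeriv (hψ' j) j), hLψ,
    ← hweak _ (hφ.mul_contDiff hψ), ← Finset.sum_sub_distrib]
  exact Finset.sum_congr rfl fun j _ => hterm j

/-! ### Properties of the domain of `Λ` -/

theorem dotC_eq_dotC_sqrtField_mul (b : Rd d → Rd d) (x : Rd d) (w : EuclideanSpace ℂ (Fin d)) :
    dotC (b x) w = ((√‖b x‖ : ℝ) : ℂ) * dotC (sqrtField b x) w := by
  rw [dotC, dotC, Finset.mul_sum]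
  refine Finset.sum_congr rfl fun j _ => ?_
  rw [← mul_assoc, ← Complex.ofReal_mul, sqrtField, PiLp.smul_apply, smul_eq_mul, ← mul_assoc]
  rcases eq_or_ne (b x) 0 with h | h
  · simp [h]
  · rw [mul_inv_cancel₀ (Real.sqrt_ne_zero'.2 (norm_pos_iff.2 h)), one_mul]

theorem aestronglyMeasurable_sqrt_norm {b : Rd d → Rd d} (hb : AEStronglyMeasurable b volume) :
    AEStronglyMeasurable (fun x => ((√‖b x‖ : ℝ) : ℂ)) volume :=
  (Complex.continuous_ofReal.comp Real.continuous_sqrt).comp_aestronglyMeasurable hb.norm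

/-- `|b|^{1/2}` is locally square integrable, so its product with an `L²` function is locally
integrable. -/
theorem locallyIntegrable_sqrt_norm_mul {b : Rd d → Rd d} (hb : LocallyIntegrable b volume)
    {q : Rd d → ℂ} (hq : MemLp q 2 volume) :
    LocallyIntegrable (fun x => ((√‖b x‖ : ℝ) : ℂ) * q x) volume := by
  rw [locallyIntegrable_iff]
  intro K hK
  have h1 : MemLp (fun x => ((√‖b x‖ : ℝ) : ℂ)) 2 (volume.restrict K) := by
    refine (memLp_two_iff_integrable_sq_norm
      (aestronglyMeasurable_sqrt_norm hb.aestronglyMeasurable).restrict).2 ?_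
    refine (hb.integrableOn_isCompact hK).norm.congr (Eventually.of_forall fun x => ?_)
    change ‖b x‖ = ‖((√‖b x‖ : ℝ) : ℂ)‖ ^ 2
    rw [Complex.norm_real, Real.norm_of_nonneg (Real.sqrt_nonneg _),
      Real.sq_sqrt (norm_nonneg _)]
  exact h1.integrable_mul (hq.restrict K)

/-- Multiplication by `|b|^{1/2}` maps `W^{1,2}` into `L²`, as `W^{1,2}` is contained in the range
of `(lam - Δ)^(-1/4)`. -/
theorem IsFourierGradient.exists_sqrt_norm_mul {b : Rd d → Rd d} {δ lam : ℝ}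
    (hb : AEStronglyMeasurable b volume) (hlam : 0 < lam) (h : WeakFormBound b δ lam)
    {g : L2 d} {v : Fin d → L2 d} (hg : IsFourierGradient g v) :
    ∃ p : L2 d, p =ᵐ[volume] fun x => ((√‖b x‖ : ℝ) : ℂ) * g x := by
  obtain ⟨K, hK, -⟩ := h.exists_operator hb
  obtain ⟨k, rfl⟩ := hg.exists_resolventPow_quarter (ζ := lam) (by simpa using hlam)
  exact ⟨K k, hK k⟩

/-- The form identity in terms of functions instead of elements of `L²`. -/
theorem IsWeakSolution.exists_isSobolevW12 {b : Rd d → Rd d} {δ lam : ℝ}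
    (hb : AEStronglyMeasurable b volume) (hlam : 0 < lam) (h : WeakFormBound b δ lam)
    {u f : L2 d} (hu : IsWeakSolution b u f) :
    ∃ w : Rd d → EuclideanSpace ℂ (Fin d), IsSobolevW12 u w ∧
      MemLp (fun x => dotC (sqrtField b x) (w x)) 2 volume ∧
      ∀ (g : Rd d → ℂ) (v : Rd d → EuclideanSpace ℂ (Fin d)), IsSobolevW12 g v →
        MemLp (fun x => ((√‖b x‖ : ℝ) : ℂ) * g x) 2 volume ∧
        ∫ x, f x * conj (g x) = (∫ x, ∑ j, w x j * conj (v x j)) +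
          ∫ x, dotC (sqrtField b x) (w x) * conj (((√‖b x‖ : ℝ) : ℂ) * g x) := by
  obtain ⟨-, w, hw, q, hq, hweak⟩ := hu
  refine ⟨vecField w, hw.isSobolevW12, (Lp.memLp q).ae_eq hq, fun g v hg => ?_⟩
  have hgrad := hg.isFourierGradient
  obtain ⟨p, hp⟩ := hgrad.exists_sqrt_norm_mul hb hlam h
  have hp' : p =ᵐ[volume] fun x => ((√‖b x‖ : ℝ) : ℂ) * g x := by
    filter_upwards [hp, hg.memLp.coeFn_toLp] with x h1 h2
    rw [h1, h2]
  refine ⟨(Lp.memLp p).ae_eq hp', ?_⟩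
  have key := hweak _ _ p hgrad hp
  simp only [L2_inner_eq_integral] at key
  rw [← integral_finsetSum _ fun j _ => L2_integrable_mul_conj _ _] at key
  convert key using 1
  · refine integral_congr_ae ?_
    filter_upwards [hg.memLp.coeFn_toLp] with x h1
    rw [h1]
  · congr 1
    · refine integral_congr_ae ?_
      filter_upwards [eventually_all.2 fun j => (memLp_component hg.memLp_grad j).coeFn_toLp]
        with x h1
      exact Finset.sum_congr rfl fun j _ => by rw [h1 j]; rfl
    · refine integral_congr_ae ?_
      filter_upwards [hp', hq] with x h1 h2
      rw [h1, h2]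

/-- The form identity tested with test functions: `-Δu = f - b · ∇u` weakly. -/
theorem sum_integral_gradient_eq {b : Rd d → Rd d} (hb : LocallyIntegrable b volume) {f : L2 d}
    {u : Rd d → ℂ} {w : Rd d → EuclideanSpace ℂ (Fin d)} (hw : IsSobolevW12 u w)
    (hq : MemLp (fun x => dotC (sqrtField b x) (w x)) 2 volume)
    (hform : ∀ (g : Rd d → ℂ) (v : Rd d → EuclideanSpace ℂ (Fin d)), IsSobolevW12 g v →
        MemLp (fun x => ((√‖b x‖ : ℝ) : ℂ) * g x) 2 volume ∧
        ∫ x, f x * conj (g x) = (∫ x, ∑ j, w x j * conj (v x j)) +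
          ∫ x, dotC (sqrtField b x) (w x) * conj (((√‖b x‖ : ℝ) : ℂ) * g x)) :
    LocallyIntegrable (fun x => dotC (b x) (w x)) volume ∧
      ∀ χ : Rd d → ℂ, IsTestFunction χ →
        ∑ j, ∫ x, w x j * partialDeriv j χ x = ∫ x, (f x - dotC (b x) (w x)) * χ x := by
  have hloc : LocallyIntegrable (fun x => dotC (b x) (w x)) volume := by
    simpa only [dotC_eq_dotC_sqrtField_mul b] using locallyIntegrable_sqrt_norm_mul hb hq
  refine ⟨hloc, fun χ hχ => ?_⟩
  have hf : LocallyIntegrable f volume := (Lp.memLp f).locallyIntegrable one_le_two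
  have h1 := (hform _ _ hχ.conj.isSobolevW12).2
  simp only [partialDeriv_conj hχ.differentiable, Complex.conj_conj, map_mul,
    Complex.conj_ofReal] at h1
  have h2 : ∫ x, dotC (sqrtField b x) (w x) * (((√‖b x‖ : ℝ) : ℂ) * χ x) =
      ∫ x, dotC (b x) (w x) * χ x := by
    refine integral_congr_ae (Eventually.of_forall fun x => ?_)
    change dotC (sqrtField b x) (w x) * (((√‖b x‖ : ℝ) : ℂ) * χ x) = dotC (b x) (w x) * χ x
    rw [dotC_eq_dotC_sqrtField_mul b]
    ring
  rw [h2, integral_finsetSum _ fun j _ => (hχ.partialDeriv j).integrable_mul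
    (hw.hasWeakGradient.locallyIntegrable_apply j)] at h1
  simp only [sub_mul]
  rw [integral_sub (hχ.integrable_mul hf) (hχ.integrable_mul hloc), h1, add_sub_cancel_right]

/-- Integration by parts turns the weak equation into the distributional one. -/
theorem integral_mul_conj_eq_of_weak {u f B : Rd d → ℂ} {w : Rd d → EuclideanSpace ℂ (Fin d)}
    (h : HasWeakGradient u w) (hf : LocallyIntegrable f volume) (hB : LocallyIntegrable B volume)
    (hweak : ∀ χ : Rd d → ℂ, IsTestFunction χ →
      ∑ j, ∫ x, w x j * partialDeriv j χ x = ∫ x, (f x - B x) * χ x)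
    {φ : Rd d → ℂ} (hφ : IsTestFunction φ) :
    ∫ x, f x * conj (φ x) =
      (∫ x, u x * conj (-(Laplacian.laplacian φ x))) + ∫ x, B x * conj (φ x) := by
  have h1 := hweak _ hφ.conj
  simp only [sub_mul] at h1
  rw [integral_sub (hφ.conj.integrable_mul hf) (hφ.conj.integrable_mul hB)] at h1
  have h2 : ∫ x, u x * conj (-(Laplacian.laplacian φ x)) =
      ∑ j, ∫ x, w x j * partialDeriv j (fun x => conj (φ x)) x := by
    have h3 : ∀ j, ∫ x, w x j * partialDeriv j (fun x => conj (φ x)) x =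
        ∫ x, u x * (-conj (partialDeriv j (partialDeriv j φ) x)) := by
      intro j
      have h4 := h.integral_eq _ (hφ.partialDeriv j).conj j
      have h5 : ∀ x, fderiv ℝ (fun x => conj (partialDeriv j φ x)) x
          (EuclideanSpace.single j 1) = conj (partialDeriv j (partialDeriv j φ) x) :=
        partialDeriv_conj (hφ.partialDeriv j).differentiable j
      simp only [h5] at h4
      simp only [mul_neg, integral_neg, h4, neg_neg, partialDeriv_conj hφ.differentiable]
    have h6 : ∀ j, Integrable fun x => u x * (-conj (partialDeriv j (partialDeriv j φ) x)) := by
      intro j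
      simp only [mul_neg]
      exact (((hφ.partialDeriv j).partialDeriv j).conj.integrable_mul h.locallyIntegrable).neg
    simp only [h3]
    rw [← integral_finsetSum _ fun j _ => h6 j]
    refine integral_congr_ae (Eventually.of_forall fun x => ?_)
    simp only [hφ.laplacian_apply, map_neg, map_sum, mul_neg, Finset.mul_sum,
      Finset.sum_neg_distrib]
  rw [h2, h1, sub_add_cancel]

theorem generates_neg_of_isWeakSolution {b : Rd d → Rd d} {δ lam : ℝ} (hδ0 : 0 ≤ δ)
    (hδ1 : δ < 1) (hb : AEStronglyMeasurable b volume) (hlam : 0 < lam)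
    (h : WeakFormBound b δ lam) {Λ : L2 d →ₗ.[ℂ] L2 d}
    (hΛ : ∀ u f, (u, f) ∈ Λ.graph ↔ IsWeakSolution b u f)
    (hdense : Dense (Λ.domain : Set (L2 d))) :
    GeneratesQuasiBoundedHolomorphicSemigroup (-Λ) := by
  refine generatesQuasiBoundedHolomorphicSemigroup_of_resolvent_le (A := -Λ) (lam := lam)
    (M := (1 - δ)⁻¹) hdense hlam (inv_nonneg.2 (sub_nonneg.2 hδ1.le)) fun ζ hζ => ?_
  obtain ⟨R, -, -, hR, -, -, -, -, -, -, -, -, -, hn⟩ := exists_resolvent hδ0 hδ1 hb hlam h hζ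
  exact ⟨R, isResolventAt_neg hΛ hR, hn.trans_eq (div_eq_mul_inv _ _).symm⟩

theorem exists_resolventAt_neg {b : Rd d → Rd d} {δ lam : ℝ} (hδ0 : 0 ≤ δ) (hδ1 : δ < 1)
    (hb : AEStronglyMeasurable b volume) (hlam : 0 < lam) (h : WeakFormBound b δ lam)
    {Λ : L2 d →ₗ.[ℂ] L2 d} (hΛ : ∀ u f, (u, f) ∈ Λ.graph ↔ IsWeakSolution b u f) {ζ : ℂ}
    (hζ : lam ≤ ζ.re) :
    ∃ R H S : L2 d →L[ℂ] L2 d,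
      IsResolventAt (-Λ) ζ R ∧ IsOperatorH b ζ H ∧ IsOperatorS b ζ S ∧
      ‖H.adjoint ∘L S‖ ≤ δ ∧
      IsUnit (1 + H.adjoint ∘L S) ∧
      R = resolventPow ζ (3 / 4) ∘L Ring.inverse (1 + H.adjoint ∘L S) ∘L
        resolventPow ζ (1 / 4) ∧
      IsUnit (1 + S ∘L H.adjoint) ∧
      R = resolventPow ζ 1 - resolventPow ζ (3 / 4) ∘L H.adjoint ∘L
        Ring.inverse (1 + S ∘L H.adjoint) ∘L S ∘L resolventPow ζ (1 / 4) ∧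
      ‖R‖ ≤ (1 - δ)⁻¹ * ‖ζ‖⁻¹ :=
  (exists_resolvent hδ0 hδ1 hb hlam h hζ).imp fun _ hR => hR.imp fun _ hH => hH.imp fun _ hS =>
    ⟨isResolventAt_neg hΛ hS.1, hS.2.2.2⟩

theorem IsWeakSolution.exists_gradient {b : Rd d → Rd d} {δ lam : ℝ}
    (hb : LocallyIntegrable b volume) (hlam : 0 < lam) (h : WeakFormBound b δ lam)
    {u f : L2 d} (hu : IsWeakSolution b u f) :
    ∃ w : Rd d → EuclideanSpace ℂ (Fin d),
      IsSobolevW12 u w ∧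
      MemLp (fun x => dotC (sqrtField b x) (w x)) 2 volume ∧
      (∀ (g : Rd d → ℂ) (v : Rd d → EuclideanSpace ℂ (Fin d)), IsSobolevW12 g v →
        MemLp (fun x => ((√‖b x‖ : ℝ) : ℂ) * g x) 2 volume ∧
        ∫ x, f x * conj (g x) =
          (∫ x, ∑ j, w x j * conj (v x j)) +
            ∫ x, dotC (sqrtField b x) (w x) * conj (((√‖b x‖ : ℝ) : ℂ) * g x)) ∧
      LocallyIntegrable (fun x => dotC (b x) (w x)) volume ∧
      MemBesselPotentialLoc 2 1 u ∧
      (∀ φ : Rd d → ℂ, IsTestFunction φ →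
        ∫ x, f x * conj (φ x) =
          (∫ x, u x * conj (-(Laplacian.laplacian φ x))) +
            ∫ x, dotC (b x) (w x) * conj (φ x)) := by
  obtain ⟨w, hw, hq, hfw⟩ := hu.exists_isSobolevW12 hb.aestronglyMeasurable hlam h
  obtain ⟨hbw, hweak⟩ := sum_integral_gradient_eq hb hw hq hfw
  have hf : LocallyIntegrable f volume := (Lp.memLp f).locallyIntegrable one_le_two
  exact ⟨w, hw, hq, hfw, hbw,
    memBesselPotentialLoc_of_weak hw.hasWeakGradient (hf.sub hbw) hweak,
    fun φ hφ => integral_mul_conj_eq_of_weak hw.hasWeakGradient hf hbw hweak hφ⟩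

end

end WeaklyFormBounded

open WeaklyFormBounded in
theorem mainTheorem5 (d : ℕ) (hd : 3 ≤ d) (δ : ℝ) (hδ0 : 0 ≤ δ) (hδ1 : δ < 1)
    (b : Rd d → Rd d) (hb : b ∈ weakFormClass d δ) :
    ∃ Λ : L2 d →ₗ.[ℂ] L2 d,
      GeneratesQuasiBoundedHolomorphicSemigroup (-Λ) ∧
      (∀ lam : ℝ, 0 < lam → WeakFormBound b δ lam → ∀ ζ : ℂ, lam ≤ ζ.re →
        ∃ R H S : L2 d →L[ℂ] L2 d,
          IsResolventAt (-Λ) ζ R ∧ IsOperatorH b ζ H ∧ IsOperatorS b ζ S ∧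
          ‖H.adjoint ∘L S‖ ≤ δ ∧
          IsUnit (1 + H.adjoint ∘L S) ∧
          R = resolventPow ζ (3 / 4) ∘L Ring.inverse (1 + H.adjoint ∘L S) ∘L
            resolventPow ζ (1 / 4) ∧
          IsUnit (1 + S ∘L H.adjoint) ∧
          R = resolventPow ζ 1 - resolventPow ζ (3 / 4) ∘L H.adjoint ∘L
            Ring.inverse (1 + S ∘L H.adjoint) ∘L S ∘L resolventPow ζ (1 / 4) ∧
          ‖R‖ ≤ (1 - δ)⁻¹ * ‖ζ‖⁻¹) ∧
      (∀ f : Λ.domain, ∃ w : Rd d → EuclideanSpace ℂ (Fin d),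
        IsSobolevW12 (f : L2 d) w ∧
        MemLp (fun x => dotC (sqrtField b x) (w x)) 2 volume ∧
        (∀ (g : Rd d → ℂ) (v : Rd d → EuclideanSpace ℂ (Fin d)), IsSobolevW12 g v →
          MemLp (fun x => ((√‖b x‖ : ℝ) : ℂ) * g x) 2 volume ∧
          ∫ x, (Λ f : L2 d) x * conj (g x) =
            (∫ x, ∑ j, w x j * conj (v x j)) +
              ∫ x, dotC (sqrtField b x) (w x) * conj (((√‖b x‖ : ℝ) : ℂ) * g x)) ∧
        LocallyIntegrable (fun x => dotC (b x) (w x)) volume ∧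
        MemBesselPotentialLoc 2 1 (f : L2 d) ∧
        (∀ φ : Rd d → ℂ, IsTestFunction φ →
          ∫ x, (Λ f : L2 d) x * conj (φ x) =
            (∫ x, (f : L2 d) x * conj (-(Laplacian.laplacian φ x))) +
              ∫ x, dotC (b x) (w x) * conj (φ x))) := by
  exact hb.2.elim fun lam₀ h₀ =>
    (exists_linearPMap_isWeakSolution hδ0 hδ1 hb.1.aestronglyMeasurable h₀.1 h₀.2).imp
      fun Λ hΛ =>
        ⟨generates_neg_of_isWeakSolution hδ0 hδ1 hb.1.aestronglyMeasurable h₀.1 h₀.2 hΛ.1 hΛ.2,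
          fun _ hlam hform _ hζ =>
            exists_resolventAt_neg hδ0 hδ1 hb.1.aestronglyMeasurable hlam hform hΛ.1 hζ,
          fun f => ((hΛ.1 _ _).1 (Λ.mem_graph f)).exists_gradient hb.1 h₀.1 h₀.2⟩
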